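/- **Setting.** Let $M\ge 1$ be an integer, $f:\mathbb Z\to\mathbb C$ an $M$-periodic function and $j\ge 0$ an integer. Put $$\Theta(\tau;j,f,M)=\sum_{n\ge1}n^jf(n)\,e^{i\pi n^2\tau/M}\qquad(\tau\in\mathbb H).$$ For $\alpha\in\mathbb Q$ let $\langle f_{\alpha/M}\rangle$ be the mean value, over one period, of the periodic function $f_{\alpha/M}(m)=f(m)e^{\pi i m^2\alpha/M}$, and let $\mathcal Q_{f,M}=\{\alpha\in\mathbb Q:\langle f_{\alpha/M}\rangle=0\}$. **Strong quantum modular forms.** Let $\mathcal Q\subset\mathbb Q$, let $\Gamma$ be a subgroup of $\mathrm{SL}(2,\mathbb Z)$ leaving $\mathcal Q\cup\{\infty\}$ invariant, let $w\in\frac12\mathbb Z$ and $\varepsilon:\Gamma\to\mathbb C^*$. For $\gamma=\begin{pmatrix}a&b\\c&d\end{pmatrix}\in\Gamma$ put $J_\gamma(\alpha)=c\alpha+d$. Half-integral powers of $J_\gamma$ near a real point are integral powers of the branch of $J_\gamma^{1/2}$ that is positive where $c\alpha+d>0$ and, where $c\alpha+d<0$, lies in $-i\mathbb R_{>0}$ if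 $c>0$ and in $i\mathbb R_{>0}$ if $c\le0$. The modularity defect at $\gamma$ of a family $\widetilde\varphi=(\widetilde\varphi_\alpha)_{\alpha\in\mathcal Q}$ of power series in $\mathbb C[[T]]$ is the family $$\widetilde h_{\gamma,\alpha}(T)=\widetilde\varphi_\alpha(T)-\varepsilon(\gamma)\,\bigl(c(\alpha+T)+d\bigr)^{-w}\,\widetilde\varphi_{\gamma\alpha}\bigl(\gamma(\alpha+T)-\gamma\alpha\bigr),\qquad \alpha\in\mathcal Q,\ c\alpha+d\ne0 .$$ Strong quantum modular forms of depth $N$, weight $w$ and multiplier $\varepsilon$ on $\Gamma$ with quantum set $\mathcal Q$ are defined by induction on $N$. Those of depth $0$ are the constants: $\widetilde\varphi_\alpha=z\in\mathbb C$ for all $\alpha\in\mathcal Q$. For $N\ge1$, $\widetilde\varphi$ is one of depth $N$ if for every $\gamma\in\Gamma$ there are an open set $R_\gamma\subset\mathbb R$ containing all $\alpha\in\mathcal Q$ with $c\alpha+d\neq0$, finitely many functions $g_1,\dots,g_m$ ($m\ge1$) holomorphic on a neighbourhood of $R_\gamma$ in $\mathbb C$, and strong quantum modular forms $\widetilde\psi^{(1)},\dots,\widetilde\psi^{(m)}$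 on $\Gamma$ with quantum set $\mathcal Q$, each of some depth $<N$, some weight in $\frac12\mathbb Z$ and some multiplier, such that, for all $\alpha\in\mathcal Q$ with $c\alpha+d\ne0$, $$\widetilde h_{\gamma,\alpha}(T)=\sum_{i=1}^m g_i(\alpha+T)\,\widetilde\psi^{(i)}_\alpha(T),$$ where $g_i(\alpha+T)$ stands for the Taylor series of $g_i$ at $\alpha$. A function $\phi:\mathbb H\to\mathbb C$ is called a strong quantum modular form of depth $N$ and weight $w$ on $\Gamma$ with quantum set $\mathcal Q$ if $\Gamma$ leaves $\mathcal Q\cup\{\infty\}$ invariant and $\phi$ has, at each $\alpha\in\mathcal Q$, a Poincaré asymptotic expansion $\phi(\alpha+T)\sim\widetilde\varphi_\alpha(T)\in\mathbb C[[T]]$ as $T\to0$ in $\mathbb H$ with $\arg T$ in any compact subinterval of $(0,\pi)$, such that $(\widetilde\varphi_\alpha)_{\alpha\in\mathcal Q}$ is a strong quantum modular form of depth $N$, weight $w$ and some multiplier on $\Gamma$ with quantum set $\mathcal Q$. **Statement.** Suppose that $f(0)=0$ and that there is $n_0\in\mathbb Z$ such that, for all $n\in\mathbb Z$, $f(n)\ne0$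 implies $n^2\equiv n_0^2 \pmod{2M}$. Suppose moreover that either $j$ is even and $f$ is odd, or $j$ is odd and $f$ is even. Then $\Theta(\cdot\,;j,f,M)$ is a strong quantum modular form of depth $[j/2]+1$ and weight $j+\frac12$ on $\Gamma_1(2M)$, with quantum set $\mathcal Q_{f,M}$. -/

import Mathlib

open scoped MatrixGroups UpperHalfPlane PowerSeries

noncomputable section

namespace QuantumModular

/-! ### The action of `SL(2, ℤ)` on the cusps and the automorphy factor -/

/-- `J_γ(α) = c α + d` for `γ = (a b; c d)` and rational `α`. -/
def J (γ : SL(2, ℤ)) (α : ℚ) : ℚ := (γ 1 0 : ℚ) * α + (γ 1 1 : ℚ)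

/-- `γ α = (a α + b) / (c α + d)`, used only when `c α + d ≠ 0`. -/
def act (γ : SL(2, ℤ)) (α : ℚ) : ℚ := ((γ 0 0 : ℚ) * α + (γ 0 1 : ℚ)) / J γ α

/-- `Q ∪ {∞}` is stable under the action of `Γ` on `ℚ ∪ {∞}`. -/
def LeavesInvariant (Γ : Subgroup SL(2, ℤ)) (Q : Set ℚ) : Prop :=
  ∀ γ ∈ Γ, ∀ x ∈ insert (OnePoint.infty : OnePoint ℚ) ((↑) '' Q),
    Matrix.SpecialLinearGroup.mapGL ℚ γ • x ∈
      insert (OnePoint.infty : OnePoint ℚ) ((↑) '' Q)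

/-- On rational points that are not sent to `∞`, the action on `OnePoint ℚ` is `act`. -/
theorem mapGL_smul_coe (γ : SL(2, ℤ)) (α : ℚ) (h : J γ α ≠ 0) :
    Matrix.SpecialLinearGroup.mapGL ℚ γ • (α : OnePoint ℚ) = (act γ α : OnePoint ℚ) := by
  rw [OnePoint.smul_some_eq_ite]
  simp only [J] at h
  simp [act, J, h]

/-- The branch of `J_γ(α)^{1/2}` for real (here rational) `α`: it is positive if `c α + d > 0`,
and if `c α + d < 0` it lies in `-i ℝ_{>0}` when `c > 0` and in `i ℝ_{>0}` when `c ≤ 0`. -/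
def sqrtJ (γ : SL(2, ℤ)) (α : ℚ) : ℂ :=
  if 0 ≤ J γ α then (Real.sqrt (J γ α : ℝ) : ℂ)
  else if 0 < γ 1 0 then -Complex.I * (Real.sqrt (-(J γ α : ℝ)) : ℂ)
  else Complex.I * (Real.sqrt (-(J γ α : ℝ)) : ℂ)

/-- The formal series `(c (α + T) + d)^{-k/2} = J^{-k/2} (1 + (c / J) T)^{-k/2}` in `T`, where
`J = c α + d ≠ 0` and `J^{-k/2}` is taken with the branch `sqrtJ`. The weight is `k / 2`. -/
def automorphySeries (k : ℤ) (γ : SL(2, ℤ)) (α : ℚ) : ℂ⟦X⟧ :=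
  PowerSeries.C (sqrtJ γ α ^ (-k)) *
    PowerSeries.rescale ((γ 1 0 : ℂ) / (J γ α : ℂ))
      (PowerSeries.binomialSeries ℂ (-(k : ℂ) / 2))

/-- The formal series `γ (α + T) - γ α` in `T`, for `c α + d ≠ 0`. -/
def increment (γ : SL(2, ℤ)) (α : ℚ) : ℂ⟦X⟧ :=
  (PowerSeries.C (γ 0 0 : ℂ) * (PowerSeries.C (α : ℂ) + PowerSeries.X)
      + PowerSeries.C (γ 0 1 : ℂ)) *
    (PowerSeries.C (γ 1 0 : ℂ) * (PowerSeries.C (α : ℂ) + PowerSeries.X)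
      + PowerSeries.C (γ 1 1 : ℂ))⁻¹
  - PowerSeries.C (act γ α : ℂ)

/-- The increment has no constant term, so that it can be substituted in any power series. -/
theorem hasSubst_increment (γ : SL(2, ℤ)) (α : ℚ) :
    PowerSeries.HasSubst (increment γ α) := by
  apply PowerSeries.HasSubst.of_constantCoeff_zero'
  simp [increment, act, J, div_eq_mul_inv]

/-- The modularity defect
`φ_α(T) - ε (c (α + T) + d)^{-k/2} φ_{γα}(γ (α + T) - γ α)` of a family of power series. -/
def defect (k : ℤ) (e : ℂˣ) (γ : SL(2, ℤ)) (φ : ℚ → ℂ⟦X⟧) (α : ℚ) : ℂ⟦X⟧ :=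
  φ α - PowerSeries.C (e : ℂ) * automorphySeries k γ α *
    PowerSeries.subst (increment γ α) (φ (act γ α))

/-- The Taylor series of `g (α + T)` at `T = 0`. -/
def taylorSeries (g : ℂ → ℂ) (α : ℚ) : ℂ⟦X⟧ :=
  PowerSeries.mk fun n => iteratedDeriv n g (α : ℂ) / (n.factorial : ℂ)

/-! ### Strong quantum modular forms of higher depth -/

/-- The space of strong quantum modular forms of depth `N`, weight `k / 2` and multiplier `ε` on
`Γ`, with quantum set `Q`. A family `(φ_α)_{α ∈ Q}` of formal power series is given as a function
on `ℚ` of which only the values on `Q` matter.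

* Depth `0`: the constants.
* Depth `N ≥ 1`: for each `γ ∈ Γ` there is an open `R ⊆ ℝ` containing the domain
  `Q ∖ {-d/c}` of the modularity defect, such that the defect is a finite sum of products
  `g_i · ψ_i`, with `g_i` holomorphic on (a neighbourhood in `ℂ` of) `R` and `ψ_i` a strong quantum
  modular form of depth `n_i < N`, of some weight and some multiplier.

For `N = 1` this says that the defect at `α` is the Taylor series at `α` of one function that is
holomorphic on `R` and does not depend on `α`. -/
def StrongQMF (Q : Set ℚ) (Γ : Subgroup SL(2, ℤ)) (N : ℕ) (k : ℤ) (ε : Γ → ℂˣ) :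
    Set (ℚ → ℂ⟦X⟧) :=
  match N with
  | 0 => {φ | ∃ z : ℂ, ∀ α ∈ Q, φ α = PowerSeries.C z}
  | N + 1 => {φ | ∀ γ : Γ, ∃ R : Set ℝ, IsOpen R ∧
      (∀ α ∈ Q, J (γ : SL(2, ℤ)) α ≠ 0 → (α : ℝ) ∈ R) ∧
      ∃ (m : ℕ) (n : Fin m → Fin (N + 1)) (l : Fin m → ℤ) (η : Fin m → Γ → ℂˣ)
        (g : Fin m → ℂ → ℂ) (ψ : Fin m → ℚ → ℂ⟦X⟧),
        0 < m ∧
        (∀ i, AnalyticOnNhd ℂ (g i) ((fun x : ℝ => (x : ℂ)) '' R)) ∧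
        (∀ i, ψ i ∈ StrongQMF Q Γ (n i : ℕ) (l i) (η i)) ∧
        ∀ α ∈ Q, J (γ : SL(2, ℤ)) α ≠ 0 →
          defect k (ε γ) (γ : SL(2, ℤ)) φ α = ∑ i, taylorSeries (g i) α * ψ i α}
termination_by N
decreasing_by exact (n i).isLt

/-- `Σ a_m T^m` is the Poincaré asymptotic expansion of `φ (α + T)` as `T → 0` non-tangentially
in the upper half-plane, i.e. with `arg T` in an arbitrary compact subinterval of `(0, π)`. -/
def HasAsymptoticExpansionAt (φ : ℍ → ℂ) (α : ℚ) (s : ℂ⟦X⟧) : Prop :=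
  ∀ δ : ℝ, 0 < δ → ∀ N : ℕ, ∃ C r : ℝ, 0 < r ∧ ∀ τ : ℍ,
    ‖(τ : ℂ) - α‖ < r →
    Complex.arg ((τ : ℂ) - α) ∈ Set.Icc δ (Real.pi - δ) →
    ‖φ τ - ∑ m ∈ Finset.range N, PowerSeries.coeff m s * ((τ : ℂ) - α) ^ m‖
      ≤ C * ‖(τ : ℂ) - α‖ ^ N

/-- The function `φ` on the upper half-plane is a strong quantum modular form on `Γ` of depth `N`,
weight `k / 2` and quantum set `Q`, for some multiplier `ε`: `Γ` leaves `Q ∪ {∞}` invariant, and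
`φ` has asymptotic expansions at the points of `Q` that form a strong quantum modular form. -/
def IsStrongQMF (φ : ℍ → ℂ) (Q : Set ℚ) (Γ : Subgroup SL(2, ℤ)) (N : ℕ) (k : ℤ) : Prop :=
  LeavesInvariant Γ Q ∧
  ∃ (s : ℚ → ℂ⟦X⟧) (ε : Γ → ℂˣ),
    (∀ α ∈ Q, HasAsymptoticExpansionAt φ α (s α)) ∧ s ∈ StrongQMF Q Γ N k ε

/-! ### Partial theta series -/

/-- `Θ(τ; j, f, M) = ∑_{n ≥ 1} n^j f(n) exp(i π n² τ / M)`. -/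
def partialTheta (j : ℕ) (f : ℤ → ℂ) (M : ℕ) (τ : ℍ) : ℂ :=
  ∑' n : ℕ+, (n : ℂ) ^ j * f (n : ℕ) *
    Complex.exp (Real.pi * Complex.I * (n : ℂ) ^ 2 * (τ : ℂ) / (M : ℂ))

/-- `f_{α/M}(m) = f(m) exp(π i m² α / M)`. -/
def twist (f : ℤ → ℂ) (M : ℕ) (α : ℚ) (m : ℤ) : ℂ :=
  f m * Complex.exp (Real.pi * Complex.I * (m : ℂ) ^ 2 * (α : ℂ) / (M : ℂ))

/-- `2 M den(α)` is a period of `f_{α/M}` when `f` is `M`-periodic. -/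
theorem twist_periodic {f : ℤ → ℂ} {M : ℕ} (hM : 0 < M) (hf : Function.Periodic f (M : ℤ))
    (α : ℚ) : Function.Periodic (twist f M α) ((2 * M * α.den : ℕ) : ℤ) := by
  intro m
  have h1 : f (m + ((2 * M * α.den : ℕ) : ℤ)) = f m := by
    have h := hf.int_mul (2 * α.den) m
    rw [← h]
    congr 1
    push_cast
    ring
  have hM' : (M : ℂ) ≠ 0 := by exact_mod_cast hM.ne'
  have hd : (α.den : ℂ) ≠ 0 := by exact_mod_cast α.den_nz
  have hα : (α : ℂ) = (α.num : ℂ) / (α.den : ℂ) := Rat.cast_def α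
  have h2 : Complex.exp (Real.pi * Complex.I * ((m + ((2 * M * α.den : ℕ) : ℤ) : ℤ) : ℂ) ^ 2 *
        (α : ℂ) / (M : ℂ))
      = Complex.exp (Real.pi * Complex.I * (m : ℂ) ^ 2 * (α : ℂ) / (M : ℂ)) := by
    rw [Complex.exp_eq_exp_iff_exists_int]
    refine ⟨2 * m * α.num + 2 * M * α.den * α.num, ?_⟩
    rw [hα]
    push_cast
    field_simp
    ring
  simp only [twist, h1, h2]

/-- The mean value `⟨f_{α/M}⟩` over one period of `f_{α/M}`. -/
def twistMean (f : ℤ → ℂ) (M : ℕ) (α : ℚ) : ℂ :=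
  (∑ m ∈ Finset.Icc 1 (2 * M * α.den), twist f M α (m : ℕ)) / ((2 * M * α.den : ℕ) : ℂ)

/-- The quantum set `Q_{f,M} = {α ∈ ℚ | ⟨f_{α/M}⟩ = 0}`. -/
def quantumSet (f : ℤ → ℂ) (M : ℕ) : Set ℚ := {α | twistMean f M α = 0}

end QuantumModular

end

noncomputable section
namespace QuantumModular

open Filter Asymptotics Topology PowerSeries

/-! ### Asymptotic expansions along a filter -/

/-! The operator `M / (π i) d/dτ` multiplies the `n`-th term of the series by `n ^ 2`. So every case
is an iterated derivative of a base series with `j = 0` (`f` odd) or `j = 1` (`f` even), and it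
suffices that the base series has depth one and that each derivative raises the depth by at most
one.

Depth. Differentiating the defect of a family of weight `k / 2` gives the defect of its derivative
in weight `k / 2 + 2`, except that the derivative of the automorphy factor contributes a multiple `c
/ (c τ + d)` of the family minus its defect (`defect_derivative`). By induction the defect of the
`m`-th derivative is a combination, with holomorphic coefficients, of `1` and the derivatives of
order `< m` (`isCombination_defect_derivFamily`, `derivFamily_mem_strongQMF`).

Base series, functional equation. For `γ` with `c ≠ 0`, seen from the cusp `-d/c` the base series is
a theta series in `w = sign(c) (c τ + d)` with coefficients `F(n) = f(n) exp(-π i n² d / (c M))` of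
period `P = |c| M`. With one more factor `n`, the series `g = ∑ n^(j+1) F(n) exp(π i n² z / P)` is
an honest theta function for `j = 0` and the derivative of one for `j = 1`, up to a constant. It has
an inversion formula under `z ↦ -1/z` involving the finite Fourier transform of `F`, and decays
rapidly at `0` and at infinity since `F` and its transform vanish at `0`. Integrate `g` along a ray
from `0` against the kernel of exponent `-1/2`. Moving the start of the ray to `w` splits this
integral in two: the ray from `w` is a Laplace transform that removes one factor `n` and returns the
base series at `w`; the segment from `0` to `w`, after inversion, is a Laplace transform of the dual
theta functions and returns the dual base series at `-1/w` (`IsThetaCoeff.eichlerIntegral_eq`). A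
Gauss sum computation using `Γ₁(2M)` and the support condition shows that the transform of `F` is a
constant times the twist of `f` at `a/c` (`IsGammaOne.exists_dft_twist`), so the dual value is the
base series at `γ τ` up to a constant. The full integral is holomorphic in `τ` across the real line
on each side of `-d/c` (`differentiableOn_eichlerIntegral`): it is the defect (`exists_hasDefect`).

Base series, expansions. At `α` in the quantum set the same identity is used with the twist at `α`
and a slanted ray. The dual term is then exponentially small, and the integral is expanded by the
binomial series of its kernel (`IsThetaCoeff.exists_hasExpansion`). Uniqueness of expansions turns
the functional equation into the identity of formal series (`defect_eq_taylorSeries`).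

Invariance. If `f` is odd, every rational is in the quantum set. If `f` is even, membership of `α`
means that `∑ f(n) exp(π i n² τ / M)` is `o(|τ - α|^(-1/2))` in cones at `α`, and this condition is
preserved because that series is modular up to constants (`act_mem_quantumSet`). The image `a/c` of
`∞` is in the set because the relevant Gauss sum is a multiple of `f 0`. -/

/-- The function `u` has the asymptotic expansion `s` at `0` along the filter `l`. -/
def HasExpansion (l : Filter ℂ) (u : ℂ → ℂ) (s : ℂ⟦X⟧) : Prop :=
  ∀ N : ℕ, (fun T => u T - (trunc N s).eval T) =O[l] fun T => T ^ N

theorem isBigO_eval_of_coeff_eq_zero {l : Filter ℂ} (hl : l ≤ 𝓝 0) {N : ℕ} {p : Polynomial ℂ}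
    (hp : ∀ m < N, p.coeff m = 0) : (fun T => p.eval T) =O[l] fun T => T ^ N := by
  obtain ⟨q, rfl⟩ := Polynomial.X_pow_dvd_iff.2 hp
  have hq : (fun T => q.eval T) =O[l] fun _ => (1 : ℂ) :=
    ((q.continuous.tendsto 0).isBigO_one ℂ).mono hl
  simpa using (isBigO_refl (fun T : ℂ => T ^ N) l).mul hq

/-- Terms of degree at least `N` are `O(T ^ N)` anyway, so the exact truncation need not be
produced; products of truncations, for instance, are allowed. -/
theorem HasExpansion.of_polynomial {l : Filter ℂ} (hl : l ≤ 𝓝 0) {u : ℂ → ℂ} {s : ℂ⟦X⟧}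
    (h : ∀ N, ∃ p : Polynomial ℂ, (∀ m < N, p.coeff m = coeff m s) ∧
      (fun T => u T - p.eval T) =O[l] fun T => T ^ N) : HasExpansion l u s := by
  intro N
  obtain ⟨p, hp, hu⟩ := h N
  have := isBigO_eval_of_coeff_eq_zero hl (N := N) (p := p - trunc N s) (by
    intro m hm
    simp [coeff_trunc, hm, hp m hm])
  refine (hu.add this).congr_left fun T => ?_
  simp

theorem HasExpansion.mono {l l' : Filter ℂ} {u : ℂ → ℂ} {s : ℂ⟦X⟧} (h : HasExpansion l u s)
    (hl : l' ≤ l) : HasExpansion l' u s := fun N => (h N).mono hl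

theorem HasExpansion.congr {l : Filter ℂ} {u u' : ℂ → ℂ} {s : ℂ⟦X⟧} (h : HasExpansion l u s)
    (hu : u =ᶠ[l] u') : HasExpansion l u' s := fun N =>
  (h N).congr' (hu.mono fun T hT => by simp [hT]) .rfl

theorem HasExpansion.add {l : Filter ℂ} {u u' : ℂ → ℂ} {s s' : ℂ⟦X⟧} (h : HasExpansion l u s)
    (h' : HasExpansion l u' s') : HasExpansion l (fun T => u T + u' T) (s + s') := fun N =>
  ((h N).add (h' N)).congr_left fun T => by simp; ring

theorem HasExpansion.neg {l : Filter ℂ} {u : ℂ → ℂ} {s : ℂ⟦X⟧} (h : HasExpansion l u s) :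
    HasExpansion l (fun T => - u T) (-s) := fun N =>
  (h N).neg_left.congr_left fun T => by
    have : trunc N (-s) = - trunc N s := by ext; simp [coeff_trunc]
    simp [this]; ring

theorem HasExpansion.sub {l : Filter ℂ} {u u' : ℂ → ℂ} {s s' : ℂ⟦X⟧} (h : HasExpansion l u s)
    (h' : HasExpansion l u' s') : HasExpansion l (fun T => u T - u' T) (s - s') := by
  simpa [sub_eq_add_neg] using h.add h'.neg

theorem hasExpansion_polynomial {l : Filter ℂ} (hl : l ≤ 𝓝 0) (p : Polynomial ℂ) :
    HasExpansion l (fun T => p.eval T) (p : ℂ⟦X⟧) :=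
  .of_polynomial hl fun N => ⟨p, fun m _ => by simp, by simpa using isBigO_zero _ _⟩

theorem hasExpansion_const {l : Filter ℂ} (hl : l ≤ 𝓝 0) (z : ℂ) :
    HasExpansion l (fun _ => z) (C z) := by
  simpa using hasExpansion_polynomial hl (Polynomial.C z)

theorem HasExpansion.isBigO_one {l : Filter ℂ} {u : ℂ → ℂ} {s : ℂ⟦X⟧}
    (h : HasExpansion l u s) : u =O[l] fun _ => (1 : ℂ) := by
  simpa using h 0

theorem HasExpansion.mul {l : Filter ℂ} (hl : l ≤ 𝓝 0) {u u' : ℂ → ℂ} {s s' : ℂ⟦X⟧}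
    (h : HasExpansion l u s)
    (h' : HasExpansion l u' s') : HasExpansion l (fun T => u T * u' T) (s * s') := by
  refine .of_polynomial hl fun N => ⟨trunc N s * trunc N s', fun m hm => ?_, ?_⟩
  · rw [coeff_mul_eq_coeff_trunc_mul_trunc s s' hm, ← Polynomial.coe_mul, Polynomial.coeff_coe]
  · have h1 := (h N).mul h'.isBigO_one
    have h2 : (fun T => (trunc N s).eval T) =O[l] fun _ => (1 : ℂ) :=
      (((trunc N s).continuous.tendsto 0).isBigO_one ℂ).mono hl
    have h3 := h2.mul (h' N)
    simp only [mul_one, one_mul] at h1 h3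
    refine (h1.add h3).congr_left fun T => ?_
    rw [Polynomial.eval_mul]
    ring

theorem HasExpansion.pow {l : Filter ℂ} (hl : l ≤ 𝓝 0) {u : ℂ → ℂ} {s : ℂ⟦X⟧}
    (h : HasExpansion l u s) (n : ℕ) : HasExpansion l (fun T => u T ^ n) (s ^ n) := by
  induction n with
  | zero => simpa using hasExpansion_const hl 1
  | succ n ih => simpa [pow_succ] using ih.mul hl h

theorem HasExpansion.polynomial_comp {l : Filter ℂ} (hl : l ≤ 𝓝 0) {u : ℂ → ℂ} {s : ℂ⟦X⟧}
    (h : HasExpansion l u s) (p : Polynomial ℂ) :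
    HasExpansion l (fun T => p.eval (u T)) (Polynomial.aeval s p) := by
  induction p using Polynomial.induction_on' with
  | add p q hp hq => simpa using hp.add hq
  | monomial n a =>
    have := (hasExpansion_const hl a).mul hl (h.pow hl n)
    simpa [Polynomial.aeval_monomial] using this

theorem HasExpansion.isBigO_id {l : Filter ℂ} {t : ℂ → ℂ} {s : ℂ⟦X⟧}
    (h : HasExpansion l t s) (hs : constantCoeff s = 0) : t =O[l] fun T => T := by
  simpa [trunc_one_left, hs] using h 1

/-- As `r` has no constant term, `t = O(T)`, so an error `O(t ^ N)` is an error `O(T ^ N)`. -/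
theorem HasExpansion.comp {l l' : Filter ℂ} (hl : l ≤ 𝓝 0) {u t : ℂ → ℂ} {s r : ℂ⟦X⟧}
    (h : HasExpansion l' u s) (ht : HasExpansion l t r) (hr : constantCoeff r = 0)
    (htl : Tendsto t l l') :
    HasExpansion l (fun T => u (t T)) (s.subst r) := by
  have hS : HasSubst r := .of_constantCoeff_zero' hr
  intro N
  have h1 : (fun T => u (t T) - (trunc N s).eval (t T)) =O[l] fun T => T ^ N :=
    ((h N).comp_tendsto htl).trans ((ht.isBigO_id hr).pow N)
  have h2 := ht.polynomial_comp hl (trunc N s) N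
  -- The discarded tail `X ^ N * q` of `s` becomes a multiple of `r ^ N`, and `X` divides `r`.
  have h3 : trunc N (Polynomial.aeval r (trunc N s)) = trunc N (s.subst r) := by
    rw [← subst_coe hS]
    conv_rhs => rw [eq_X_pow_mul_shift_add_trunc N s, subst_add hS, subst_mul hS, subst_pow hS,
      subst_X hS]
    obtain ⟨q, rfl⟩ := X_dvd_iff.2 hr
    rw [map_add, mul_pow, mul_assoc, trunc_X_pow_self_mul, zero_add]
  rw [h3] at h2
  exact (h1.add h2).congr_left fun T => by ring

/-- If the difference had a lowest nonzero coefficient, in degree `n`, then `T ^ n = O(T ^ (n +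
1))`, which is impossible along a nontrivial filter tending to `0` and avoiding it. Identities
between functions become identities between formal series through this lemma. -/
theorem HasExpansion.unique {l : Filter ℂ} (hl : l ≤ 𝓝[≠] 0) [l.NeBot] {u : ℂ → ℂ}
    {s s' : ℂ⟦X⟧} (h : HasExpansion l u s) (h' : HasExpansion l u s') : s = s' := by
  rw [← sub_eq_zero]
  by_contra hne
  have h0 := h.sub h'
  simp only [sub_self] at h0
  set d := s - s'
  obtain ⟨n, hn, hmin⟩ : ∃ n, coeff n d ≠ 0 ∧ ∀ m < n, coeff m d = 0 := by
    have hex : ∃ n, coeff n d ≠ 0 := by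
      by_contra! hall
      exact hne (by ext n; simpa using hall n)
    classical
    exact ⟨Nat.find hex, Nat.find_spec hex, fun m hm => by simpa using Nat.find_min hex hm⟩
  have htr : trunc (n + 1) d = Polynomial.C (coeff n d) * Polynomial.X ^ n := by
    ext m
    rw [coeff_trunc, Polynomial.coeff_C_mul_X_pow]
    rcases lt_trichotomy m n with hm | rfl | hm
    · simp [hm.ne, hmin m hm]
    · simp
    · simp [hm.ne', show ¬ m < n + 1 by omega]
  have h1 := h0 (n + 1)
  simp only [htr, zero_sub, Polynomial.eval_mul, Polynomial.eval_C, Polynomial.eval_pow,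
    Polynomial.eval_X] at h1
  have h2 : (fun T : ℂ => T ^ n) =O[l] fun T => T ^ (n + 1) := by
    refine ((h1.neg_left).const_mul_left (coeff n d)⁻¹).congr_left fun T => ?_
    field_simp
  obtain ⟨K, hK⟩ := h2.bound
  have h3 : ∀ᶠ T : ℂ in l, 1 ≤ K * ‖T‖ := by
    filter_upwards [hK, hl self_mem_nhdsWithin] with T hT hT0
    have : 0 < ‖T‖ ^ n := pow_pos (norm_pos_iff.2 hT0) n
    rw [norm_pow, norm_pow, pow_succ] at hT
    nlinarith
  have h4 : Tendsto (fun T : ℂ => K * ‖T‖) l (𝓝 (K * ‖(0 : ℂ)‖)) :=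
    ((continuous_const.mul continuous_norm).tendsto 0).mono_left (hl.trans nhdsWithin_le_nhds)
  have := ge_of_tendsto h4 h3
  norm_num at this

theorem hasExpansion_of_hasFPowerSeriesAt {u : ℂ → ℂ} {x : ℂ} {c : ℕ → ℂ}
    (h : HasFPowerSeriesAt u (FormalMultilinearSeries.ofScalars ℂ c) x) :
    HasExpansion (𝓝 0) (fun T => u (x + T)) (PowerSeries.mk c) := by
  intro N
  refine ((h.isBigO_sub_partialSum_pow N).trans ?_).congr_left fun T => ?_
  · simpa using (isBigO_refl (fun y : ℂ => y ^ N) (𝓝 0)).norm_left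
  · simp [FormalMultilinearSeries.partialSum, Polynomial.eval, eval₂_trunc_eq_sum_range, mul_comm]

theorem hasExpansion_taylorSeries {g : ℂ → ℂ} {α : ℚ} (h : AnalyticAt ℂ g α) :
    HasExpansion (𝓝 0) (fun T => g (α + T)) (taylorSeries g α) :=
  hasExpansion_of_hasFPowerSeriesAt h.hasFPowerSeriesAt

theorem hasExpansion_binomialSeries (a : ℂ) :
    HasExpansion (𝓝 0) (fun T => (1 + T) ^ a) (PowerSeries.binomialSeries ℂ a) := by
  have h : HasFPowerSeriesAt (fun x : ℂ ↦ (1 + x) ^ a)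
    (FormalMultilinearSeries.ofScalars ℂ fun n => Ring.choose a n) 0 :=
    Complex.one_add_cpow_hasFPowerSeriesAt_zero
  have := hasExpansion_of_hasFPowerSeriesAt h
  convert this using 1
  · simp
  · ext n; simp

/-! ### Cones in the upper half-plane -/

/-- The cone of opening `κ` in the upper half-plane. -/
def cone (κ : ℝ) : Set ℂ := {T | T ≠ 0 ∧ κ * ‖T‖ ≤ T.im}

/-- The asymptotic expansion of `φ (α + T)` as `T → 0` in cones of the upper half-plane. -/
def ConeExpansion (φ : ℂ → ℂ) (α : ℂ) (s : ℂ⟦X⟧) : Prop :=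
  ∀ κ : ℝ, 0 < κ → HasExpansion (𝓝[cone κ] 0) (fun T => φ (α + T)) s

theorem nhdsWithin_cone_le (κ : ℝ) : 𝓝[cone κ] (0 : ℂ) ≤ 𝓝[≠] 0 :=
  nhdsWithin_mono _ fun _ hT => hT.1

theorem nhdsWithin_cone_le_nhds (κ : ℝ) : 𝓝[cone κ] (0 : ℂ) ≤ 𝓝 0 := nhdsWithin_le_nhds

theorem im_pos_of_mem_cone {κ : ℝ} (hκ : 0 < κ) {T : ℂ} (hT : T ∈ cone κ) : 0 < T.im :=
  (mul_pos hκ (norm_pos_iff.2 hT.1)).trans_le hT.2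

theorem mul_I_mem_cone {κ : ℝ} (hκ : κ ≤ 1) {t : ℝ} (ht : 0 < t) :
    (t : ℂ) * Complex.I ∈ cone κ := by
  refine ⟨by simp [ht.ne'], ?_⟩
  simp only [norm_mul, Complex.norm_real, Complex.norm_I, mul_one, Complex.mul_im,
    Complex.ofReal_re, Complex.I_im, Complex.ofReal_im, Complex.I_re, mul_zero, add_zero]
  rw [Real.norm_of_nonneg ht.le]
  nlinarith

theorem tendsto_mul_I_cone {κ : ℝ} (hκ : κ ≤ 1) :
    Tendsto (fun t : ℝ => (t : ℂ) * Complex.I) (𝓝[>] 0) (𝓝[cone κ] 0) := by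
  refine tendsto_nhdsWithin_iff.2 ⟨?_, ?_⟩
  · have : Continuous fun t : ℝ => (t : ℂ) * Complex.I := by fun_prop
    simpa using (this.tendsto 0).mono_left nhdsWithin_le_nhds
  · filter_upwards [self_mem_nhdsWithin] with t ht
    exact mul_I_mem_cone hκ ht

theorem nhdsWithin_cone_neBot {κ : ℝ} (hκ : κ ≤ 1) : (𝓝[cone κ] (0 : ℂ)).NeBot :=
  (tendsto_mul_I_cone hκ).neBot

theorem cone_anti {κ κ' : ℝ} (h : κ ≤ κ') : cone κ' ⊆ cone κ := fun _ hT =>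
  ⟨hT.1, (mul_le_mul_of_nonneg_right h (norm_nonneg _)).trans hT.2⟩

theorem ConeExpansion.unique {φ : ℂ → ℂ} {α : ℂ} {s s' : ℂ⟦X⟧} (h : ConeExpansion φ α s)
    (h' : ConeExpansion φ α s') : s = s' := by
  have := nhdsWithin_cone_neBot (κ := 1) le_rfl
  exact (h 1 one_pos).unique (nhdsWithin_cone_le 1) (h' 1 one_pos)

/-- Expansions that exist in each cone are automatically compatible. -/
theorem exists_coneExpansion {φ : ℂ → ℂ} {α : ℂ}
    (h : ∀ κ : ℝ, 0 < κ → ∃ s, HasExpansion (𝓝[cone κ] 0) (fun T => φ (α + T)) s) :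
    ∃ s, ConeExpansion φ α s := by
  obtain ⟨s, hs⟩ := h 1 one_pos
  refine ⟨s, fun κ hκ => ?_⟩
  obtain ⟨s', hs'⟩ := h (min κ 1) (by positivity)
  have hne := nhdsWithin_cone_neBot (κ := 1) le_rfl
  have := hs.unique (nhdsWithin_cone_le 1)
    (hs'.mono (nhdsWithin_mono _ (cone_anti (min_le_right _ _))))
  exact this ▸ hs'.mono (nhdsWithin_mono _ (cone_anti (min_le_left _ _)))

/-- Discs of radius proportional to `‖T‖` stay in a slightly wider cone, which is what Cauchy's
estimate needs. -/
theorem mem_cone_of_dist_le {κ : ℝ} (hκ : 0 < κ) (hκ1 : κ ≤ 1) {T T' : ℂ} (hT : T ∈ cone κ)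
    (h : ‖T' - T‖ ≤ κ / 4 * ‖T‖) : T' ∈ cone (κ / 4) ∧ ‖T'‖ ≤ 2 * ‖T‖ := by
  have h0 : 0 < ‖T‖ := norm_pos_iff.2 hT.1
  have h1 : ‖T'‖ ≤ ‖T‖ + κ / 4 * ‖T‖ := by
    calc ‖T'‖ = ‖T + (T' - T)‖ := by ring_nf
      _ ≤ _ := (norm_add_le _ _).trans (by linarith)
  have h2 : T.im - κ / 4 * ‖T‖ ≤ T'.im := by
    have := (Complex.abs_im_le_norm (T' - T)).trans h
    rw [Complex.sub_im] at this
    linarith [(abs_le.1 this).1]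
  have h3 := hT.2
  have h4 : κ * ‖T‖ ≤ ‖T‖ := by nlinarith
  have h5 : 0 < κ * ‖T‖ := by positivity
  refine ⟨⟨?_, ?_⟩, by linarith⟩
  · rintro rfl
    simp only [Complex.zero_im] at h2
    linarith
  · have : κ / 4 * ‖T'‖ ≤ κ / 4 * (2 * ‖T‖) := by gcongr; linarith
    linarith

/-- Cauchy's estimate on a circle of radius comparable to `‖T‖` costs one power of `T`; the
remainder of order `N + 1` is used to pay for it. -/
theorem ConeExpansion.deriv {φ : ℂ → ℂ} {α : ℂ} (hα : α.im = 0) {s : ℂ⟦X⟧}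
    (hφ : DifferentiableOn ℂ φ {z | 0 < z.im})
    (h : ConeExpansion φ α s) : ConeExpansion (_root_.deriv φ) α (d⁄dX ℂ s) := by
  suffices H : ∀ κ : ℝ, 0 < κ → κ ≤ 1 →
      HasExpansion (𝓝[cone κ] 0) (fun T => _root_.deriv φ (α + T)) (d⁄dX ℂ s) from
    fun κ hκ => (H (min κ 1) (by positivity) (min_le_right _ _)).mono
      (nhdsWithin_mono _ (cone_anti (min_le_left _ _)))
  intro κ hκ hκ1 N
  obtain ⟨K, hK⟩ := (h (κ / 4) (by positivity) (N + 1)).bound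
  obtain ⟨r, hr, hb⟩ := Metric.mem_nhdsWithin_iff.1 hK
  refine .of_bound (4 / κ * (|K| * 2 ^ (N + 1))) ?_
  -- Points of the circle around `T` have norm at most `2 * ‖T‖`, hence `r / 2`.
  have hball : ∀ᶠ T : ℂ in 𝓝[cone κ] 0, T ∈ Metric.ball (0 : ℂ) (r / 2) :=
    nhdsWithin_le_nhds (Metric.ball_mem_nhds _ (by positivity))
  filter_upwards [hball, self_mem_nhdsWithin] with T hTr hT
  have h0 : 0 < ‖T‖ := norm_pos_iff.2 hT.1
  set R : ℂ → ℂ := fun T => φ (α + T) - (trunc (N + 1) s).eval T with hR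
  have hdiff : ∀ T' ∈ cone (κ / 4), DifferentiableAt ℂ (fun T => φ (α + T)) T' := by
    intro T' hT'
    have : DifferentiableAt ℂ φ (α + T') := by
      refine hφ.differentiableAt ((isOpen_lt continuous_const Complex.continuous_im).mem_nhds ?_)
      simpa [hα] using im_pos_of_mem_cone (by positivity) hT'
    exact this.comp T' ((differentiableAt_const α).add differentiableAt_id)
  have hRd : ∀ T' ∈ cone (κ / 4), DifferentiableAt ℂ R T' := fun T' hT' =>
    (hdiff T' hT').sub (Polynomial.differentiableAt _)
  have hmem : ∀ T' ∈ Metric.closedBall T (κ / 4 * ‖T‖),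
      T' ∈ cone (κ / 4) ∧ ‖T'‖ ≤ 2 * ‖T‖ := fun T' hT' =>
    mem_cone_of_dist_le hκ hκ1 hT (by simpa [dist_eq_norm] using hT')
  have hTr' : ‖T‖ < r / 2 := by simpa using hTr
  have hρ : 0 < κ / 4 * ‖T‖ := by positivity
  have hc := Complex.norm_deriv_le_of_forall_mem_sphere_norm_le (f := R) (c := T) hρ
    (C := |K| * (2 * ‖T‖) ^ (N + 1)) ?_ ?_
  · have hder : _root_.deriv R T
        = _root_.deriv φ (α + T) - (trunc N (d⁄dX ℂ s)).eval T := by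
      have hTc := (hmem T (Metric.mem_closedBall_self hρ.le)).1
      rw [hR, deriv_fun_sub (hdiff T hTc) (Polynomial.differentiableAt _), Polynomial.deriv,
        trunc_derivative, deriv_comp_const_add]
    rw [hder] at hc
    refine hc.trans (le_of_eq ?_)
    rw [norm_pow]
    field_simp
    ring
  · refine DifferentiableOn.diffContOnCl ?_
    rw [closure_ball _ hρ.ne']
    exact fun T' hT' => (hRd T' (hmem T' hT').1).differentiableWithinAt
  · intro T' hT'
    obtain ⟨hc', hn'⟩ := hmem T' (Metric.sphere_subset_closedBall hT')
    have : ‖R T'‖ ≤ K * ‖T' ^ (N + 1)‖ := hb ⟨by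
      simp only [Metric.mem_ball, dist_zero_right]; linarith, hc'⟩
    refine this.trans ?_
    rw [norm_pow]
    gcongr
    exact le_abs_self K

end QuantumModular
end

noncomputable section
namespace QuantumModular

open Filter Asymptotics Topology PowerSeries

/-! ### The automorphy series and the increment as asymptotic expansions -/

/-- With `p` the truncation of `s⁻¹`, one has `u⁻¹ - p = u⁻¹ (1 - u p)`; the first factor is bounded
and the second has the expansion `s (s⁻¹ - p)`, a multiple of `X ^ N`. -/
theorem HasExpansion.inv {l : Filter ℂ} (hl : l ≤ 𝓝 0) {u : ℂ → ℂ} {s : ℂ⟦X⟧}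
    (h : HasExpansion l u s) (hs : constantCoeff s ≠ 0) :
    HasExpansion l (fun T => (u T)⁻¹) s⁻¹ := by
  have hu : Tendsto u l (𝓝 (constantCoeff s)) := by
    have h1 := h 1
    simp only [trunc_one_left, Polynomial.eval_C, pow_one] at h1
    have h2 : Tendsto (fun T => u T - coeff 0 s) l (𝓝 0) :=
      h1.trans_tendsto (tendsto_id.mono_left hl)
    simpa using h2.add_const (coeff 0 s)
  have h0 : ∀ᶠ T in l, u T ≠ 0 := hu.eventually_ne hs
  have hb : (fun T => (u T)⁻¹) =O[l] fun _ => (1 : ℂ) := (hu.inv₀ hs).isBigO_one ℂ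
  intro N
  have h3 := (h.mul hl (hasExpansion_polynomial hl (trunc N s⁻¹)))
  have h4 : HasExpansion l (fun T => 1 - u T * (trunc N s⁻¹).eval T)
      (s * (s⁻¹ - ((trunc N s⁻¹ : Polynomial ℂ) : ℂ⟦X⟧))) := by
    have := (hasExpansion_const hl 1).sub h3
    rwa [map_one, ← PowerSeries.mul_inv_cancel s hs, ← mul_sub] at this
  have h5 : trunc N (s * (s⁻¹ - ((trunc N s⁻¹ : Polynomial ℂ) : ℂ⟦X⟧))) = 0 := by
    conv_lhs => rw [eq_X_pow_mul_shift_add_trunc N s⁻¹]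
    rw [map_add, trunc_X_pow_self_mul, zero_add, trunc_trunc, add_sub_cancel_right, mul_left_comm,
      trunc_X_pow_self_mul]
  have h6 := h4 N
  rw [h5] at h6
  have h7 := hb.mul h6
  simp only [one_mul, Polynomial.eval_zero, sub_zero] at h7
  refine h7.congr' ?_ .rfl
  filter_upwards [h0] with T hT
  field_simp

/-- The formal series `c (α + T) + d`. -/
def denomSeries (γ : SL(2, ℤ)) (α : ℚ) : ℂ⟦X⟧ :=
  C (γ 1 0 : ℂ) * (C (α : ℂ) + X) + C (γ 1 1 : ℂ)

/-- The Möbius transformation on complex numbers. -/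
def moebius (γ : SL(2, ℤ)) (τ : ℂ) : ℂ :=
  ((γ 0 0 : ℂ) * τ + (γ 0 1 : ℂ)) / ((γ 1 0 : ℂ) * τ + (γ 1 1 : ℂ))

theorem hasExpansion_id {l : Filter ℂ} (hl : l ≤ 𝓝 0) : HasExpansion l (fun T => T) X := by
  simpa using hasExpansion_polynomial hl Polynomial.X

theorem hasExpansion_linear {l : Filter ℂ} (hl : l ≤ 𝓝 0) (p q α : ℂ) :
    HasExpansion l (fun T => p * (α + T) + q) (C p * (C α + X) + C q) :=
  ((hasExpansion_const hl p).mul hl ((hasExpansion_const hl α).add (hasExpansion_id hl))).add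
    (hasExpansion_const hl q)

theorem constantCoeff_denomSeries (γ : SL(2, ℤ)) (α : ℚ) :
    constantCoeff (denomSeries γ α) = (J γ α : ℂ) := by
  simp [denomSeries, J]

theorem constantCoeff_increment (γ : SL(2, ℤ)) (α : ℚ) : constantCoeff (increment γ α) = 0 := by
  simp [increment, act, J, div_eq_mul_inv]

theorem hasExpansion_increment {l : Filter ℂ} (hl : l ≤ 𝓝 0) (γ : SL(2, ℤ)) {α : ℚ}
    (h : J γ α ≠ 0) :
    HasExpansion l (fun T => moebius γ (α + T) - (act γ α : ℂ)) (increment γ α) := by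
  have h0 : constantCoeff (denomSeries γ α) ≠ 0 := by
    rw [constantCoeff_denomSeries]; exact_mod_cast h
  exact ((hasExpansion_linear hl _ _ _).mul hl ((hasExpansion_linear hl _ _ _).inv hl h0)).sub
    (hasExpansion_const hl _)

theorem HasExpansion.rescale {u : ℂ → ℂ} {s : ℂ⟦X⟧} (h : HasExpansion (𝓝 0) u s) (a : ℂ) :
    HasExpansion (𝓝 0) (fun T => u (a * T)) (PowerSeries.rescale a s) := by
  rw [PowerSeries.rescale_eq_subst]
  refine h.comp le_rfl ?_ (by simp) ?_
  · simpa [smul_eq_C_mul] using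
      (hasExpansion_const le_rfl a).mul le_rfl (hasExpansion_id (l := 𝓝 0) le_rfl)
  · have : Continuous fun T : ℂ => a * T := by fun_prop
    simpa using this.tendsto 0

/-- The automorphy factor `(c τ + d)^{-k/2}` near `α`, in the branch of `sqrtJ`. -/
def automorphy (k : ℤ) (γ : SL(2, ℤ)) (α : ℚ) (τ : ℂ) : ℂ :=
  sqrtJ γ α ^ (-k) * (1 + (γ 1 0 : ℂ) / (J γ α : ℂ) * (τ - α)) ^ (-(k : ℂ) / 2)

theorem hasExpansion_automorphy (k : ℤ) (γ : SL(2, ℤ)) (α : ℚ) :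
    HasExpansion (𝓝 0) (fun T => automorphy k γ α (α + T)) (automorphySeries k γ α) := by
  have := (hasExpansion_const (l := 𝓝 0) le_rfl (sqrtJ γ α ^ (-k))).mul le_rfl
    ((hasExpansion_binomialSeries (-(k : ℂ) / 2)).rescale ((γ 1 0 : ℂ) / (J γ α : ℂ)))
  simpa [automorphy, automorphySeries] using this

theorem det_eq_one (γ : SL(2, ℤ)) : (γ 0 0 : ℤ) * γ 1 1 - γ 0 1 * γ 1 0 = 1 := by
  have := γ.det_coe
  rwa [Matrix.det_fin_two] at this

theorem det_eq_one_complex (γ : SL(2, ℤ)) :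
    (γ 0 0 : ℂ) * γ 1 1 - γ 0 1 * γ 1 0 = 1 := by
  exact_mod_cast det_eq_one γ

theorem moebius_sub_act (γ : SL(2, ℤ)) {α : ℚ} (h : J γ α ≠ 0) {T : ℂ}
    (hT : (J γ α : ℂ) + (γ 1 0 : ℂ) * T ≠ 0) :
    moebius γ (α + T) - (act γ α : ℂ) = T / (J γ α * (J γ α + (γ 1 0 : ℂ) * T)) := by
  have hJ : (J γ α : ℂ) = (γ 1 0 : ℂ) * α + γ 1 1 := by simp [J]
  have h' : (J γ α : ℂ) ≠ 0 := by exact_mod_cast h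
  have hden : (γ 1 0 : ℂ) * (α + T) + γ 1 1 = J γ α + (γ 1 0 : ℂ) * T := by rw [hJ]; ring
  have hact : (act γ α : ℂ) = ((γ 0 0 : ℂ) * α + γ 0 1) / J γ α := by simp [act]
  rw [moebius, hden, hact, div_sub_div _ _ hT h', div_eq_div_iff (mul_ne_zero hT h')
    (mul_ne_zero h' hT), hJ]
  linear_combination T * ((γ 1 0 : ℂ) * α + γ 1 1) * ((γ 1 0 : ℂ) * α + γ 1 1 + γ 1 0 * T)
    * det_eq_one_complex γ

theorem im_div_add_ofReal_mul {j c : ℝ} (hj : j ≠ 0) (T : ℂ) :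
    (T / (j * (j + c * T))).im = T.im / ‖(j : ℂ) + c * T‖ ^ 2 := by
  rw [← div_div, div_right_comm, Complex.div_ofReal_im, Complex.div_im, ← Complex.normSq_eq_norm_sq]
  simp only [Complex.add_re, Complex.add_im, Complex.mul_re, Complex.mul_im, Complex.ofReal_re,
    Complex.ofReal_im, zero_mul, sub_zero, add_zero, zero_add]
  rw [← sub_div, div_right_comm]
  congr 1
  field_simp
  ring

theorem denom_ne_zero_of_im_pos {j c : ℝ} (hj : j ≠ 0) {T : ℂ} (hT : 0 < T.im) :
    (j : ℂ) + c * T ≠ 0 := by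
  intro h
  have h1 := congrArg Complex.im h
  have h2 := congrArg Complex.re h
  simp only [Complex.add_re, Complex.add_im, Complex.mul_re, Complex.mul_im, Complex.ofReal_re,
    Complex.ofReal_im, zero_mul, sub_zero, add_zero, zero_add, Complex.zero_im,
    Complex.zero_re] at h1 h2
  rcases mul_eq_zero.1 h1 with h1 | h1
  · simp [h1] at h2; exact hj h2
  · exact hT.ne' h1

/-- The increment is `T / (J (J + c T))`, with imaginary part `T.im / ‖J + c T‖ ^ 2`. Hence the
ratio of imaginary part to norm is multiplied by `|J| / ‖J + c T‖ ≥ 1 / 2`. -/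
theorem moebius_sub_act_mem_cone (γ : SL(2, ℤ)) {α : ℚ} (h : J γ α ≠ 0) {κ : ℝ} (hκ : 0 < κ)
    {T : ℂ} (hT : T ∈ cone κ) (hT' : ‖(J γ α : ℂ) + (γ 1 0 : ℂ) * T‖ ≤ 2 * |(J γ α : ℝ)|) :
    moebius γ (α + T) - (act γ α : ℂ) ∈ cone (κ / 2) := by
  have him := im_pos_of_mem_cone hκ hT
  have hj : ((J γ α : ℚ) : ℝ) ≠ 0 := by exact_mod_cast h
  have hD := denom_ne_zero_of_im_pos (c := ((γ 1 0 : ℤ) : ℝ)) hj him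
  have hI := im_div_add_ofReal_mul (c := ((γ 1 0 : ℤ) : ℝ)) hj T
  simp only [Complex.ofReal_ratCast, Complex.ofReal_intCast] at hD hI
  have hj' : ((J γ α : ℚ) : ℂ) ≠ 0 := by exact_mod_cast h
  rw [moebius_sub_act γ h hD]
  refine ⟨div_ne_zero hT.1 (mul_ne_zero hj' hD), ?_⟩
  rw [hI, norm_div, norm_mul]
  have hDn := norm_pos_iff.2 hD
  have hjn : ‖((J γ α : ℚ) : ℂ)‖ = |(J γ α : ℝ)| := by
    rw [← Complex.ofReal_ratCast, Complex.norm_real, Real.norm_eq_abs]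
  rw [hjn]
  have hjp : 0 < |(J γ α : ℝ)| := abs_pos.2 hj
  rw [le_div_iff₀ (by positivity)]
  refine le_trans ?_ hT.2
  have : κ / 2 * (‖T‖ / (|(J γ α : ℝ)| * ‖(J γ α : ℂ) + (γ 1 0 : ℂ) * T‖)) *
      ‖(J γ α : ℂ) + (γ 1 0 : ℂ) * T‖ ^ 2 = κ * ‖T‖ *
      (‖(J γ α : ℂ) + (γ 1 0 : ℂ) * T‖ / (2 * |(J γ α : ℝ)|)) := by
    field_simp
  rw [this]
  exact mul_le_of_le_one_right (by positivity) ((div_le_one (by positivity)).2 hT')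

theorem tendsto_moebius_sub_act (γ : SL(2, ℤ)) {α : ℚ} (h : J γ α ≠ 0) {κ : ℝ} (hκ : 0 < κ) :
    Tendsto (fun T => moebius γ (α + T) - (act γ α : ℂ)) (𝓝[cone κ] 0) (𝓝[cone (κ / 2)] 0) := by
  refine tendsto_nhdsWithin_iff.2 ⟨?_, ?_⟩
  · have hι := hasExpansion_increment (nhdsWithin_cone_le_nhds κ) γ h
    exact (hι.isBigO_id (constantCoeff_increment γ α)).trans_tendsto
      (tendsto_id.mono_left (nhdsWithin_cone_le_nhds κ))
  · have hj : 0 < |(J γ α : ℝ)| := abs_pos.2 (by exact_mod_cast h)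
    have hc : Continuous fun T : ℂ => ‖(J γ α : ℂ) + (γ 1 0 : ℂ) * T‖ := by fun_prop
    have h1 : ∀ᶠ T : ℂ in 𝓝 0, ‖(J γ α : ℂ) + (γ 1 0 : ℂ) * T‖ < 2 * |(J γ α : ℝ)| := by
      refine (hc.tendsto 0).eventually_lt_const ?_
      have hjn : ‖((J γ α : ℚ) : ℂ)‖ = |(J γ α : ℝ)| := by
        rw [← Complex.ofReal_ratCast, Complex.norm_real, Real.norm_eq_abs]
      simp only [mul_zero, add_zero, hjn]
      linarith
    filter_upwards [nhdsWithin_le_nhds h1, self_mem_nhdsWithin] with T hT hTc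
    exact moebius_sub_act_mem_cone γ h hκ hTc hT.le

/-- A functional equation near `α` in the upper half-plane gives the modularity defect at `α`. -/
theorem defect_eq_taylorSeries {φ g : ℂ → ℂ} {s : ℚ → ℂ⟦X⟧} {k : ℤ} {e : ℂˣ} {γ : SL(2, ℤ)}
    {α : ℚ} (hJ : J γ α ≠ 0) (hα : ConeExpansion φ α (s α))
    (hγα : ConeExpansion φ (act γ α) (s (act γ α))) (hg : AnalyticAt ℂ g α)
    (h : ∀ᶠ τ in 𝓝 (α : ℂ), 0 < τ.im →
      φ τ - e * automorphy k γ α τ * φ (moebius γ τ) = g τ) :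
    defect k e γ s α = taylorSeries g α := by
  have hl := nhdsWithin_cone_le_nhds 1
  have := nhdsWithin_cone_neBot (κ := 1) le_rfl
  have h1 := (hγα (1 / 2) (by norm_num)).comp hl (hasExpansion_increment hl γ hJ)
    (constantCoeff_increment γ α) (tendsto_moebius_sub_act γ hJ one_pos)
  have h2 := (hα 1 one_pos).sub (((hasExpansion_const hl (e : ℂ)).mul hl
    ((hasExpansion_automorphy k γ α).mono hl)).mul hl h1)
  refine HasExpansion.unique (nhdsWithin_cone_le 1) h2
    (((hasExpansion_taylorSeries hg).mono hl).congr ?_)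
  have hc : Tendsto (fun T : ℂ => (α : ℂ) + T) (𝓝 0) (𝓝 α) := by
    have : Continuous fun T : ℂ => (α : ℂ) + T := by fun_prop
    simpa using this.tendsto 0
  filter_upwards [nhdsWithin_le_nhds (hc.eventually h), self_mem_nhdsWithin] with T hT hTc
  rw [← hT (by simpa using im_pos_of_mem_cone one_pos hTc)]
  ring_nf

end QuantumModular
end

noncomputable section
namespace QuantumModular

open Filter Asymptotics Topology PowerSeries

/-! ### Derivatives of the formal series -/

/-- Both sides are expansions at `0` of the derivative of `(1 + z) ^ a` in the upper half-plane, so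
uniqueness of expansions applies. -/
theorem derivative_binomialSeries (a : ℂ) :
    d⁄dX ℂ (PowerSeries.binomialSeries ℂ a) = C a * PowerSeries.binomialSeries ℂ (a - 1) := by
  have hsp : ∀ z : ℂ, 0 < z.im → 1 + z ∈ Complex.slitPlane := fun z hz =>
    Or.inr (by simpa using hz.ne')
  have hd : ∀ (z : ℂ), 0 < z.im →
      HasDerivAt (fun z : ℂ => (1 + z) ^ a) (a * (1 + z) ^ (a - 1)) z := fun z hz => by
    simpa using ((hasDerivAt_id z).const_add 1).cpow_const (c := a) (hsp z hz)
  have h1 :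
      ConeExpansion (fun z : ℂ => (1 + z) ^ a) 0 (PowerSeries.binomialSeries ℂ a) := fun κ _ => by
    simpa using (hasExpansion_binomialSeries a).mono (nhdsWithin_cone_le_nhds κ)
  have h2 := h1.deriv (by simp) fun z hz => (hd z hz).differentiableAt.differentiableWithinAt
  refine h2.unique fun κ hκ => ?_
  have h3 := ((hasExpansion_const (l := 𝓝 0) le_rfl a).mul le_rfl
    (hasExpansion_binomialSeries (a - 1))).mono (nhdsWithin_cone_le_nhds κ)
  refine h3.congr ?_
  filter_upwards [self_mem_nhdsWithin] with T hT
  rw [zero_add, (hd T (im_pos_of_mem_cone hκ hT)).deriv]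

theorem derivative_rescale (a : ℂ) (s : ℂ⟦X⟧) :
    d⁄dX ℂ (rescale a s) = C a * rescale a (d⁄dX ℂ s) := by
  ext n
  simp only [coeff_derivative, coeff_rescale, coeff_C_mul]
  ring

theorem rescale_C_eq (a b : ℂ) : rescale a (C b) = C b := by
  ext n
  by_cases hn : n = 0 <;> simp [coeff_rescale, coeff_C, hn]

theorem denomSeries_mul_inv (γ : SL(2, ℤ)) {α : ℚ} (h : J γ α ≠ 0) :
    denomSeries γ α * (denomSeries γ α)⁻¹ = 1 :=
  PowerSeries.mul_inv_cancel _ (by rw [constantCoeff_denomSeries]; exact_mod_cast h)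

theorem derivative_denomSeries (γ : SL(2, ℤ)) (α : ℚ) :
    d⁄dX ℂ (denomSeries γ α) = C (γ 1 0 : ℂ) := by
  simp [denomSeries]

theorem derivative_increment (γ : SL(2, ℤ)) {α : ℚ} (h : J γ α ≠ 0) :
    d⁄dX ℂ (increment γ α) = (denomSeries γ α)⁻¹ ^ 2 := by
  have hB := denomSeries_mul_inv γ h
  have hdB := derivative_denomSeries γ α
  have hdet := congrArg (C (R := ℂ)) (det_eq_one_complex γ)
  have : increment γ α = (C (γ 0 0 : ℂ) * (C (α : ℂ) + X) + C (γ 0 1 : ℂ)) *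
      (denomSeries γ α)⁻¹ - C (act γ α : ℂ) := rfl
  have hdA : d⁄dX ℂ (C (γ 0 0 : ℂ) * (C (α : ℂ) + X) + C (γ 0 1 : ℂ)) = C (γ 0 0 : ℂ) := by
    simp
  rw [this, map_sub, Derivation.leibniz, derivative_inv', hdA, hdB, derivative_C]
  simp only [smul_eq_mul, sub_zero]
  have hdef : denomSeries γ α = C (γ 1 0 : ℂ) * (C (α : ℂ) + X) + C (γ 1 1 : ℂ) := rfl
  simp only [map_sub, map_mul, map_one] at hdet
  set B' := (denomSeries γ α)⁻¹
  set B := denomSeries γ α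
  linear_combination B' ^ 2 * hdet - B' * C (γ 0 0 : ℂ) * hB + B' ^ 2 * C (γ 0 0 : ℂ) * hdef

theorem denomSeries_eq (γ : SL(2, ℤ)) {α : ℚ} (h : J γ α ≠ 0) :
    denomSeries γ α = C (J γ α : ℂ) * rescale ((γ 1 0 : ℂ) / (J γ α : ℂ)) (1 + X) := by
  have hJ : (J γ α : ℂ) = (γ 1 0 : ℂ) * α + γ 1 1 := by simp [J]
  have h' : (J γ α : ℂ) ≠ 0 := by exact_mod_cast h
  have h1 : C (J γ α : ℂ) * C ((γ 1 0 : ℂ) / (J γ α : ℂ)) = C (γ 1 0 : ℂ) := by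
    rw [← map_mul, mul_div_cancel₀ _ h']
  rw [map_add, map_one, rescale_X, mul_add, ← mul_assoc, h1, denomSeries, hJ]
  simp only [map_add, map_mul]
  ring

theorem sqrtJ_sq (γ : SL(2, ℤ)) (α : ℚ) : sqrtJ γ α ^ 2 = J γ α := by
  unfold sqrtJ
  have hq : ((J γ α : ℚ) : ℂ) = ((J γ α : ℝ) : ℂ) := by simp
  split_ifs with h1 h2
  · rw [← Complex.ofReal_pow, Real.sq_sqrt (by exact_mod_cast h1), hq]
  · rw [mul_pow, ← Complex.ofReal_pow, Real.sq_sqrt (by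
      have : ((J γ α : ℚ) : ℝ) ≤ 0 := by exact_mod_cast (not_le.1 h1).le
      linarith), hq]
    simp
  · rw [mul_pow, ← Complex.ofReal_pow, Real.sq_sqrt (by
      have : ((J γ α : ℚ) : ℝ) ≤ 0 := by exact_mod_cast (not_le.1 h1).le
      linarith), hq]
    simp

theorem sqrtJ_ne_zero (γ : SL(2, ℤ)) {α : ℚ} (h : J γ α ≠ 0) : sqrtJ γ α ≠ 0 := by
  have := sqrtJ_sq γ α
  intro h0
  rw [h0] at this
  have h' : (J γ α : ℂ) ≠ 0 := by exact_mod_cast h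
  exact h' (by simpa using this.symm)

theorem binomialSeries_eq_mul (a : ℂ) (n : ℕ) :
    PowerSeries.binomialSeries ℂ a = PowerSeries.binomialSeries ℂ (a - n) * (1 + X) ^ n := by
  rw [← binomialSeries_nat (R := ℂ), ← binomialSeries_add, sub_add_cancel]

/-- The weight is `k / 2`, so `k + 4` means weight plus two, matching the factor `(c τ + d)⁻²` that
the chain rule produces. -/
theorem automorphySeries_add_four (k : ℤ) (γ : SL(2, ℤ)) {α : ℚ} (h : J γ α ≠ 0) :
    automorphySeries (k + 4) γ α = automorphySeries k γ α * (denomSeries γ α)⁻¹ ^ 2 := by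
  have hB := denomSeries_mul_inv γ h
  have key : automorphySeries (k + 4) γ α * denomSeries γ α ^ 2 = automorphySeries k γ α := by
    have hσ : sqrtJ γ α ^ (-(k + 4)) * (J γ α : ℂ) ^ 2 = sqrtJ γ α ^ (-k) := by
      rw [← sqrtJ_sq, ← pow_mul, ← zpow_natCast, ← zpow_add₀ (sqrtJ_ne_zero γ h)]
      congr 1
      push_cast
      ring
    rw [denomSeries_eq γ h, automorphySeries, automorphySeries,
      binomialSeries_eq_mul (-(k : ℂ) / 2) 2, ← hσ]
    simp only [map_mul, map_pow]
    have : (-((k + 4 : ℤ) : ℂ) / 2) = -(k : ℂ) / 2 - (2 : ℕ) := by push_cast; ring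
    rw [this]
    ring
  rw [← key]
  linear_combination (- automorphySeries (k + 4) γ α * (1 + denomSeries γ α * (denomSeries γ α)⁻¹))
    * hB

theorem derivative_automorphySeries (k : ℤ) (γ : SL(2, ℤ)) {α : ℚ} (h : J γ α ≠ 0) :
    d⁄dX ℂ (automorphySeries k γ α) =
      C (-(k : ℂ) / 2) * (C (γ 1 0 : ℂ) * (denomSeries γ α)⁻¹) * automorphySeries k γ α := by
  have hB := denomSeries_mul_inv γ h
  have h' : (J γ α : ℂ) ≠ 0 := by exact_mod_cast h
  have h1 : C (J γ α : ℂ) * C ((γ 1 0 : ℂ) / (J γ α : ℂ)) = C (γ 1 0 : ℂ) := by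
    rw [← map_mul, mul_div_cancel₀ _ h']
  have key : d⁄dX ℂ (automorphySeries k γ α) * denomSeries γ α =
      C (-(k : ℂ) / 2) * C (γ 1 0 : ℂ) * automorphySeries k γ α := by
    have hb := binomialSeries_eq_mul (-(k : ℂ) / 2) 1
    rw [Nat.cast_one, pow_one] at hb
    rw [denomSeries_eq γ h, automorphySeries, Derivation.leibniz, derivative_C, smul_zero,
      add_zero, smul_eq_mul, derivative_rescale, derivative_binomialSeries, map_mul, rescale_C_eq,
      hb, map_mul, ← h1]
    ring
  calc d⁄dX ℂ (automorphySeries k γ α)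
      = d⁄dX ℂ (automorphySeries k γ α) * (denomSeries γ α * (denomSeries γ α)⁻¹) := by
        rw [hB, mul_one]
    _ = _ := by rw [← mul_assoc, key]; ring

/-- The derivative of the increment supplies the two extra units of weight. The derivative of the
automorphy factor leaves `-(k / 2) c / (c τ + d)` times the transformed term, and that term is `s`
minus its defect. This multiple of `s` is what raises the depth. -/
theorem defect_derivative (k : ℤ) (e : ℂˣ) (γ : SL(2, ℤ)) (s : ℚ → ℂ⟦X⟧) {α : ℚ}
    (h : J γ α ≠ 0) :
    defect (k + 4) e γ (fun β => d⁄dX ℂ (s β)) α = d⁄dX ℂ (defect k e γ s α) -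
      C ((k : ℂ) / 2) * (C (γ 1 0 : ℂ) * (denomSeries γ α)⁻¹) * (s α - defect k e γ s α) := by
  simp only [defect, automorphySeries_add_four k γ h, map_sub, Derivation.leibniz,
    derivative_automorphySeries k γ h, derivative_subst (hasSubst_increment γ α),
    derivative_increment γ h, derivative_C, smul_eq_mul]
  rw [show (-(k : ℂ) / 2) = -((k : ℂ) / 2) by ring, map_neg]
  ring

theorem defect_C_mul (k : ℤ) (e : ℂˣ) (γ : SL(2, ℤ)) (z : ℂ) (s : ℚ → ℂ⟦X⟧) (α : ℚ) :
    defect k e γ (fun β => C z * s β) α = C z * defect k e γ s α := by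
  simp only [defect, subst_mul (hasSubst_increment γ α)]
  have : (C z : ℂ⟦X⟧).subst (increment γ α) = C z := subst_C z
  rw [this]
  ring

/-! ### Taylor series -/

theorem taylorSeries_eq_of_hasExpansion {g : ℂ → ℂ} {α : ℚ} {s : ℂ⟦X⟧} (h : AnalyticAt ℂ g α)
    (hs : HasExpansion (𝓝 0) (fun T => g (α + T)) s) : taylorSeries g α = s :=
  ((hasExpansion_taylorSeries h).mono nhdsWithin_le_nhds).unique (l := 𝓝[≠] 0) le_rfl
    (hs.mono nhdsWithin_le_nhds)

theorem taylorSeries_add {g h : ℂ → ℂ} {α : ℚ} (hg : AnalyticAt ℂ g α) (hh : AnalyticAt ℂ h α) :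
    taylorSeries (fun z => g z + h z) α = taylorSeries g α + taylorSeries h α :=
  taylorSeries_eq_of_hasExpansion (hg.add hh)
    ((hasExpansion_taylorSeries hg).add (hasExpansion_taylorSeries hh))

theorem taylorSeries_mul {g h : ℂ → ℂ} {α : ℚ} (hg : AnalyticAt ℂ g α) (hh : AnalyticAt ℂ h α) :
    taylorSeries (fun z => g z * h z) α = taylorSeries g α * taylorSeries h α :=
  taylorSeries_eq_of_hasExpansion (hg.mul hh)
    ((hasExpansion_taylorSeries hg).mul le_rfl (hasExpansion_taylorSeries hh))

theorem taylorSeries_const (z : ℂ) (α : ℚ) : taylorSeries (fun _ => z) α = C z :=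
  taylorSeries_eq_of_hasExpansion analyticAt_const (hasExpansion_const le_rfl z)

theorem taylorSeries_deriv (g : ℂ → ℂ) (α : ℚ) :
    taylorSeries (deriv g) α = d⁄dX ℂ (taylorSeries g α) := by
  ext n
  simp only [taylorSeries, coeff_mk, coeff_derivative, ← iteratedDeriv_succ', Nat.factorial_succ]
  push_cast
  field_simp

theorem analyticAt_denom_inv (γ : SL(2, ℤ)) {z : ℂ} (h : (γ 1 0 : ℂ) * z + γ 1 1 ≠ 0) :
    AnalyticAt ℂ (fun z => (γ 1 0 : ℂ) * ((γ 1 0 : ℂ) * z + γ 1 1)⁻¹) z :=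
  analyticAt_const.mul (((analyticAt_const.mul analyticAt_id).add analyticAt_const).inv h)

theorem taylorSeries_denom_inv (γ : SL(2, ℤ)) {α : ℚ} (h : J γ α ≠ 0) :
    taylorSeries (fun z => (γ 1 0 : ℂ) * ((γ 1 0 : ℂ) * z + γ 1 1)⁻¹) α =
      C (γ 1 0 : ℂ) * (denomSeries γ α)⁻¹ := by
  have hJ : (J γ α : ℂ) = (γ 1 0 : ℂ) * α + γ 1 1 := by simp [J]
  have h' : (J γ α : ℂ) ≠ 0 := by exact_mod_cast h
  refine taylorSeries_eq_of_hasExpansion (analyticAt_denom_inv γ (hJ ▸ h')) ?_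
  exact (hasExpansion_const le_rfl _).mul le_rfl ((hasExpansion_linear le_rfl _ _ _).inv le_rfl
    (by rw [← denomSeries, constantCoeff_denomSeries]; exact h'))

end QuantumModular
end

noncomputable section
namespace QuantumModular

open Filter Asymptotics Topology PowerSeries

/-! ### Iterated derivatives of quantum modular forms -/

/-- The real points at which `c x + d ≠ 0`. -/
def regularSet (γ : SL(2, ℤ)) : Set ℝ := {x | (γ 1 0 : ℝ) * x + (γ 1 1 : ℝ) ≠ 0}

theorem isOpen_regularSet (γ : SL(2, ℤ)) : IsOpen (regularSet γ) :=
  isOpen_ne_fun (by fun_prop) (by fun_prop)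

theorem mem_regularSet (γ : SL(2, ℤ)) {α : ℚ} (h : J γ α ≠ 0) : (α : ℝ) ∈ regularSet γ := by
  have : ((J γ α : ℚ) : ℝ) ≠ 0 := by exact_mod_cast h
  simpa [regularSet, J] using this

/-- Analytic on a neighbourhood of the regular set of `γ`. -/
def AnalyticOnRegular (γ : SL(2, ℤ)) (g : ℂ → ℂ) : Prop :=
  AnalyticOnNhd ℂ g ((fun x : ℝ => (x : ℂ)) '' regularSet γ)

theorem AnalyticOnRegular.analyticAt {γ : SL(2, ℤ)} {g : ℂ → ℂ} (h : AnalyticOnRegular γ g)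
    {α : ℚ} (hα : J γ α ≠ 0) : AnalyticAt ℂ g α :=
  h α ⟨(α : ℝ), mem_regularSet γ hα, by simp⟩

theorem analyticOnRegular_denom_inv (γ : SL(2, ℤ)) :
    AnalyticOnRegular γ (fun z => (γ 1 0 : ℂ) * ((γ 1 0 : ℂ) * z + γ 1 1)⁻¹) := by
  rintro _ ⟨x, hx, rfl⟩
  have hx' : ((γ 1 0 : ℝ) : ℂ) * x + ((γ 1 1 : ℝ) : ℂ) ≠ 0 := by exact_mod_cast hx
  exact analyticAt_denom_inv γ (by simpa using hx')

/-- The families that are combinations of the first `m` families `ψ i`, with coefficients that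
are Taylor series of functions that are analytic on the regular set of `γ`. -/
def IsCombination (Q : Set ℚ) (γ : SL(2, ℤ)) (ψ : ℕ → ℚ → ℂ⟦X⟧) (m : ℕ) (φ : ℚ → ℂ⟦X⟧) : Prop :=
  ∃ g : ℕ → ℂ → ℂ, (∀ i, AnalyticOnRegular γ (g i)) ∧
    ∀ α ∈ Q, J γ α ≠ 0 → φ α = ∑ i ∈ Finset.range m, taylorSeries (g i) α * ψ i α

variable {Q : Set ℚ} {γ : SL(2, ℤ)} {ψ : ℕ → ℚ → ℂ⟦X⟧} {m : ℕ} {φ φ' : ℚ → ℂ⟦X⟧}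

theorem IsCombination.add (h : IsCombination Q γ ψ m φ) (h' : IsCombination Q γ ψ m φ') :
    IsCombination Q γ ψ m (fun α => φ α + φ' α) := by
  obtain ⟨g, hg, he⟩ := h
  obtain ⟨g', hg', he'⟩ := h'
  refine ⟨fun i z => g i z + g' i z, fun i => (hg i).add (hg' i), fun α hα hJ => ?_⟩
  dsimp only
  rw [he α hα hJ, he' α hα hJ, ← Finset.sum_add_distrib]
  refine Finset.sum_congr rfl fun i _ => ?_
  rw [taylorSeries_add ((hg i).analyticAt hJ) ((hg' i).analyticAt hJ), add_mul]

theorem IsCombination.taylorSeries_mul (h : IsCombination Q γ ψ m φ) {u : ℂ → ℂ}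
    (hu : AnalyticOnRegular γ u) :
    IsCombination Q γ ψ m (fun α => taylorSeries u α * φ α) := by
  obtain ⟨g, hg, he⟩ := h
  refine ⟨fun i z => u z * g i z, fun i => hu.mul (hg i), fun α hα hJ => ?_⟩
  dsimp only
  rw [he α hα hJ, Finset.mul_sum]
  refine Finset.sum_congr rfl fun i _ => ?_
  rw [QuantumModular.taylorSeries_mul (hu.analyticAt hJ) ((hg i).analyticAt hJ), mul_assoc]

theorem IsCombination.C_mul (h : IsCombination Q γ ψ m φ) (z : ℂ) :
    IsCombination Q γ ψ m (fun α => C z * φ α) := by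
  have := h.taylorSeries_mul (u := fun _ => z) (fun _ _ => analyticAt_const)
  simpa only [taylorSeries_const] using this

theorem isCombination_self {i : ℕ} (hi : i < m) : IsCombination Q γ ψ m (ψ i) := by
  refine ⟨fun j => if j = i then fun _ => 1 else fun _ => 0, fun j => ?_, fun α _ _ => ?_⟩
  · dsimp only
    split_ifs <;> exact fun _ _ => analyticAt_const
  · rw [Finset.sum_eq_single i]
    · simp [taylorSeries_const]
    · intro j _ hj
      simp [hj, taylorSeries_const]
    · simp [hi]

theorem isCombination_zero : IsCombination Q γ ψ m (fun _ => 0) :=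
  ⟨fun _ _ => 0, fun _ _ _ => analyticAt_const, fun α _ _ => by simp [taylorSeries_const]⟩

theorem isCombination_sum {ι : Type*} (t : Finset ι) {f : ι → ℚ → ℂ⟦X⟧}
    (h : ∀ i ∈ t, IsCombination Q γ ψ m (f i)) :
    IsCombination Q γ ψ m (fun α => ∑ i ∈ t, f i α) := by
  classical
  induction t using Finset.induction_on with
  | empty => simpa using isCombination_zero
  | insert i t hi ih =>
    simp only [Finset.sum_insert hi]
    exact (h i (by simp)).add (ih fun j hj => h j (by simp [hj]))

theorem IsCombination.congr (h : IsCombination Q γ ψ m φ)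
    (he : ∀ α ∈ Q, J γ α ≠ 0 → φ' α = φ α) : IsCombination Q γ ψ m φ' := by
  obtain ⟨g, hg, h⟩ := h
  exact ⟨g, hg, fun α hα hJ => (he α hα hJ).trans (h α hα hJ)⟩

theorem IsCombination.succ (h : IsCombination Q γ ψ m φ) : IsCombination Q γ ψ (m + 1) φ := by
  obtain ⟨g, hg, h⟩ := h
  refine (isCombination_sum (Finset.range m) (f := fun i α => taylorSeries (g i) α * ψ i α)
    fun i hi => ?_).congr h
  exact (isCombination_self ((Finset.mem_range.1 hi).trans (Nat.lt_succ_self m))).taylorSeries_mul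
    (hg i)

/-- The family of constants `1`, followed by `s` and its iterated derivatives `(z D)^i s`. -/
def derivFamily (z : ℂ) (s : ℚ → ℂ⟦X⟧) : ℕ → ℚ → ℂ⟦X⟧
  | 0 => fun _ => 1
  | 1 => s
  | i + 2 => fun α => C z * d⁄dX ℂ (derivFamily z s (i + 1) α)

/-- Leibniz' rule: a coefficient is differentiated, or the family moves to the next index, which
requires one more family. -/
theorem IsCombination.derivative {z : ℂ} {s : ℚ → ℂ⟦X⟧}
    (h : IsCombination Q γ (derivFamily z s) m φ) :
    IsCombination Q γ (derivFamily z s) (m + 1) (fun α => C z * d⁄dX ℂ (φ α)) := by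
  obtain ⟨g, hg, h⟩ := h
  have h1 : ∀ i ∈ Finset.range m, IsCombination Q γ (derivFamily z s) (m + 1) (fun α =>
      C z * d⁄dX ℂ (taylorSeries (g i) α * derivFamily z s i α)) := by
    intro i hi
    have hi' := Finset.mem_range.1 hi
    have ha : IsCombination Q γ (derivFamily z s) (m + 1)
        (fun α => C z * (taylorSeries (deriv (g i)) α * derivFamily z s i α)) :=
      ((isCombination_self (by omega)).taylorSeries_mul (hg i).deriv).C_mul z
    have hb : IsCombination Q γ (derivFamily z s) (m + 1)
        (fun α => C z * (taylorSeries (g i) α * d⁄dX ℂ (derivFamily z s i α))) := by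
      -- Index `0` is the constant `1`, whose derivative vanishes; it does not move to index `1`.
      rcases i with _ | i
      · simpa [derivFamily] using isCombination_zero
      · have := (isCombination_self (Q := Q) (γ := γ) (ψ := derivFamily z s) (i := i + 2)
          (m := m + 1) (by omega)).taylorSeries_mul (hg (i + 1))
        refine this.congr fun α _ _ => ?_
        simp only [derivFamily]
        ring
    refine (ha.add hb).congr fun α _ _ => ?_
    rw [Derivation.leibniz, taylorSeries_deriv]
    simp only [smul_eq_mul]
    ring
  refine (isCombination_sum _ h1).congr fun α hα hJ => ?_
  rw [h α hα hJ, map_sum, Finset.mul_sum]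

/-- Induction through `defect_derivative`: both the derivative of the previous defect and the extra
term, a multiple of the previous family minus its defect, involve only one index more than the
previous defect. The defect at index `m + 1` thus uses indices up to `m`, which is what the
recursion on the depth needs. -/
theorem isCombination_defect_derivFamily {z : ℂ} {s : ℚ → ℂ⟦X⟧} {k : ℤ} {e : ℂˣ} {g : ℂ → ℂ}
    (hg : AnalyticOnRegular γ g)
    (h : ∀ α ∈ Q, J γ α ≠ 0 → defect k e γ s α = taylorSeries g α) (m : ℕ) :
    IsCombination Q γ (derivFamily z s) (m + 1)
      (defect (k + 4 * m) e γ (derivFamily z s (m + 1))) := by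
  induction m with
  | zero =>
    refine ⟨fun _ => g, fun _ => hg, fun α hα hJ => ?_⟩
    simpa [derivFamily] using h α hα hJ
  | succ m ih =>
    have h1 := ih.derivative
    have h2 := ((isCombination_self (Q := Q) (γ := γ) (ψ := derivFamily z s)
      (Nat.lt_succ_self (m + 1))).add (ih.succ.C_mul (-1))).taylorSeries_mul
      (analyticOnRegular_denom_inv γ)
    refine (h1.add (h2.C_mul (-(z * (((k + 4 * m : ℤ) : ℂ) / 2))))).congr fun α hα hJ => ?_
    have h3 := defect_derivative (k + 4 * m) e γ (derivFamily z s (m + 1)) hJ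
    have hk : k + 4 * ((m + 1 : ℕ) : ℤ) = (k + 4 * m) + 4 := by push_cast; ring
    rw [hk]
    change defect _ e γ (fun β => C z * d⁄dX ℂ (derivFamily z s (m + 1) β)) α = _
    rw [defect_C_mul, h3, taylorSeries_denom_inv γ hJ]
    simp only [map_neg, map_mul, map_one]
    ring

/-- A family whose defects are Taylor series of analytic functions is a strong quantum modular
form of depth one, and its `m`-th derivative is one of depth `m + 1`. -/
theorem derivFamily_mem_strongQMF {Γ : Subgroup SL(2, ℤ)} {z : ℂ} {s : ℚ → ℂ⟦X⟧} {k : ℤ}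
    {ε : Γ → ℂˣ} (h : ∀ γ : Γ, ∃ g, AnalyticOnRegular (γ : SL(2, ℤ)) g ∧
      ∀ α ∈ Q, J (γ : SL(2, ℤ)) α ≠ 0 → defect k (ε γ) γ s α = taylorSeries g α) (m : ℕ) :
    derivFamily z s (m + 1) ∈ StrongQMF Q Γ (m + 1) (k + 4 * m) ε := by
  induction m using Nat.strong_induction_on with
  | _ m ih =>
    rw [StrongQMF]
    intro γ
    obtain ⟨g, hg, hd⟩ := h γ
    obtain ⟨G, hG, hG'⟩ := isCombination_defect_derivFamily (z := z) hg hd m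
    -- Index `i ≥ 1` is the derivative of order `i - 1`, of depth `i` and with `k` raised by `4 * (i
    -- - 1)`. At `i = 0` the weight and multiplier are arbitrary, since depth zero does not see
    -- them.
    refine ⟨regularSet γ, isOpen_regularSet _, fun α _ hJ => mem_regularSet _ hJ, m + 1, id,
      fun i => k + 4 * ((i : ℤ) - 1), fun _ => ε, fun i => G i, fun i => derivFamily z s i,
      m.succ_pos, fun i => hG i, ?_, fun α hα hJ => ?_⟩
    · rintro ⟨i, hi⟩
      rcases i with _ | i
      · simp only [id_eq]
        rw [StrongQMF]
        exact ⟨1, fun α _ => by simp [derivFamily]⟩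
      · have := ih i (by omega)
        simpa using this
    · rw [hG' α hα hJ, Finset.sum_range]

end QuantumModular
end

noncomputable section
namespace QuantumModular

open Filter Topology

/-! ### Theta series -/

/-- The general term `n^m a(n) exp(π i n² z / P)`. -/
def thetaTerm (m : ℕ) (a : ℤ → ℂ) (P : ℝ) (n : ℤ) (z : ℂ) : ℂ :=
  (n : ℂ) ^ m * a n * Complex.exp (Real.pi * Complex.I * (n : ℂ) ^ 2 * z / P)

/-- The series `∑_{n ≥ 0} n^m a(n) exp(π i n² z / P)`. -/
def thetaSeries (m : ℕ) (a : ℤ → ℂ) (P : ℝ) (z : ℂ) : ℂ := ∑' n : ℕ, thetaTerm m a P n z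

theorem norm_thetaTerm (m : ℕ) (a : ℤ → ℂ) (P : ℝ) (n : ℤ) (z : ℂ) :
    ‖thetaTerm m a P n z‖ = |(n : ℝ)| ^ m * ‖a n‖ * Real.exp (-(Real.pi * n ^ 2 * z.im / P)) := by
  have h : (Real.pi * Complex.I * (n : ℂ) ^ 2 * z / P : ℂ) =
      ((Real.pi * (n : ℝ) ^ 2 / P : ℝ) : ℂ) * (z * Complex.I) := by
    push_cast
    ring
  rw [thetaTerm, norm_mul, norm_mul, norm_pow, Complex.norm_exp, h, Complex.re_ofReal_mul,
    Complex.mul_I_re, Complex.norm_intCast]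
  congr 2
  ring

/-- For `n ≥ 1` one has `2 n² y ≥ η n + y` when `y ≥ η`. One part of the exponent gives summability
uniformly in `z`, the other an exponential decay in `y`; the latter fails for a constant term, hence
`a 0 = 0`. -/
theorem norm_thetaTerm_le {m : ℕ} {a : ℤ → ℂ} {P A η : ℝ} (hP : 0 < P) (ha : ∀ n, ‖a n‖ ≤ A)
    (ha0 : a 0 = 0) (hη : 0 < η) (n : ℕ) {z : ℂ} (hz : η ≤ z.im) :
    ‖thetaTerm m a P n z‖ ≤ A * ((n : ℝ) ^ m * Real.exp (-(Real.pi * η / (2 * P)) * n)) *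
      Real.exp (-(Real.pi / (2 * P) * z.im)) := by
  have hA : 0 ≤ A := (norm_nonneg _).trans (ha 0)
  rcases Nat.eq_zero_or_pos n with rfl | hn
  · simp [thetaTerm, ha0]
    positivity
  have hn1 : (1 : ℝ) ≤ n := by exact_mod_cast hn
  rw [norm_thetaTerm]
  simp only [Int.cast_natCast, Nat.abs_cast]
  rw [mul_assoc A, mul_assoc ((n : ℝ) ^ m) (Real.exp _), ← Real.exp_add, mul_right_comm,
    mul_comm _ ‖a n‖]
  gcongr
  · exact ha _
  · have hpi := Real.pi_pos
    have h1 : Real.pi * n ^ 2 * z.im / P -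
        (Real.pi * η / (2 * P) * n + Real.pi / (2 * P) * z.im) =
        Real.pi / (2 * P) * (2 * n ^ 2 * z.im - η * n - z.im) := by
      field_simp
      ring
    have hy : 0 < z.im := hη.trans_le hz
    have h4 : (n : ℝ) ≤ n ^ 2 := by nlinarith
    have h5 : η * n ≤ n ^ 2 * z.im := by nlinarith
    have h6 : z.im ≤ n ^ 2 * z.im := by nlinarith
    have h2 : 0 ≤ 2 * n ^ 2 * z.im - η * n - z.im := by linarith
    have h3 : 0 ≤ Real.pi / (2 * P) * (2 * n ^ 2 * z.im - η * n - z.im) := by positivity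
    linarith

theorem summable_thetaBound (m : ℕ) {P η : ℝ} (hP : 0 < P) (hη : 0 < η) (A : ℝ) :
    Summable fun n : ℕ => A * ((n : ℝ) ^ m * Real.exp (-(Real.pi * η / (2 * P)) * n)) :=
  (Real.summable_pow_mul_exp_neg_nat_mul m (by positivity)).mul_left A

theorem summable_norm_thetaTerm {m : ℕ} {a : ℤ → ℂ} {P A : ℝ} (hP : 0 < P)
    (ha : ∀ n, ‖a n‖ ≤ A) (ha0 : a 0 = 0) {z : ℂ} (hz : 0 < z.im) :
    Summable fun n : ℕ => ‖thetaTerm m a P n z‖ :=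
  .of_nonneg_of_le (fun _ => norm_nonneg _)
    (fun n => norm_thetaTerm_le hP ha ha0 hz n le_rfl)
    ((summable_thetaBound m hP hz A).mul_right _)

theorem exists_norm_thetaSeries_le {m : ℕ} {a : ℤ → ℂ} {P A η : ℝ} (hP : 0 < P)
    (ha : ∀ n, ‖a n‖ ≤ A) (ha0 : a 0 = 0) (hη : 0 < η) :
    ∃ K : ℝ, 0 ≤ K ∧ ∀ z : ℂ, η ≤ z.im →
      ‖thetaSeries m a P z‖ ≤ K * Real.exp (-(Real.pi / (2 * P) * z.im)) := by
  have hA : 0 ≤ A := (norm_nonneg _).trans (ha 0)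
  refine ⟨∑' n : ℕ, A * ((n : ℝ) ^ m * Real.exp (-(Real.pi * η / (2 * P)) * n)),
    tsum_nonneg fun n => by positivity, fun z hz => ?_⟩
  rw [← tsum_mul_right]
  exact tsum_of_norm_bounded ((summable_thetaBound m hP hη A).mul_right _).hasSum
    fun n => norm_thetaTerm_le hP ha ha0 hη n hz

theorem hasDerivAt_thetaTerm (m : ℕ) (a : ℤ → ℂ) (P : ℝ) (n : ℤ) (z : ℂ) :
    HasDerivAt (thetaTerm m a P n) (Real.pi * Complex.I / P * thetaTerm (m + 2) a P n z) z := by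
  have h : HasDerivAt (fun z : ℂ => (Real.pi * Complex.I * (n : ℂ) ^ 2 * z / P : ℂ))
      (Real.pi * Complex.I * (n : ℂ) ^ 2 / P) z := by
    simpa using ((hasDerivAt_id z).const_mul (Real.pi * Complex.I * (n : ℂ) ^ 2)).div_const (P : ℂ)
  refine (h.cexp.const_mul ((n : ℂ) ^ m * a n)).congr_deriv ?_
  rw [thetaTerm]
  ring

theorem hasDerivAt_thetaSeries {m : ℕ} {a : ℤ → ℂ} {P A : ℝ} (hP : 0 < P)
    (ha : ∀ n, ‖a n‖ ≤ A) (ha0 : a 0 = 0) {z : ℂ} (hz : 0 < z.im) :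
    HasDerivAt (thetaSeries m a P) (Real.pi * Complex.I / P * thetaSeries (m + 2) a P z) z := by
  set U : Set ℂ := {w | z.im / 2 < w.im} with hU
  have hUo : IsOpen U := isOpen_lt continuous_const Complex.continuous_im
  have hzU : z ∈ U := by simp [hU]; linarith
  have hb : ∀ (n : ℕ) (w : ℂ), w ∈ U → ‖thetaTerm m a P n w‖ ≤
      A * ((n : ℝ) ^ m * Real.exp (-(Real.pi * (z.im / 2) / (2 * P)) * n)) := by
    intro n w hw
    have hA : 0 ≤ A := (norm_nonneg _).trans (ha 0)
    refine (norm_thetaTerm_le hP ha ha0 (half_pos hz) n (le_of_lt hw)).trans ?_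
    refine mul_le_of_le_one_right (by positivity) (Real.exp_le_one_iff.2 ?_)
    have : 0 < w.im := (half_pos hz).trans hw
    have := Real.pi_pos
    rw [neg_nonpos]
    positivity
  have hs := summable_thetaBound m hP (half_pos hz) A
  have hd : ∀ n : ℕ, DifferentiableOn ℂ (thetaTerm m a P n) U := fun n w _ =>
    (hasDerivAt_thetaTerm m a P n w).differentiableAt.differentiableWithinAt
  have h1 := Complex.hasSum_deriv_of_summable_norm hs hd hUo hb hzU
  have h2 := (Complex.differentiableOn_tsum_of_summable_norm hs hd hUo hb).differentiableAt
    (hUo.mem_nhds hzU)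
  have h3 : deriv (thetaSeries m a P) z = Real.pi * Complex.I / P * thetaSeries (m + 2) a P z := by
    change deriv (fun w => ∑' n : ℕ, thetaTerm m a P n w) z = _
    rw [← h1.tsum_eq, thetaSeries, ← tsum_mul_left]
    exact tsum_congr fun n => (hasDerivAt_thetaTerm m a P n z).deriv
  rw [← h3]
  exact h2.hasDerivAt

theorem exists_bound_of_periodic {F : ℤ → ℂ} {P : ℕ} (hP : 0 < P)
    (hF : Function.Periodic F (P : ℤ)) : ∃ A : ℝ, ∀ n, ‖F n‖ ≤ A := by
  refine ⟨∑ x ∈ Finset.range P, ‖F x‖, fun n => ?_⟩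
  have hP' : (0 : ℤ) < P := by exact_mod_cast hP
  have h1 : F n = F (n % P) := by
    conv_lhs => rw [← Int.emod_add_mul_ediv n P]
    have := hF.int_mul (n / P) (n % P)
    rw [mul_comm (P : ℤ)]
    simpa using this
  obtain ⟨x, hx⟩ := Int.eq_ofNat_of_zero_le (Int.emod_nonneg n hP'.ne')
  have hx' : x < P := by have := Int.emod_lt_of_pos n hP'; omega
  rw [h1, hx]
  exact Finset.single_le_sum (f := fun x : ℕ => ‖F x‖) (fun _ _ => norm_nonneg _)
    (Finset.mem_range.2 hx')

end QuantumModular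
end

noncomputable section
namespace QuantumModular

open Filter Topology

/-! ### The finite Fourier transform and the theta transformation -/

/-- The Fourier transform `∑_{x mod P} F(x) e(k x / P)`. -/
def dft (P : ℕ) (F : ℤ → ℂ) (k : ℤ) : ℂ :=
  ∑ x ∈ Finset.range P, F x * Complex.exp (2 * Real.pi * Complex.I * k * x / P)

/-- The series `∑_{n ∈ ℤ} n^m a(n) exp(π i n² z / P)`. -/
def thetaSeriesInt (m : ℕ) (a : ℤ → ℂ) (P : ℝ) (z : ℂ) : ℂ := ∑' n : ℤ, thetaTerm m a P n z

theorem summable_norm_thetaTerm_int {m : ℕ} {a : ℤ → ℂ} {P A : ℝ} (hP : 0 < P)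
    (ha : ∀ n, ‖a n‖ ≤ A) {z : ℂ} (hz : 0 < z.im) :
    Summable fun n : ℤ => ‖thetaTerm m a P n z‖ := by
  have h1 : ∀ b : ℤ → ℂ, (∀ n, ‖b n‖ ≤ A) → Summable fun n : ℕ => ‖thetaTerm m b P n z‖ := by
    intro b hb
    have h := summable_norm_thetaTerm (m := m) (A := A) (a := fun n => if n = 0 then 0 else b n) hP
      (fun n => by
        split_ifs
        · simpa using (norm_nonneg _).trans (ha 0)
        · exact hb n) (by simp) hz
    refine (summable_congr_cofinite ?_).1 h
    rw [Nat.cofinite_eq_atTop]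
    filter_upwards [eventually_gt_atTop 0] with n hn
    simp [thetaTerm, hn.ne']
  refine .of_nat_of_neg (h1 a ha) ((h1 (fun n => a (-n)) fun n => ha _).congr fun n => ?_)
  simp [norm_thetaTerm]

theorem tsum_int_eq_sum_tsum {P : ℕ} (hP : 0 < P) {f : ℤ → ℂ} (hf : Summable f) :
    ∑' n, f n = ∑ x ∈ Finset.range P, ∑' m : ℤ, f (m * P + x) := by
  have : NeZero P := ⟨hP.ne'⟩
  have h1 : Summable fun p : ℤ × Fin P => f (p.1 * P + (p.2 : ℕ)) :=
    ((Int.divModEquiv P).symm.summable_iff (f := f)).2 hf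
  have h2 : Summable fun p : Fin P × ℤ => f (p.2 * P + (p.1 : ℕ)) :=
    ((Equiv.prodComm (Fin P) ℤ).summable_iff (f := fun p : ℤ × Fin P =>
      f (p.1 * P + (p.2 : ℕ)))).2 h1
  calc ∑' n, f n = ∑' p : ℤ × Fin P, f (p.1 * P + (p.2 : ℕ)) :=
        ((Int.divModEquiv P).symm.tsum_eq f).symm
    _ = ∑' p : Fin P × ℤ, f (p.2 * P + (p.1 : ℕ)) :=
        ((Equiv.prodComm (Fin P) ℤ).tsum_eq fun p : ℤ × Fin P => f (p.1 * P + (p.2 : ℕ))).symm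
    _ = ∑ x : Fin P, ∑' m : ℤ, f (m * P + (x : ℕ)) := by rw [h2.tsum_prod, tsum_fintype]
    _ = _ := (Finset.sum_range fun x => ∑' m : ℤ, f (m * P + (x : ℕ))).symm

theorem periodic_mul_add {F : ℤ → ℂ} {P : ℕ} (hF : Function.Periodic F (P : ℤ)) (m x : ℤ) :
    F (m * P + x) = F x := by
  rw [add_comm]
  exact hF.int_mul m x

theorem neg_one_div_im_pos {z : ℂ} (hz : 0 < z.im) : 0 < (-1 / z).im := by
  rw [neg_div, Complex.neg_im, one_div, Complex.inv_im, neg_div, neg_neg]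
  exact div_pos hz (Complex.normSq_pos.2 fun h => by simp [h] at hz)

/-- Sorting the sum by residues modulo `P` reduces it to finitely many Jacobi theta functions at `(x
z, P z)`. -/
theorem thetaTerm_mul_add (m P : ℕ) (hP : 0 < P) {F : ℤ → ℂ} (hF : Function.Periodic F (P : ℤ))
    (q : ℤ) (x : ℕ) (z : ℂ) :
    thetaTerm m F P (q * P + x) z = F x * Complex.exp (Real.pi * Complex.I * x ^ 2 * z / P) *
      ((x + P * q : ℂ) ^ m * jacobiTheta₂_term q (x * z) (P * z)) := by
  have hP' : (P : ℂ) ≠ 0 := by exact_mod_cast hP.ne'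
  have h : (Real.pi * Complex.I * (((q * P + x : ℤ)) : ℂ) ^ 2 * z / ((P : ℝ) : ℂ) : ℂ) =
      Real.pi * Complex.I * x ^ 2 * z / P +
        (2 * Real.pi * Complex.I * q * (x * z) + Real.pi * Complex.I * q ^ 2 * (P * z)) := by
    push_cast
    field_simp
    ring
  rw [thetaTerm, periodic_mul_add hF, h, Complex.exp_add, jacobiTheta₂_term]
  push_cast
  ring

theorem summable_thetaSeriesInt {m P : ℕ} (hP : 0 < P) {F : ℤ → ℂ}
    (hF : Function.Periodic F (P : ℤ)) {z : ℂ} (hz : 0 < z.im) :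
    Summable fun n : ℤ => thetaTerm m F P n z := by
  obtain ⟨A, hA⟩ := exists_bound_of_periodic hP hF
  exact (summable_norm_thetaTerm_int (by exact_mod_cast hP) hA hz).of_norm

/-- The arguments `(x / P, -1 / (P z))` are those to which Jacobi's functional equation sends `(x z,
P z)`. -/
theorem exp_mul_dft (m P : ℕ) (F : ℤ → ℂ) (k : ℤ) (z : ℂ) :
    thetaTerm m (dft P F) P k (-1 / z) = ∑ x ∈ Finset.range P, F x *
      ((k : ℂ) ^ m * jacobiTheta₂_term k (x / P) (-1 / (P * z))) := by
  rw [thetaTerm, dft, Finset.mul_sum, Finset.sum_mul]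
  refine Finset.sum_congr rfl fun x _ => ?_
  rw [jacobiTheta₂_term, Complex.exp_add]
  have h1 : (2 * Real.pi * Complex.I * k * x / P : ℂ) = 2 * Real.pi * Complex.I * k * (x / P) := by
    ring
  have h2 : (Real.pi * Complex.I * (k : ℂ) ^ 2 * (-1 / z) / ((P : ℝ) : ℂ) : ℂ) =
      Real.pi * Complex.I * k ^ 2 * (-1 / (P * z)) := by
    push_cast
    rw [← div_div, div_right_comm]
    ring
  rw [h1, h2]
  ring

/-- Jacobi's functional equation in each residue class; its exponential factor cancels `exp (π i x²
z / P)`. -/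
theorem thetaSeriesInt_zero_functional_equation {P : ℕ} (hP : 0 < P) {F : ℤ → ℂ}
    (hF : Function.Periodic F (P : ℤ)) {z : ℂ} (hz : 0 < z.im) :
    thetaSeriesInt 0 F P z =
      1 / (-Complex.I * (P * z)) ^ (1 / 2 : ℂ) * thetaSeriesInt 0 (dft P F) P (-1 / z) := by
  have hP' : (P : ℂ) ≠ 0 := by exact_mod_cast hP.ne'
  have hz0 : z ≠ 0 := fun h => by simp [h] at hz
  have him : 0 < (-1 / (P * z)).im := neg_one_div_im_pos (by
    rw [← Complex.ofReal_natCast, Complex.im_ofReal_mul]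
    exact mul_pos (by exact_mod_cast hP) hz)
  have h2 : thetaSeriesInt 0 (dft P F) P (-1 / z) =
      ∑ x ∈ Finset.range P, F x * jacobiTheta₂ (x / P) (-1 / (P * z)) := by
    rw [thetaSeriesInt, tsum_congr (exp_mul_dft 0 P F · z), Summable.tsum_finsetSum]
    · refine Finset.sum_congr rfl fun x _ => ?_
      rw [tsum_mul_left, jacobiTheta₂]
      simp
    · intro x _
      simpa using ((hasSum_jacobiTheta₂_term _ him).summable).mul_left (F x)
  rw [h2, thetaSeriesInt, tsum_int_eq_sum_tsum hP (summable_thetaSeriesInt hP hF hz),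
    Finset.mul_sum]
  refine Finset.sum_congr rfl fun x _ => ?_
  rw [tsum_congr (fun q => thetaTerm_mul_add 0 P hP hF q x z), tsum_mul_left]
  simp only [pow_zero, one_mul]
  rw [← jacobiTheta₂, jacobiTheta₂_functional_equation]
  have h3 : Complex.exp (Real.pi * Complex.I * x ^ 2 * z / P) *
      Complex.exp (-Real.pi * Complex.I * (x * z) ^ 2 / (P * z)) = 1 := by
    rw [← Complex.exp_add, Complex.exp_eq_one_iff]
    refine ⟨0, ?_⟩
    field_simp
    ring
  have h4 : (x * z / (P * z) : ℂ) = x / P := by field_simp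
  rw [h4]
  linear_combination (F x * (1 / (-Complex.I * (P * z)) ^ (1 / 2 : ℂ)) *
    jacobiTheta₂ (x / P) (-1 / (P * z))) * h3

/-- In the class of `x` the factor `n = x + P q` produces `jacobiTheta₂` and its derivative in the
first variable. The inhomogeneous term in the functional equation of the derivative cancels the
multiple of `jacobiTheta₂`. -/
theorem thetaSeriesInt_one_functional_equation {P : ℕ} (hP : 0 < P) {F : ℤ → ℂ}
    (hF : Function.Periodic F (P : ℤ)) {z : ℂ} (hz : 0 < z.im) :
    thetaSeriesInt 1 F P z =
      1 / (-Complex.I * (P * z)) ^ (1 / 2 : ℂ) / z * thetaSeriesInt 1 (dft P F) P (-1 / z) := by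
  have hP' : (P : ℂ) ≠ 0 := by exact_mod_cast hP.ne'
  have hz0 : z ≠ 0 := fun h => by simp [h] at hz
  have hpi : (2 * Real.pi * Complex.I : ℂ) ≠ 0 := Complex.two_pi_I_ne_zero
  have him' : 0 < (P * z).im := by
    rw [← Complex.ofReal_natCast, Complex.im_ofReal_mul]
    exact mul_pos (by exact_mod_cast hP) hz
  have him : 0 < (-1 / (P * z)).im := neg_one_div_im_pos him'
  have hterm : ∀ (k : ℤ) (u v : ℂ), (k : ℂ) * jacobiTheta₂_term k u v =
      (2 * Real.pi * Complex.I)⁻¹ * jacobiTheta₂'_term k u v := by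
    intro k u v
    rw [jacobiTheta₂'_term]
    field_simp
  have h2 : thetaSeriesInt 1 (dft P F) P (-1 / z) =
      ∑ x ∈ Finset.range P, F x * ((2 * Real.pi * Complex.I)⁻¹ *
        jacobiTheta₂' (x / P) (-1 / (P * z))) := by
    rw [thetaSeriesInt, tsum_congr (exp_mul_dft 1 P F · z), Summable.tsum_finsetSum]
    · refine Finset.sum_congr rfl fun x _ => ?_
      simp only [pow_one, hterm]
      rw [tsum_mul_left, tsum_mul_left, jacobiTheta₂']
    · intro x _
      simp only [pow_one, hterm]
      exact (((hasSum_jacobiTheta₂'_term _ him).summable).mul_left _).mul_left (F x)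
  rw [h2, thetaSeriesInt, tsum_int_eq_sum_tsum hP (summable_thetaSeriesInt hP hF hz),
    Finset.mul_sum]
  refine Finset.sum_congr rfl fun x _ => ?_
  have h5 : ∀ q : ℤ, ((x + P * q : ℂ) ^ 1 * jacobiTheta₂_term q (x * z) (P * z)) =
      x * jacobiTheta₂_term q (x * z) (P * z) + (P * (2 * Real.pi * Complex.I)⁻¹) *
        jacobiTheta₂'_term q (x * z) (P * z) := by
    intro q
    rw [mul_assoc (P : ℂ), ← hterm]
    ring
  rw [tsum_congr (fun q => thetaTerm_mul_add 1 P hP hF q x z), tsum_mul_left, tsum_congr h5,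
    Summable.tsum_add ((hasSum_jacobiTheta₂_term _ him').summable.mul_left _)
      ((hasSum_jacobiTheta₂'_term _ him').summable.mul_left _), tsum_mul_left, tsum_mul_left,
    ← jacobiTheta₂, ← jacobiTheta₂', jacobiTheta₂_functional_equation,
    jacobiTheta₂'_functional_equation]
  have h3 : Complex.exp (Real.pi * Complex.I * x ^ 2 * z / P) *
      Complex.exp (-Real.pi * Complex.I * (x * z) ^ 2 / (P * z)) = 1 := by
    rw [← Complex.exp_add, Complex.exp_eq_one_iff]
    refine ⟨0, ?_⟩
    field_simp
    ring
  have h4 : (x * z / (P * z) : ℂ) = x / P := by field_simp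
  rw [h4]
  have h6 : ∀ (E E' c t t' f : ℂ), E * E' = 1 →
      f * E * (x * (c * E' * t) + P * (2 * Real.pi * Complex.I)⁻¹ *
        (c * E' / (P * z) * (t' - 2 * Real.pi * Complex.I * (x * z) * t))) =
      c / z * (f * ((2 * Real.pi * Complex.I)⁻¹ * t')) := by
    intro E E' c t t' f h
    have hI := Complex.I_ne_zero
    have hpi' : (Real.pi : ℂ) ≠ 0 := by exact_mod_cast Real.pi_ne_zero
    field_simp
    linear_combination (t' * f * c) * h
  exact h6 _ _ _ _ _ _ h3

theorem thetaSeriesInt_eq_two_mul {m : ℕ} {a : ℤ → ℂ} {P A : ℝ} (hP : 0 < P)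
    (ha : ∀ n, ‖a n‖ ≤ A) (ha0 : a 0 = 0) (hev : ∀ n : ℤ, (-1) ^ m * a (-n) = a n) {z : ℂ}
    (hz : 0 < z.im) : thetaSeriesInt m a P z = 2 * thetaSeries m a P z := by
  have h := (summable_norm_thetaTerm_int (m := m) hP ha hz).of_norm.hasSum.nat_add_neg
  have h0 : thetaTerm m a P 0 z = 0 := by simp [thetaTerm, ha0]
  have h1 : ∀ n : ℕ, thetaTerm m a P n z + thetaTerm m a P (-n) z = 2 * thetaTerm m a P n z := by
    intro n
    rw [two_mul]
    congr 1
    rw [thetaTerm, thetaTerm, ← hev n]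
    push_cast
    rw [neg_pow, neg_sq]
    ring
  rw [h0, add_zero, funext h1] at h
  rw [thetaSeriesInt, ← h.tsum_eq, thetaSeries, tsum_mul_left]

end QuantumModular
end

noncomputable section
namespace QuantumModular

open Filter Topology

/-! ### Sums of periodic functions over a period -/

theorem sum_range_eq_sum_zmod {P : ℕ} [NeZero P] {f : ℤ → ℂ} (hf : Function.Periodic f (P : ℤ))
    (φ : ZMod P ≃ ZMod P) (ψ : ℤ → ℤ) (h : ∀ n : ℤ, ((ψ n : ℤ) : ZMod P) = φ n) :
    ∑ x ∈ Finset.range P, f (ψ x) = ∑ x ∈ Finset.range P, f x := by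
  have hv : ∀ n : ℤ, f ((n : ZMod P).val : ℤ) = f n := by
    intro n
    rw [ZMod.val_intCast]
    conv_rhs => rw [← Int.emod_add_mul_ediv n P]
    have := hf.int_mul (n / P) (n % P)
    rw [mul_comm (P : ℤ)]
    simpa using this.symm
  have hs : ∀ G : ZMod P → ℂ, ∑ x ∈ Finset.range P, G (x : ℕ) = ∑ u : ZMod P, G u := by
    intro G
    refine Finset.sum_nbij' (fun x => (x : ZMod P)) (fun u => u.val) (by simp) ?_ ?_ (by simp)
      (by simp)
    · intro u _
      exact Finset.mem_range.2 (ZMod.val_lt u)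
    · intro x hx
      exact ZMod.val_natCast_of_lt (Finset.mem_range.1 hx)
  calc ∑ x ∈ Finset.range P, f (ψ x) = ∑ x ∈ Finset.range P, f ((φ ((x : ℕ) : ZMod P)).val) := by
        refine Finset.sum_congr rfl fun x _ => ?_
        rw [← hv (ψ x), h]
        simp
    _ = ∑ u : ZMod P, f ((φ u).val) := hs fun u => f ((φ u).val)
    _ = ∑ u : ZMod P, f (u.val) := φ.sum_comp fun u => f (u.val)
    _ = ∑ x ∈ Finset.range P, f (((x : ℕ) : ZMod P).val) := (hs fun u => f (u.val)).symm
    _ = _ := Finset.sum_congr rfl fun x _ => by simpa using hv x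

theorem sum_range_add {P : ℕ} (hP : 0 < P) {f : ℤ → ℂ} (hf : Function.Periodic f (P : ℤ))
    (a : ℤ) : ∑ x ∈ Finset.range P, f (x + a) = ∑ x ∈ Finset.range P, f x := by
  have : NeZero P := ⟨hP.ne'⟩
  exact sum_range_eq_sum_zmod hf (Equiv.addRight (a : ZMod P)) (fun n => n + a) (by simp)

theorem sum_range_neg {P : ℕ} (hP : 0 < P) {f : ℤ → ℂ} (hf : Function.Periodic f (P : ℤ)) :
    ∑ x ∈ Finset.range P, f (-x) = ∑ x ∈ Finset.range P, f x := by
  have : NeZero P := ⟨hP.ne'⟩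
  exact sum_range_eq_sum_zmod hf (Equiv.neg (ZMod P)) (fun n => -n) (by simp)

theorem exp_two_pi_periodic {P : ℕ} (hP : 0 < P) (k x : ℤ) :
    Complex.exp (2 * Real.pi * Complex.I * k * ((x + P : ℤ) : ℂ) / P) =
      Complex.exp (2 * Real.pi * Complex.I * k * x / P) := by
  have hP' : (P : ℂ) ≠ 0 := by exact_mod_cast hP.ne'
  rw [Complex.exp_eq_exp_iff_exists_int]
  refine ⟨k, ?_⟩
  push_cast
  field_simp

theorem dft_periodic {P : ℕ} (hP : 0 < P) (F : ℤ → ℂ) : Function.Periodic (dft P F) (P : ℤ) := by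
  intro k
  refine Finset.sum_congr rfl fun x _ => ?_
  congr 1
  have := exp_two_pi_periodic hP x k
  convert this using 2 <;> push_cast <;> ring

theorem dft_neg {P : ℕ} (hP : 0 < P) {F : ℤ → ℂ} (hF : Function.Periodic F (P : ℤ)) (k : ℤ) :
    dft P F (-k) = dft P (fun x => F (-x)) k := by
  have hper : Function.Periodic
      (fun x : ℤ => F x * Complex.exp (2 * Real.pi * Complex.I * (-k : ℤ) * x / P)) (P : ℤ) :=
    fun x => by simp only [hF x, exp_two_pi_periodic hP]
  have := sum_range_neg hP hper
  rw [dft, dft]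
  simp only [Int.cast_natCast] at this
  rw [← this]
  refine Finset.sum_congr rfl fun x _ => ?_
  push_cast
  ring_nf

/-- The hypotheses on the coefficients of a partial theta series with `n^j`: they are periodic, of
parity opposite to that of `j`, and vanish at `0` and on average. -/
structure IsThetaCoeff (j P : ℕ) (F : ℤ → ℂ) : Prop where
  pos : 0 < P
  periodic : Function.Periodic F (P : ℤ)
  parity : ∀ n, (-1) ^ (j + 1) * F (-n) = F n
  zero : F 0 = 0
  dft_zero : dft P F 0 = 0

theorem IsThetaCoeff.dft_parity {j P : ℕ} {F : ℤ → ℂ} (h : IsThetaCoeff j P F) (n : ℤ) :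
    (-1) ^ (j + 1) * dft P F (-n) = dft P F n := by
  rw [dft_neg h.pos h.periodic, dft, dft, Finset.mul_sum]
  refine Finset.sum_congr rfl fun x _ => ?_
  rw [← mul_assoc, h.parity]

/-! ### Decay of theta series -/

/-- Functions on the upper half-plane that decay rapidly at `0` and `∞` in cones. -/
def RapidDecay (g : ℂ → ℂ) : Prop :=
  ∀ κ : ℝ, 0 < κ → ∀ K : ℕ, ∃ A b : ℝ, 0 ≤ A ∧ 0 < b ∧
    ∀ z ∈ cone κ, ‖g z‖ ≤ A * ‖z‖ ^ K * Real.exp (-(b * ‖z‖))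

/-- Exponential decay at `i∞`, uniformly on half-planes. -/
def ExpDecay {E : Type*} [Norm E] (g : ℂ → E) : Prop :=
  ∃ b : ℝ, 0 < b ∧ ∀ η : ℝ, 0 < η → ∃ A : ℝ, 0 ≤ A ∧
    ∀ z : ℂ, η ≤ z.im → ‖g z‖ ≤ A * Real.exp (-(b * z.im))

theorem expDecay_thetaSeries (m : ℕ) {P : ℕ} (hP : 0 < P) {F : ℤ → ℂ}
    (hF : Function.Periodic F (P : ℤ)) (h0 : F 0 = 0) : ExpDecay (thetaSeries m F P) := by
  obtain ⟨A, hA⟩ := exists_bound_of_periodic hP hF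
  have hP' : (0 : ℝ) < P := by exact_mod_cast hP
  exact ⟨Real.pi / (2 * P), by positivity, fun η hη => exists_norm_thetaSeries_le hP' hA h0 hη⟩

theorem pow_mul_exp_neg_le {b : ℝ} (hb : 0 < b) (n : ℕ) {u : ℝ} (hu : 0 ≤ u) :
    u ^ n * Real.exp (-(b * u)) ≤ n.factorial / b ^ n := by
  have h := Real.pow_div_factorial_le_exp (b * u) (by positivity) n
  rw [div_le_iff₀ (by positivity), mul_pow] at h
  rw [Real.exp_neg, ← div_eq_mul_inv, div_le_div_iff₀ (Real.exp_pos _) (by positivity)]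
  linarith

theorem neg_one_div_im_ge {κ : ℝ} {z : ℂ} (hz : z ∈ cone κ) : κ / ‖z‖ ≤ (-1 / z).im := by
  have h0 : 0 < ‖z‖ := norm_pos_iff.2 hz.1
  rw [neg_div, Complex.neg_im, one_div, Complex.inv_im, neg_div, neg_neg, Complex.normSq_eq_norm_sq,
    div_le_div_iff₀ h0 (by positivity)]
  nlinarith [hz.2]

/-- In a cone, `‖z‖ ≥ 1` forces the imaginary part to grow like `‖z‖`. For `‖z‖ ≤ 1` the point `-1 /
z` has imaginary part at least `κ / ‖z‖`, so `g'` there beats every power of `‖z‖`. -/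
theorem RapidDecay.of_expDecay {g : ℂ → ℂ} {g' : ℂ → ℝ} (hg : ExpDecay g) (hg' : ExpDecay g')
    {B : ℝ} {m : ℕ} (hB : 0 ≤ B)
    (h : ∀ z : ℂ, 0 < z.im → ‖z‖ ≤ 1 → ‖g z‖ ≤ B / ‖z‖ ^ m * g' (-1 / z)) : RapidDecay g := by
  intro κ hκ K
  obtain ⟨b, hb, hg⟩ := hg
  obtain ⟨A, hA, hg⟩ := hg κ hκ
  obtain ⟨b', hb', hg'⟩ := hg'
  obtain ⟨A', hA', hg'⟩ := hg' κ hκ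
  -- The additional `m` powers absorb the pole `B / ‖z‖ ^ m`.
  set D : ℝ := (K + m).factorial / (b' * κ) ^ (K + m) with hD
  have hD0 : 0 ≤ D := by positivity
  refine ⟨max A (B * (A' * D) * Real.exp 1), min 1 (b * κ), le_max_of_le_left hA, by positivity,
    fun z hz => ?_⟩
  have h0 : 0 < ‖z‖ := norm_pos_iff.2 hz.1
  have him := im_pos_of_mem_cone hκ hz
  rcases le_total ‖z‖ 1 with h1 | h1
  · have h2 : κ ≤ (-1 / z).im :=
      ((le_div_iff₀ h0).2 (by nlinarith)).trans (neg_one_div_im_ge hz)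
    have h3 : g' (-1 / z) ≤ A' * Real.exp (-(b' * (-1 / z).im)) :=
      (le_abs_self _).trans (hg' _ h2)
    have h4 : Real.exp (-(b' * (-1 / z).im)) ≤ Real.exp (-(b' * κ * ‖z‖⁻¹)) := by
      refine Real.exp_le_exp.2 (neg_le_neg ?_)
      rw [mul_assoc, ← div_eq_mul_inv]
      exact mul_le_mul_of_nonneg_left (neg_one_div_im_ge hz) hb'.le
    have h5 := pow_mul_exp_neg_le (mul_pos hb' hκ) (K + m) (inv_nonneg.2 h0.le)
    rw [← hD] at h5
    have h6 : Real.exp (-(b' * κ * ‖z‖⁻¹)) ≤ D * ‖z‖ ^ (K + m) := by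
      rw [inv_pow, inv_mul_le_iff₀ (by positivity)] at h5
      linarith
    calc ‖g z‖ ≤ B / ‖z‖ ^ m * g' (-1 / z) := h z him h1
      _ ≤ B / ‖z‖ ^ m * (A' * (D * ‖z‖ ^ (K + m))) := by
        gcongr
        exact h3.trans (mul_le_mul_of_nonneg_left (h4.trans h6) hA')
      _ = B * (A' * D) * ‖z‖ ^ K * 1 := by rw [pow_add]; field_simp
      -- For `‖z‖ ≤ 1` the exponential decay factor is bounded below by `exp (-1)`.
      _ ≤ B * (A' * D) * ‖z‖ ^ K * (Real.exp 1 * Real.exp (-(min 1 (b * κ) * ‖z‖))) := by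
        gcongr
        rw [← Real.exp_add]
        refine Real.one_le_exp ?_
        have : min 1 (b * κ) * ‖z‖ ≤ 1 * 1 := by
          gcongr
          exact min_le_left _ _
        linarith
      _ = B * (A' * D) * Real.exp 1 * ‖z‖ ^ K * Real.exp (-(min 1 (b * κ) * ‖z‖)) := by ring
      _ ≤ _ := by gcongr; exact le_max_right _ _
  · have h2 : κ ≤ z.im := (le_mul_of_one_le_right hκ.le h1).trans hz.2
    calc ‖g z‖ ≤ A * Real.exp (-(b * z.im)) := hg z h2
      _ ≤ A * 1 * Real.exp (-(min 1 (b * κ) * ‖z‖)) := by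
        rw [mul_one]
        refine mul_le_mul_of_nonneg_left (Real.exp_le_exp.2 (neg_le_neg ?_)) hA
        calc min 1 (b * κ) * ‖z‖ ≤ b * κ * ‖z‖ := by gcongr; exact min_le_right _ _
          _ ≤ b * z.im := by rw [mul_assoc]; exact mul_le_mul_of_nonneg_left hz.2 hb.le
      _ ≤ _ := by
        gcongr
        · exact le_max_left _ _
        · exact one_le_pow₀ h1

/-- Cauchy's estimate on a circle of radius `κ / 4 * ‖z‖`. Dividing by the radius costs one power,
whence `K + 1`, and points of the circle have norm at least `‖z‖ / 2`, whence `b / 2`. -/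
theorem RapidDecay.deriv {g : ℂ → ℂ} (h : RapidDecay g)
    (hg : DifferentiableOn ℂ g {z | 0 < z.im}) : RapidDecay (deriv g) := by
  suffices H : ∀ κ : ℝ, 0 < κ → κ ≤ 1 → ∀ K : ℕ, ∃ A b : ℝ, 0 ≤ A ∧ 0 < b ∧
      ∀ z ∈ cone κ, ‖_root_.deriv g z‖ ≤ A * ‖z‖ ^ K * Real.exp (-(b * ‖z‖)) by
    intro κ hκ K
    obtain ⟨A, b, hA, hb, H⟩ := H (min κ 1) (by positivity) (min_le_right _ _) K
    exact ⟨A, b, hA, hb, fun z hz => H z (cone_anti (min_le_left _ _) hz)⟩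
  intro κ hκ hκ1 K
  obtain ⟨A, b, hA, hb, h⟩ := h (κ / 4) (by positivity) (K + 1)
  refine ⟨4 / κ * A * 2 ^ (K + 1), b / 2, by positivity, by positivity, fun z hz => ?_⟩
  have h0 : 0 < ‖z‖ := norm_pos_iff.2 hz.1
  have hρ : 0 < κ / 4 * ‖z‖ := by positivity
  have hmem : ∀ w ∈ Metric.closedBall z (κ / 4 * ‖z‖),
      w ∈ cone (κ / 4) ∧ ‖w‖ ≤ 2 * ‖z‖ := fun w hw =>
    mem_cone_of_dist_le hκ hκ1 hz (by simpa [dist_eq_norm] using hw)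
  have hc := Complex.norm_deriv_le_of_forall_mem_sphere_norm_le (f := g) (c := z) hρ
    (C := A * (2 * ‖z‖) ^ (K + 1) * Real.exp (-(b / 2 * ‖z‖))) ?_ ?_
  · refine hc.trans (le_of_eq ?_)
    rw [mul_pow, pow_succ ‖z‖]
    field_simp
  · refine DifferentiableOn.diffContOnCl ?_
    rw [closure_ball _ hρ.ne']
    exact hg.mono fun w hw => im_pos_of_mem_cone (by positivity) (hmem w hw).1
  · intro w hw
    obtain ⟨hc', hn'⟩ := hmem w (Metric.sphere_subset_closedBall hw)
    refine (h w hc').trans ?_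
    have hd : ‖w - z‖ = κ / 4 * ‖z‖ := by simpa [dist_eq_norm] using hw
    have h2 : ‖z‖ ≤ ‖w‖ + ‖w - z‖ := by
      calc ‖z‖ = ‖w - (w - z)‖ := by ring_nf
        _ ≤ _ := norm_sub_le _ _
    have h3 : ‖z‖ / 2 ≤ ‖w‖ := by nlinarith
    gcongr A * ?_ ^ (K + 1) * Real.exp (-?_)
    calc b / 2 * ‖z‖ = b * (‖z‖ / 2) := by ring
      _ ≤ b * ‖w‖ := by gcongr

end QuantumModular
end

noncomputable section
namespace QuantumModular

open Filter Topology

/-! ### Transformation of the theta series attached to theta coefficients -/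

/-- The branch of `(-i z)^{-1/2}` that is positive on the imaginary half-axis. -/
def invSqrt (z : ℂ) : ℂ := (-Complex.I * z) ^ (-(1 / 2) : ℂ)

theorem norm_invSqrt (z : ℂ) : ‖invSqrt z‖ = ‖z‖ ^ (-(1 / 2) : ℝ) := by
  have := Complex.norm_cpow_real (-Complex.I * z) (-(1 / 2) : ℝ)
  rw [invSqrt]
  convert this using 2
  · push_cast; rfl
  · simp

theorem neg_I_mul_mem_slitPlane {z : ℂ} (hz : 0 < z.im) : -Complex.I * z ∈ Complex.slitPlane :=
  Or.inl (by simpa using hz)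

theorem hasDerivAt_invSqrt {z : ℂ} (hz : 0 < z.im) :
    HasDerivAt invSqrt (-(1 / (2 * z)) * invSqrt z) z := by
  have hz0 : z ≠ 0 := fun h => by simp [h] at hz
  have h := (((hasDerivAt_id z).const_mul (-Complex.I)).cpow_const (c := (-(1 / 2) : ℂ))
    (neg_I_mul_mem_slitPlane hz))
  refine h.congr_deriv ?_
  have hne : -Complex.I * z ≠ 0 := mul_ne_zero (by simp) hz0
  simp only [id]
  rw [Complex.cpow_sub _ _ hne, Complex.cpow_one, invSqrt]
  have hI := Complex.I_ne_zero
  field_simp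

theorem ofReal_mul_cpow {r : ℝ} (hr : 0 < r) (x a : ℂ) :
    ((r : ℂ) * x) ^ a = (r : ℂ) ^ a * x ^ a := by
  have hr' : (r : ℂ) ≠ 0 := by exact_mod_cast hr.ne'
  rcases eq_or_ne x 0 with rfl | hx
  · rcases eq_or_ne a 0 with rfl | ha
    · simp
    · simp [ha]
  · rw [Complex.cpow_def_of_ne_zero (mul_ne_zero hr' hx), Complex.cpow_def_of_ne_zero hr',
      Complex.cpow_def_of_ne_zero hx, ← Complex.exp_add, Complex.log_ofReal_mul hr hx,
      Complex.ofReal_log hr.le, add_mul]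

theorem ofReal_cpow_neg_half {r : ℝ} (hr : 0 ≤ r) :
    (r : ℂ) ^ (-(1 / 2) : ℂ) = (Real.sqrt r : ℂ)⁻¹ := by
  rw [Real.sqrt_eq_rpow, Complex.cpow_neg, Complex.ofReal_cpow hr]
  push_cast
  rfl

theorem one_div_cpow_eq_invSqrt {P : ℕ} (hP : 0 < P) (z : ℂ) :
    1 / (-Complex.I * (P * z)) ^ (1 / 2 : ℂ) = (Real.sqrt P : ℂ)⁻¹ * invSqrt z := by
  have h : -Complex.I * (P * z) = ((P : ℝ) : ℂ) * (-Complex.I * z) := by push_cast; ring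
  have hP' : (0 : ℝ) < P := by exact_mod_cast hP
  rw [h, one_div, ← Complex.cpow_neg, ofReal_mul_cpow hP', ofReal_cpow_neg_half hP'.le, invSqrt]

variable {P : ℕ} {F : ℤ → ℂ}

theorem IsThetaCoeff.thetaSeries_one_functional_equation (h : IsThetaCoeff 0 P F) {z : ℂ}
    (hz : 0 < z.im) : thetaSeries 1 F P z =
      (Real.sqrt P : ℂ)⁻¹ * invSqrt z / z * thetaSeries 1 (dft P F) P (-1 / z) := by
  obtain ⟨A, hA⟩ := exists_bound_of_periodic h.pos h.periodic
  obtain ⟨B, hB⟩ := exists_bound_of_periodic h.pos (dft_periodic h.pos F)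
  have hP' : (0 : ℝ) < P := by exact_mod_cast h.pos
  have h1 := thetaSeriesInt_one_functional_equation h.pos h.periodic hz
  rw [thetaSeriesInt_eq_two_mul hP' hA h.zero (fun n => by simpa using h.parity n) hz,
    thetaSeriesInt_eq_two_mul hP' hB h.dft_zero (fun n => by simpa using h.dft_parity n)
      (neg_one_div_im_pos hz), one_div_cpow_eq_invSqrt h.pos z] at h1
  linear_combination h1 / 2

theorem IsThetaCoeff.thetaSeries_zero_functional_equation (h : IsThetaCoeff 1 P F) {z : ℂ}
    (hz : 0 < z.im) : thetaSeries 0 F P z =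
      (Real.sqrt P : ℂ)⁻¹ * invSqrt z * thetaSeries 0 (dft P F) P (-1 / z) := by
  obtain ⟨A, hA⟩ := exists_bound_of_periodic h.pos h.periodic
  obtain ⟨B, hB⟩ := exists_bound_of_periodic h.pos (dft_periodic h.pos F)
  have hP' : (0 : ℝ) < P := by exact_mod_cast h.pos
  have h1 := thetaSeriesInt_zero_functional_equation h.pos h.periodic hz
  rw [thetaSeriesInt_eq_two_mul hP' hA h.zero (fun n => by simpa using h.parity n) hz,
    thetaSeriesInt_eq_two_mul hP' hB h.dft_zero (fun n => by simpa using h.dft_parity n)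
      (neg_one_div_im_pos hz), one_div_cpow_eq_invSqrt h.pos z] at h1
  linear_combination h1 / 2

/-- The derivative of the formula with exponent `0`; the term with the dual series of exponent `0`
comes from differentiating `invSqrt`. -/
theorem IsThetaCoeff.thetaSeries_two_functional_equation (h : IsThetaCoeff 1 P F) {z : ℂ}
    (hz : 0 < z.im) : thetaSeries 2 F P z =
      (Real.sqrt P : ℂ)⁻¹ * invSqrt z *
        (P / (2 * Real.pi) * (Complex.I / z) * thetaSeries 0 (dft P F) P (-1 / z) +
          z⁻¹ ^ 2 * thetaSeries 2 (dft P F) P (-1 / z)) := by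
  obtain ⟨A, hA⟩ := exists_bound_of_periodic h.pos h.periodic
  obtain ⟨B, hB⟩ := exists_bound_of_periodic h.pos (dft_periodic h.pos F)
  have hP' : (0 : ℝ) < P := by exact_mod_cast h.pos
  have hPc : (P : ℂ) ≠ 0 := by exact_mod_cast h.pos.ne'
  have hpi : (Real.pi : ℂ) ≠ 0 := by exact_mod_cast Real.pi_ne_zero
  have hI := Complex.I_ne_zero
  have hz0 : z ≠ 0 := fun h => by simp [h] at hz
  have h1 := hasDerivAt_thetaSeries (m := 0) hP' hA h.zero hz
  have hinv : HasDerivAt (fun z : ℂ => -1 / z) (z⁻¹ ^ 2) z := by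
    have := (hasDerivAt_inv hz0).const_mul (-1)
    simpa [div_eq_mul_inv] using this
  have h2 := (hasDerivAt_thetaSeries (m := 0) hP' hB h.dft_zero
    (neg_one_div_im_pos hz)).comp z hinv
  have h3 := ((hasDerivAt_invSqrt hz).const_mul (Real.sqrt P : ℂ)⁻¹).mul h2
  have h4 := h1.unique (h3.congr_of_eventuallyEq (by
    filter_upwards [(isOpen_lt continuous_const Complex.continuous_im).mem_nhds hz] with w hw
    exact h.thetaSeries_zero_functional_equation hw))
  simp only [zero_add, Complex.ofReal_natCast, Function.comp] at h4
  have hI2 : Complex.I * Complex.I = -1 := Complex.I_mul_I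
  have h5 : thetaSeries 2 F P z = P / (Real.pi * Complex.I) *
      (Real.pi * Complex.I / P * thetaSeries 2 F P z) := by field_simp
  rw [h5, h4]
  field_simp
  ring_nf
  simp only [Complex.I_sq]
  ring

theorem rpow_neg_half_le {x : ℝ} (hx : 0 < x) (h1 : x ≤ 1) : x ^ (-(1 / 2) : ℝ) ≤ 1 / x := by
  rw [show 1 / x = x ^ (-1 : ℝ) by rw [Real.rpow_neg_one, one_div]]
  exact Real.rpow_le_rpow_of_exponent_ge hx h1 (by norm_num)

/-- Decay at infinity comes from `F 0 = 0`, and decay at `0` comes, through the inversion formula,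
from `dft P F 0 = 0`. -/
theorem IsThetaCoeff.rapidDecay_zero (h : IsThetaCoeff 0 P F) :
    RapidDecay (thetaSeries 1 F P) := by
  obtain ⟨b, hb, hd⟩ := expDecay_thetaSeries 1 h.pos (dft_periodic h.pos F) h.dft_zero
  refine .of_expDecay (B := ‖(Real.sqrt P : ℂ)⁻¹‖) (m := 2)
    (g' := fun z => ‖thetaSeries 1 (dft P F) P z‖)
    (expDecay_thetaSeries 1 h.pos h.periodic h.zero) ⟨b, hb, by simpa using hd⟩ (by positivity) ?_
  intro z hz h1
  have h0 : 0 < ‖z‖ := norm_pos_iff.2 fun h => by simp [h] at hz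
  rw [h.thetaSeries_one_functional_equation hz, norm_mul, norm_div, norm_mul, norm_invSqrt]
  refine mul_le_mul_of_nonneg_right ?_ (norm_nonneg _)
  rw [pow_two, ← div_div, div_le_div_iff_of_pos_right h0, div_eq_mul_one_div ‖(Real.sqrt P : ℂ)⁻¹‖]
  exact mul_le_mul_of_nonneg_left (rpow_neg_half_le h0 h1) (norm_nonneg _)

theorem IsThetaCoeff.rapidDecay_one (h : IsThetaCoeff 1 P F) :
    RapidDecay (thetaSeries 2 F P) := by
  obtain ⟨b, hb, hd⟩ := expDecay_thetaSeries 0 h.pos (dft_periodic h.pos F) h.dft_zero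
  obtain ⟨b', hb', hd'⟩ := expDecay_thetaSeries 2 h.pos (dft_periodic h.pos F) h.dft_zero
  set q : ℝ := P / (2 * Real.pi) with hq
  have hpi := Real.pi_pos
  have hq0 : 0 ≤ q := by positivity
  refine .of_expDecay (B := ‖(Real.sqrt P : ℂ)⁻¹‖) (m := 3)
    (g' := fun z => q * ‖thetaSeries 0 (dft P F) P z‖ + ‖thetaSeries 2 (dft P F) P z‖)
    (expDecay_thetaSeries 2 h.pos h.periodic h.zero)
    ⟨min b b', lt_min hb hb', fun η hη => ?_⟩ (by positivity) ?_
  · obtain ⟨A, hA, hd⟩ := hd η hη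
    obtain ⟨A', hA', hd'⟩ := hd' η hη
    refine ⟨q * A + A', by positivity, fun z hz => ?_⟩
    have hz0 : 0 ≤ z.im := (hη.trans_le hz).le
    rw [Real.norm_of_nonneg (by positivity), add_mul, mul_assoc q]
    refine add_le_add (mul_le_mul_of_nonneg_left ?_ hq0) ?_
    · refine (hd z hz).trans (mul_le_mul_of_nonneg_left (Real.exp_le_exp.2 (neg_le_neg ?_)) hA)
      exact mul_le_mul_of_nonneg_right (min_le_left _ _) hz0
    · refine (hd' z hz).trans (mul_le_mul_of_nonneg_left (Real.exp_le_exp.2 (neg_le_neg ?_)) hA')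
      exact mul_le_mul_of_nonneg_right (min_le_right _ _) hz0
  intro z hz h1
  have h0 : 0 < ‖z‖ := norm_pos_iff.2 fun h => by simp [h] at hz
  rw [h.thetaSeries_two_functional_equation hz, norm_mul, norm_mul, norm_invSqrt]
  have e1 : ‖(P / (2 * Real.pi) : ℂ)‖ = q := by
    rw [hq, norm_div, norm_mul, Complex.norm_natCast, Complex.norm_real,
      Real.norm_of_nonneg hpi.le, Complex.norm_two]
  have h2 : ‖P / (2 * Real.pi) * (Complex.I / z) * thetaSeries 0 (dft P F) P (-1 / z) +
      z⁻¹ ^ 2 * thetaSeries 2 (dft P F) P (-1 / z)‖ ≤ 1 / ‖z‖ ^ 2 *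
      (q * ‖thetaSeries 0 (dft P F) P (-1 / z)‖ + ‖thetaSeries 2 (dft P F) P (-1 / z)‖) := by
    refine (norm_add_le _ _).trans ?_
    rw [mul_add]
    gcongr
    · rw [norm_mul, norm_mul, e1, norm_div, Complex.norm_I, ← mul_assoc, mul_comm q]
      gcongr
      rw [pow_two]
      exact mul_le_of_le_one_left h0.le h1
    · rw [norm_mul, norm_pow, norm_inv, one_div, inv_pow]
  calc _ ≤ ‖(Real.sqrt P : ℂ)⁻¹‖ * (1 / ‖z‖) * (1 / ‖z‖ ^ 2 *
      (q * ‖thetaSeries 0 (dft P F) P (-1 / z)‖ + ‖thetaSeries 2 (dft P F) P (-1 / z)‖)) := by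
        gcongr
        exact rpow_neg_half_le h0 h1
    _ = _ := by field_simp

theorem IsThetaCoeff.rapidDecay {j : ℕ} (hj : j < 2) (h : IsThetaCoeff j P F) :
    RapidDecay (thetaSeries (j + 1) F P) := by
  interval_cases j
  · exact h.rapidDecay_zero
  · exact h.rapidDecay_one

end QuantumModular
end

noncomputable section
namespace QuantumModular

open Filter Topology MeasureTheory Set

/-! ### Moving the starting point of a ray -/

theorem norm_cpow_neg_half (y : ℂ) : ‖y ^ (-(1 / 2) : ℂ)‖ = ‖y‖ ^ (-(1 / 2) : ℝ) := by
  have := Complex.norm_cpow_real y (-(1 / 2) : ℝ)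
  convert this using 2
  push_cast
  rfl

theorem norm_cpow_neg_half_sub_one (y : ℂ) :
    ‖y ^ (-(1 / 2) - 1 : ℂ)‖ = ‖y‖ ^ (-(1 / 2) - 1 : ℝ) := by
  have := Complex.norm_cpow_real y (-(1 / 2) - 1 : ℝ)
  convert this using 2
  push_cast
  rfl

theorem integrableOn_rpow_mul_exp_neg {s b : ℝ} (hs : -1 < s) (hb : 0 < b) :
    IntegrableOn (fun t : ℝ => t ^ s * Real.exp (-(b * t))) (Ioi 0) := by
  have := integrableOn_rpow_mul_exp_neg_mul_rpow hs one_pos hb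
  simpa using this

/-- A function `g` on the upper half-plane, the direction `v` of a ray, and a point `v x` of the
upper half-plane on the side of the ray that is given by `μ`. -/
structure RayData (g : ℂ → ℂ) (v x μ : ℂ) : Prop where
  diff : DifferentiableOn ℂ g {z | 0 < z.im}
  decay : RapidDecay g
  v_im : 0 < v.im
  w_im : 0 < (v * x).im
  re_zero : μ.re = 0
  re_pos : 0 < (μ * x).re

/-- The kernel `μ ((1 - s) x - t)`, to be raised to the power `-1/2`. -/
def rayArg (x μ : ℂ) (s t : ℝ) : ℂ := μ * ((1 - s) * x - t)

/-- The integrand on the ray of direction `v` that starts at `s v x`. -/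
def rayIntegrand (g : ℂ → ℂ) (v x μ : ℂ) (s t : ℝ) : ℂ :=
  g (v * (s * x + t)) * rayArg x μ s t ^ (-(1 / 2) : ℂ)

/-- The derivative of the integrand along the ray. -/
def rayIntegrandDeriv (g : ℂ → ℂ) (v x μ : ℂ) (s t : ℝ) : ℂ :=
  v * deriv g (v * (s * x + t)) * rayArg x μ s t ^ (-(1 / 2) : ℂ) +
    g (v * (s * x + t)) * (μ / 2 * rayArg x μ s t ^ (-(1 / 2) - 1 : ℂ))

namespace RayData

variable {g : ℂ → ℂ} {v x μ : ℂ}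

theorem mu_ne_zero (h : RayData g v x μ) : μ ≠ 0 := by
  rintro rfl
  simpa using h.re_pos

theorem x_ne_zero (h : RayData g v x μ) : x ≠ 0 := by
  rintro rfl
  simpa using h.re_pos

theorem im_eq (s t : ℝ) : (v * (s * x + t)).im = s * (v * x).im + t * v.im := by
  have : v * (s * x + t) = (s : ℂ) * (v * x) + (t : ℂ) * v := by ring
  rw [this, Complex.add_im, Complex.im_ofReal_mul, Complex.im_ofReal_mul]

theorem im_pos (h : RayData g v x μ) {s t : ℝ} (hs : 0 ≤ s) (ht : 0 ≤ t) (hst : 0 < s ∨ 0 < t) :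
    0 < (v * (s * x + t)).im := by
  rw [im_eq]
  have h1 := h.v_im
  have h2 := h.w_im
  rcases hst with h3 | h3 <;> positivity

/-- The points are combinations, with nonnegative coefficients, of the two points `v * x` and `v` of
the upper half-plane. -/
theorem exists_cone (h : RayData g v x μ) : ∃ κ : ℝ, 0 < κ ∧
    ∀ s t : ℝ, 0 ≤ s → 0 ≤ t → (0 < s ∨ 0 < t) →
    v * (s * x + t) ∈ cone κ := by
  have hv : 0 < ‖v‖ := norm_pos_iff.2 fun h0 => by simpa [h0] using h.v_im
  have hw : 0 < ‖v * x‖ := norm_pos_iff.2 fun h0 => by simpa [h0] using h.w_im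
  refine ⟨min ((v * x).im / ‖v * x‖) (v.im / ‖v‖),
    lt_min (div_pos h.w_im hw) (div_pos h.v_im hv), fun s t hs ht hst => ?_⟩
  have hi := h.im_pos hs ht hst
  refine ⟨fun h0 => by simp [h0] at hi, ?_⟩
  have h1 : ‖v * (s * x + t)‖ ≤ s * ‖v * x‖ + t * ‖v‖ := by
    have : v * (s * x + t) = (s : ℂ) * (v * x) + (t : ℂ) * v := by ring
    rw [this]
    refine (norm_add_le _ _).trans ?_
    rw [norm_mul, norm_mul (t : ℂ), Complex.norm_real, Complex.norm_real,
      Real.norm_of_nonneg hs, Real.norm_of_nonneg ht]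
  set m := min ((v * x).im / ‖v * x‖) (v.im / ‖v‖) with hm
  have hm0 : 0 < m := lt_min (div_pos h.w_im hw) (div_pos h.v_im hv)
  have h2 : m * ‖v * x‖ ≤ (v * x).im := (le_div_iff₀ hw).1 (min_le_left _ _)
  have h3 : m * ‖v‖ ≤ v.im := (le_div_iff₀ hv).1 (min_le_right _ _)
  rw [im_eq]
  calc m * ‖v * (s * x + t)‖ ≤ m * (s * ‖v * x‖ + t * ‖v‖) := by gcongr
    _ = s * (m * ‖v * x‖) + t * (m * ‖v‖) := by ring
    _ ≤ _ := by gcongr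

theorem exists_bound_of_rapidDecay (h : RayData g v x μ) {f : ℂ → ℂ} (hf : RapidDecay f) :
    ∃ A b : ℝ, 0 ≤ A ∧ 0 < b ∧ ∀ s t : ℝ, 0 ≤ s → 0 ≤ t → (0 < s ∨ 0 < t) →
      ‖f (v * (s * x + t))‖ ≤ A * Real.exp (-(b * t)) := by
  obtain ⟨κ, hκ, hc⟩ := h.exists_cone
  obtain ⟨A, b, hA, hb, hf⟩ := hf κ hκ 0
  refine ⟨A, b * v.im, hA, mul_pos hb h.v_im, fun s t hs ht hst => ?_⟩
  refine (hf _ (hc s t hs ht hst)).trans ?_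
  rw [pow_zero, mul_one]
  refine mul_le_mul_of_nonneg_left (Real.exp_le_exp.2 (neg_le_neg ?_)) hA
  rw [mul_assoc]
  refine mul_le_mul_of_nonneg_left ?_ hb.le
  refine le_trans ?_ (Complex.im_le_norm _)
  rw [im_eq, mul_comm v.im]
  have := h.w_im
  have : 0 ≤ s * (v * x).im := by positivity
  linarith

/-- Since `μ` is purely imaginary, `t` drops out. The kernel stays in the right half-plane for `s <
1`, so the principal branch is never crossed. -/
theorem rayArg_re (h : RayData g v x μ) (s t : ℝ) : (rayArg x μ s t).re = (1 - s) * (μ * x).re := by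
  have : rayArg x μ s t = ((1 - s : ℝ) : ℂ) * (μ * x) - (t : ℂ) * μ := by
    rw [rayArg]; push_cast; ring
  rw [this, Complex.sub_re, Complex.re_ofReal_mul, Complex.re_ofReal_mul, h.re_zero, mul_zero,
    sub_zero]

/-- A bound linear in `t` and uniform in `s`: where `t` exceeds twice `‖(1 - s) x‖` it dominates,
and otherwise the real part is already large enough. -/
theorem le_norm_rayArg (h : RayData g v x μ) {s t : ℝ} (hs : s ≤ 1) (ht : 0 ≤ t) :
    t * ((μ * x).re / (2 * ‖x‖)) ≤ ‖rayArg x μ s t‖ := by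
  have hx : 0 < ‖x‖ := norm_pos_iff.2 h.x_ne_zero
  have hμ : 0 < ‖μ‖ := norm_pos_iff.2 h.mu_ne_zero
  have hle : (μ * x).re ≤ ‖μ‖ * ‖x‖ := by
    rw [← norm_mul]
    exact Complex.re_le_norm _
  rw [← mul_div_assoc, div_le_iff₀ (by positivity)]
  have hpos := h.re_pos
  rcases le_total ((1 - s) * (2 * ‖x‖)) t with h1 | h1
  · have h2 : t - (1 - s) * ‖x‖ ≤ ‖(1 - s : ℂ) * x - t‖ := by
      have e : ‖(1 - s : ℂ) * x‖ = (1 - s) * ‖x‖ := by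
        rw [norm_mul, ← Complex.ofReal_one, ← Complex.ofReal_sub, Complex.norm_real,
          Real.norm_of_nonneg (by linarith)]
      have e' : ‖(t : ℂ)‖ = t := by rw [Complex.norm_real, Real.norm_of_nonneg ht]
      have := norm_sub_norm_le (t : ℂ) ((1 - s : ℂ) * x)
      rw [e, e', norm_sub_rev] at this
      exact this
    have h3 : ‖rayArg x μ s t‖ = ‖μ‖ * ‖(1 - s : ℂ) * x - t‖ := norm_mul _ _
    rw [h3]
    have h4 : t / 2 ≤ ‖(1 - s : ℂ) * x - t‖ := by linarith
    calc t * (μ * x).re ≤ t * (‖μ‖ * ‖x‖) := by gcongr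
      _ = ‖μ‖ * (t / 2) * (2 * ‖x‖) := by ring
      _ ≤ _ := by gcongr
  · have h2 := (Complex.re_le_norm (rayArg x μ s t))
    rw [h.rayArg_re] at h2
    calc t * (μ * x).re ≤ (1 - s) * (2 * ‖x‖) * (μ * x).re := by gcongr
      _ = (1 - s) * (μ * x).re * (2 * ‖x‖) := by ring
      _ ≤ _ := by gcongr

theorem rayArg_mem_slitPlane (h : RayData g v x μ) {s t : ℝ} (hs : s ≤ 1) (hst : s < 1 ∨ 0 < t) :
    rayArg x μ s t ∈ Complex.slitPlane := by
  rcases hs.lt_or_eq with h1 | rfl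
  · left
    rw [h.rayArg_re]
    exact mul_pos (by linarith) h.re_pos
  · right
    have ht : 0 < t := by simpa using hst
    have : rayArg x μ 1 t = ((-t : ℝ) : ℂ) * μ := by rw [rayArg]; push_cast; ring
    rw [this, Complex.im_ofReal_mul]
    refine mul_ne_zero (by linarith) fun h0 => h.mu_ne_zero (Complex.ext h.re_zero h0)

theorem differentiableAt (h : RayData g v x μ) {s t : ℝ} (hs : 0 ≤ s) (ht : 0 ≤ t)
    (hst : 0 < s ∨ 0 < t) :
    DifferentiableAt ℂ g (v * (s * x + t)) :=
  h.diff.differentiableAt ((isOpen_lt continuous_const Complex.continuous_im).mem_nhds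
    (h.im_pos hs ht hst))

/-- The integrand depends on `s` and `t` only through `s x + t`, so its derivative in `s` is `x`
times the one in `t`. This is the infinitesimal form of the contour shift. -/
theorem hasDerivAt_left (h : RayData g v x μ) {s t : ℝ} (hs : 0 ≤ s) (hs1 : s < 1) (ht : 0 ≤ t)
    (hst : 0 < s ∨ 0 < t) :
    HasDerivAt (fun s => rayIntegrand g v x μ s t) (x * rayIntegrandDeriv g v x μ s t) s := by
  have h1 : HasDerivAt (fun s : ℝ => v * ((s : ℂ) * x + t)) (v * x) s := by
    simpa using (((hasDerivAt_id s).ofReal_comp.mul_const x).add_const (t : ℂ)).const_mul v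
  have h2 : HasDerivAt (fun s : ℝ => rayArg x μ s t) (-(μ * x)) s := by
    have :=
        ((((hasDerivAt_id s).ofReal_comp.const_sub 1).mul_const x).sub_const (t : ℂ)).const_mul μ
    simpa [rayArg] using this
  have h3 := (h.differentiableAt hs ht hst).hasDerivAt.comp s h1
  have h4 := (Complex.hasStrictDerivAt_cpow_const
    (h.rayArg_mem_slitPlane hs1.le (.inl hs1)) (c := -(1 / 2))).hasDerivAt.comp
    (h := fun s => rayArg x μ s t) s h2
  refine (h3.mul h4).congr_deriv ?_
  simp only [Function.comp, rayIntegrandDeriv]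
  ring

theorem hasDerivAt_right (h : RayData g v x μ) {s t : ℝ} (hs : 0 < s) (hs1 : s < 1) (ht : 0 ≤ t) :
    HasDerivAt (fun t => rayIntegrand g v x μ s t) (rayIntegrandDeriv g v x μ s t) t := by
  have h1 : HasDerivAt (fun t : ℝ => v * ((s : ℂ) * x + t)) v t := by
    simpa using (((hasDerivAt_id t).ofReal_comp).const_add ((s : ℂ) * x)).const_mul v
  have h2 : HasDerivAt (fun t : ℝ => rayArg x μ s t) (-μ) t := by
    have := (((hasDerivAt_id t).ofReal_comp).const_sub ((1 - s : ℂ) * x)).const_mul μ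
    simpa [rayArg] using this
  have h3 := (h.differentiableAt hs.le ht (.inl hs)).hasDerivAt.comp t h1
  have h4 := (Complex.hasStrictDerivAt_cpow_const
    (h.rayArg_mem_slitPlane hs1.le (.inl hs1)) (c := -(1 / 2))).hasDerivAt.comp
    (h := fun t => rayArg x μ s t) t h2
  refine (h3.mul h4).congr_deriv ?_
  simp only [Function.comp, rayIntegrandDeriv]
  ring

theorem continuousOn_right (h : RayData g v x μ) {s : ℝ} (hs : 0 ≤ s) (hs1 : s ≤ 1) :
    ContinuousOn (rayIntegrand g v x μ s) (Ioi 0) := by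
  intro t ht
  have ht' : (0 : ℝ) < t := ht
  have h1 : ContinuousAt (fun t : ℝ => g (v * ((s : ℂ) * x + t))) t :=
    (h.differentiableAt hs ht'.le (.inr ht')).continuousAt.comp (f := fun t : ℝ =>
      v * ((s : ℂ) * x + t)) (by fun_prop)
  have h2 : ContinuousAt (fun t : ℝ => rayArg x μ s t) t := by
    unfold rayArg
    fun_prop
  have h3 := h2.cpow (continuousAt_const (y := (-(1 / 2) : ℂ)))
      (h.rayArg_mem_slitPlane hs1 (.inr ht'))
  exact (h1.mul h3).continuousWithinAt

theorem continuousOn_left (h : RayData g v x μ) {t : ℝ} (ht : 0 < t) :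
    ContinuousOn (fun s => rayIntegrand g v x μ s t) (Icc 0 1) := by
  intro s hs
  have h1 : ContinuousAt (fun s : ℝ => g (v * ((s : ℂ) * x + t))) s :=
    (h.differentiableAt hs.1 ht.le (.inr ht)).continuousAt.comp (f := fun s : ℝ =>
      v * ((s : ℂ) * x + t)) (by fun_prop)
  have h2 : ContinuousAt (fun s : ℝ => rayArg x μ s t) s := by
    unfold rayArg
    fun_prop
  have h3 := h2.cpow (continuousAt_const (y := (-(1 / 2) : ℂ)))
      (h.rayArg_mem_slitPlane hs.2 (.inr ht))
  exact (h1.mul h3).continuousWithinAt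

theorem exists_integrable_bound (h : RayData g v x μ) : ∃ B : ℝ → ℝ, IntegrableOn B (Ioi 0) ∧
    ∀ s ∈ Icc (0 : ℝ) 1, ∀ t ∈ Ioi (0 : ℝ), ‖rayIntegrand g v x μ s t‖ ≤ B t := by
  obtain ⟨A, b, hA, hb, hbd⟩ := h.exists_bound_of_rapidDecay h.decay
  set c := (μ * x).re / (2 * ‖x‖) with hc
  have hx : 0 < ‖x‖ := norm_pos_iff.2 h.x_ne_zero
  have hc0 : 0 < c := div_pos h.re_pos (by positivity)
  refine ⟨fun t => A * c ^ (-(1 / 2) : ℝ) * (t ^ (-(1 / 2) : ℝ) * Real.exp (-(b * t))),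
    (integrableOn_rpow_mul_exp_neg (by norm_num) hb).const_mul _, fun s hs t ht => ?_⟩
  have ht' : (0 : ℝ) < t := ht
  rw [rayIntegrand, norm_mul, norm_cpow_neg_half]
  have h1 := hbd s t hs.1 ht'.le (.inr ht')
  have h2 : ‖rayArg x μ s t‖ ^ (-(1 / 2) : ℝ) ≤ (t * c) ^ (-(1 / 2) : ℝ) :=
    Real.rpow_le_rpow_of_nonpos (by positivity) (h.le_norm_rayArg hs.2 ht'.le) (by norm_num)
  rw [Real.mul_rpow ht'.le hc0.le] at h2
  calc _ ≤ A * Real.exp (-(b * t)) * (t ^ (-(1 / 2) : ℝ) * c ^ (-(1 / 2) : ℝ)) := by gcongr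
    _ = _ := by ring

/-- The derivative carries the kernel to the power `-3/2`, which is not integrable at `t = 0` when
`s = 1`; hence the margin `δ`. -/
theorem exists_deriv_bound (h : RayData g v x μ) {δ : ℝ} (hδ : 0 < δ) : ∃ B b : ℝ, 0 < b ∧
    ∀ s t : ℝ, δ ≤ s → s ≤ 1 - δ → 0 ≤ t →
      ‖rayIntegrandDeriv g v x μ s t‖ ≤ B * Real.exp (-(b * t)) := by
  obtain ⟨A, b, hA, hb, hbd⟩ := h.exists_bound_of_rapidDecay h.decay
  obtain ⟨A', b', hA', hb', hbd'⟩ := h.exists_bound_of_rapidDecay (h.decay.deriv h.diff)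
  set q := δ * (μ * x).re with hq
  have hq0 : 0 < q := mul_pos hδ h.re_pos
  refine ⟨‖v‖ * A' * q ^ (-(1 / 2) : ℝ) + A * (‖μ‖ / 2 * q ^ (-(1 / 2) - 1 : ℝ)), min b b',
    lt_min hb hb', fun s t hs hs1 ht => ?_⟩
  have hs0 : 0 < s := hδ.trans_le hs
  have hqy : q ≤ ‖rayArg x μ s t‖ := by
    refine le_trans ?_ (Complex.re_le_norm _)
    rw [h.rayArg_re]
    exact mul_le_mul_of_nonneg_right (by linarith) h.re_pos.le
  have h1 := hbd s t hs0.le ht (.inl hs0)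
  have h2 := hbd' s t hs0.le ht (.inl hs0)
  have h3 : ‖rayArg x μ s t‖ ^ (-(1 / 2) : ℝ) ≤ q ^ (-(1 / 2) : ℝ) :=
    Real.rpow_le_rpow_of_nonpos hq0 hqy (by norm_num)
  have h4 : ‖rayArg x μ s t‖ ^ (-(1 / 2) - 1 : ℝ) ≤ q ^ (-(1 / 2) - 1 : ℝ) :=
    Real.rpow_le_rpow_of_nonpos hq0 hqy (by norm_num)
  have h5 : Real.exp (-(b * t)) ≤ Real.exp (-(min b b' * t)) :=
    Real.exp_le_exp.2 (neg_le_neg (mul_le_mul_of_nonneg_right (min_le_left _ _) ht))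
  have h6 : Real.exp (-(b' * t)) ≤ Real.exp (-(min b b' * t)) :=
    Real.exp_le_exp.2 (neg_le_neg (mul_le_mul_of_nonneg_right (min_le_right _ _) ht))
  rw [rayIntegrandDeriv]
  refine (norm_add_le _ _).trans ?_
  rw [norm_mul, norm_mul, norm_mul, norm_mul, norm_cpow_neg_half, norm_cpow_neg_half_sub_one,
    norm_div, Complex.norm_two]
  calc _ ≤ ‖v‖ * (A' * Real.exp (-(min b b' * t))) * q ^ (-(1 / 2) : ℝ) +
        A * Real.exp (-(min b b' * t)) * (‖μ‖ / 2 * q ^ (-(1 / 2) - 1 : ℝ)) := by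
        gcongr
        · exact h2.trans (by gcongr)
        · exact h1.trans (by gcongr)
    _ = _ := by ring

theorem integrableOn_rayIntegrand (h : RayData g v x μ) {s : ℝ} (hs : s ∈ Icc (0 : ℝ) 1) :
    IntegrableOn (rayIntegrand g v x μ s) (Ioi 0) := by
  obtain ⟨B, hB, hb⟩ := h.exists_integrable_bound
  refine Integrable.mono' hB ((h.continuousOn_right hs.1 hs.2).aestronglyMeasurable
    measurableSet_Ioi) ?_
  filter_upwards [ae_restrict_mem measurableSet_Ioi] with t ht
  exact hb s hs t ht

theorem continuousOn_integral (h : RayData g v x μ) :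
    ContinuousOn (fun s => ∫ t in Ioi (0 : ℝ), rayIntegrand g v x μ s t) (Icc 0 1) := by
  obtain ⟨B, hB, hb⟩ := h.exists_integrable_bound
  refine continuousOn_of_dominated (bound := B) (fun s hs => (h.continuousOn_right hs.1
    hs.2).aestronglyMeasurable measurableSet_Ioi) (fun s hs => ?_) hB ?_
  · filter_upwards [ae_restrict_mem measurableSet_Ioi] with t ht
    exact hb s hs t ht
  · filter_upwards [ae_restrict_mem measurableSet_Ioi] with t ht
    exact h.continuousOn_left ht

/-- Under the integral, the derivative in `s` is `x` times a derivative in `t`, so only the boundary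
value at `t = 0` survives. -/
theorem hasDerivAt_integral (h : RayData g v x μ) {s : ℝ} (hs : 0 < s) (hs1 : s < 1) :
    HasDerivAt (fun s => ∫ t in Ioi (0 : ℝ), rayIntegrand g v x μ s t)
      (-(x * rayIntegrand g v x μ s 0)) s := by
  -- Half the distance to the endpoints, so that the `δ`-ball around `s` still keeps distance `δ`
  -- from them.
  set δ := min s (1 - s) / 2 with hδ
  have hm : 0 < min s (1 - s) := lt_min hs (by linarith)
  have hδ0 : 0 < δ := by positivity
  obtain ⟨B, b, hb, hB⟩ := h.exists_deriv_bound hδ0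
  have hexp : IntegrableOn (fun t : ℝ => Real.exp (-(b * t))) (Ioi 0) := by
    simpa using integrableOn_rpow_mul_exp_neg (s := 0) (by norm_num) hb
  have hle1 : δ + δ ≤ s := by rw [hδ, add_halves]; exact min_le_left _ _
  have hle2 : δ + δ ≤ 1 - s := by rw [hδ, add_halves]; exact min_le_right _ _
  have hball : ∀ r ∈ Metric.ball s δ, δ ≤ r ∧ r ≤ 1 - δ := by
    intro r hr
    rw [Metric.mem_ball, Real.dist_eq, abs_lt] at hr
    exact ⟨by linarith [hr.1], by linarith [hr.2]⟩
  have hcD : ContinuousOn (rayIntegrandDeriv g v x μ s) (Ioi 0) := by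
    intro t ht
    have ht' : (0 : ℝ) < t := ht
    have hopen : IsOpen {z : ℂ | 0 < z.im} := isOpen_lt continuous_const Complex.continuous_im
    have hz := h.im_pos hs.le ht'.le (.inl hs)
    have h0 : ContinuousAt (fun t : ℝ => v * ((s : ℂ) * x + t)) t := by fun_prop
    have h1 : ContinuousAt (fun t : ℝ => g (v * ((s : ℂ) * x + t))) t :=
      (h.differentiableAt hs.le ht'.le (.inr ht')).continuousAt.comp (f := fun t : ℝ =>
        v * ((s : ℂ) * x + t)) h0
    have h1' : ContinuousAt (fun t : ℝ => deriv g (v * ((s : ℂ) * x + t))) t :=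
      (((h.diff.deriv hopen).differentiableAt (hopen.mem_nhds hz)).continuousAt).comp
          (f := fun t : ℝ =>
        v * ((s : ℂ) * x + t)) h0
    have h2 : ContinuousAt (fun t : ℝ => rayArg x μ s t) t := by
      unfold rayArg
      fun_prop
    have h3 := h2.cpow (continuousAt_const (y := (-(1 / 2) : ℂ)))
        (h.rayArg_mem_slitPlane hs1.le (.inr ht'))
    have h4 := h2.cpow (continuousAt_const (y := (-(1 / 2) - 1 : ℂ)))
        (h.rayArg_mem_slitPlane hs1.le (.inr ht'))
    exact (((continuousAt_const.mul h1').mul h3).add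
      (h1.mul (continuousAt_const.mul h4))).continuousWithinAt
  have hIcc : ∀ᶠ r in 𝓝 s, r ∈ Icc (0 : ℝ) 1 := Icc_mem_nhds hs hs1
  have key := hasDerivAt_integral_of_dominated_loc_of_deriv_le (μ := volume.restrict (Ioi (0 : ℝ)))
    (F := fun s t => rayIntegrand g v x μ s t) (x₀ := s)
    (F' := fun s t => x * rayIntegrandDeriv g v x μ s t)
    (bound := fun t => ‖x‖ * (B * Real.exp (-(b * t)))) (Metric.ball_mem_nhds s hδ0)
    (hIcc.mono fun r hr => (h.continuousOn_right hr.1 hr.2).aestronglyMeasurable measurableSet_Ioi)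
    (h.integrableOn_rayIntegrand ⟨hs.le, hs1.le⟩)
    ((continuousOn_const.mul hcD).aestronglyMeasurable measurableSet_Ioi)
    (by
      filter_upwards [ae_restrict_mem measurableSet_Ioi] with t ht r hr
      rw [norm_mul]
      exact mul_le_mul_of_nonneg_left (hB r t (hball r hr).1 (hball r hr).2 (le_of_lt ht))
        (norm_nonneg _))
    ((hexp.const_mul B).const_mul _)
    (by
      filter_upwards [ae_restrict_mem measurableSet_Ioi] with t ht r hr
      exact h.hasDerivAt_left (hδ0.le.trans (hball r hr).1) (by linarith [(hball r hr).2])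
        (le_of_lt ht) (.inr ht))
  refine key.2.congr_deriv ?_
  have hint : IntegrableOn (rayIntegrandDeriv g v x μ s) (Ioi 0) := by
    refine Integrable.mono' (hexp.const_mul B) (hcD.aestronglyMeasurable measurableSet_Ioi) ?_
    filter_upwards [ae_restrict_mem measurableSet_Ioi] with t ht
    exact hB s t (by linarith) (by linarith) (le_of_lt ht)
  have hlim : Tendsto (fun t => rayIntegrand g v x μ s t) atTop (𝓝 0) := by
    obtain ⟨A, b, hA, hb, hbd⟩ := h.exists_bound_of_rapidDecay h.decay
    have hx : 0 < (1 - s) * (μ * x).re := mul_pos (by linarith) h.re_pos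
    have hexp0 : Tendsto (fun t : ℝ => A * ((1 - s) * (μ * x).re) ^ (-(1 / 2) : ℝ) *
        Real.exp (-(b * t))) atTop (𝓝 0) := by
      have : Tendsto (fun t : ℝ => Real.exp (-(b * t))) atTop (𝓝 0) :=
        Real.tendsto_exp_neg_atTop_nhds_zero.comp (tendsto_id.const_mul_atTop hb)
      simpa using this.const_mul (A * ((1 - s) * (μ * x).re) ^ (-(1 / 2) : ℝ))
    refine squeeze_zero_norm' ?_ hexp0
    filter_upwards [eventually_ge_atTop 0] with t ht
    rw [rayIntegrand, norm_mul, norm_cpow_neg_half]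
    have h1 := hbd s t hs.le ht (.inl hs)
    have h2 : ‖rayArg x μ s t‖ ^ (-(1 / 2) : ℝ) ≤ ((1 - s) * (μ * x).re) ^ (-(1 / 2) : ℝ) :=
      Real.rpow_le_rpow_of_nonpos hx
        ((h.rayArg_re s t).symm.le.trans (Complex.re_le_norm _)) (by norm_num)
    calc _ ≤ A * Real.exp (-(b * t)) * ((1 - s) * (μ * x).re) ^ (-(1 / 2) : ℝ) := by gcongr
      _ = _ := by ring
  have hFTC := integral_Ioi_of_hasDerivAt_of_tendsto'
    (fun t ht => h.hasDerivAt_right hs hs1 ht) hint hlim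
  rw [integral_const_mul, hFTC]
  ring

end RayData

end QuantumModular
end

noncomputable section
namespace QuantumModular

open Filter Topology MeasureTheory Set

/-! ### Laplace transforms of theta series -/

theorem integrableOn_inv_sqrt_mul_exp_neg {β : ℝ} (hβ : 0 < β) :
    IntegrableOn (fun t : ℝ => (√t)⁻¹ * Real.exp (-(β * t))) (Ioi 0) := by
  refine (integrableOn_rpow_mul_exp_neg (s := -(1 / 2)) (by norm_num) hβ).congr_fun
    (fun t ht => ?_) measurableSet_Ioi
  have ht' : (0 : ℝ) < t := ht
  simp only
  rw [Real.sqrt_eq_rpow, ← Real.rpow_neg ht'.le]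

theorem integrableOn_sqrt_mul_exp_neg {β : ℝ} (hβ : 0 < β) :
    IntegrableOn (fun t : ℝ => √t * Real.exp (-(β * t))) (Ioi 0) := by
  refine (integrableOn_rpow_mul_exp_neg (s := 1 / 2) (by norm_num) hβ).congr_fun
    (fun t ht => ?_) measurableSet_Ioi
  simp only
  rw [Real.sqrt_eq_rpow]

theorem norm_cexp_neg_mul (b : ℂ) (t : ℝ) :
    ‖Complex.exp (-(b * t))‖ = Real.exp (-(b.re * t)) := by
  rw [Complex.norm_exp]
  simp

theorem integrableOn_ofReal_mul_cexp {ω : ℝ → ℝ} (hω : ContinuousOn ω (Ioi 0))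
    (hint : ∀ β : ℝ, 0 < β → IntegrableOn (fun t => ω t * Real.exp (-(β * t))) (Ioi 0))
    {b : ℂ} (hb : 0 < b.re) :
    IntegrableOn (fun t : ℝ => (ω t : ℂ) * Complex.exp (-(b * t))) (Ioi 0) := by
  refine (hint b.re hb).norm.mono' ?_ ?_
  · refine ContinuousOn.aestronglyMeasurable ?_ measurableSet_Ioi
    exact (Complex.continuous_ofReal.comp_continuousOn hω).mul
      (Continuous.continuousOn (by fun_prop))
  · refine Eventually.of_forall fun t => ?_
    rw [norm_mul, norm_mul, norm_cexp_neg_mul, Complex.norm_real, Real.norm_of_nonneg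
      (Real.exp_pos _).le]

theorem continuousOn_inv_sqrt : ContinuousOn (fun t : ℝ => (√t)⁻¹) (Ioi 0) :=
  Real.continuous_sqrt.continuousOn.inv₀ fun _ ht => (Real.sqrt_pos.2 ht).ne'

/-- The substitution `t = u ^ 2` gives a complex Gaussian integral. -/
theorem integral_inv_sqrt_mul_cexp {b : ℂ} (hb : 0 < b.re) :
    ∫ t in Ioi (0 : ℝ), (((√t)⁻¹ : ℝ) : ℂ) * Complex.exp (-(b * t)) =
      (Real.pi / b) ^ (1 / 2 : ℂ) := by
  have h := integral_comp_rpow_Ioi_of_pos (E := ℂ)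
    (g := fun t : ℝ => (((√t)⁻¹ : ℝ) : ℂ) * Complex.exp (-(b * t))) (p := 2) two_pos
  rw [← h]
  have h2 : ∀ t ∈ Ioi (0 : ℝ), (2 * t ^ ((2 : ℝ) - 1)) •
      ((((√(t ^ (2 : ℝ)))⁻¹ : ℝ) : ℂ) * Complex.exp (-(b * ((t ^ (2 : ℝ) : ℝ) : ℂ)))) =
      2 * Complex.exp (-b * (t : ℂ) ^ 2) := by
    intro t ht
    have ht' : (0 : ℝ) < t := ht
    have ht0 : (t : ℂ) ≠ 0 := by exact_mod_cast ht'.ne'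
    rw [show (2 : ℝ) - 1 = 1 by norm_num, Real.rpow_one, Real.rpow_two, Real.sqrt_sq ht'.le,
      Complex.real_smul]
    push_cast
    rw [neg_mul]
    field_simp
  rw [setIntegral_congr_fun measurableSet_Ioi h2, integral_const_mul,
      integral_gaussian_complex_Ioi hb]
  ring

/-- Integration by parts: `√t * exp (-b t)` vanishes at both ends, and its derivative links this
integral to the one with `(√t)⁻¹`. -/
theorem integral_sqrt_mul_cexp {b : ℂ} (hb : 0 < b.re) :
    ∫ t in Ioi (0 : ℝ), ((√t : ℝ) : ℂ) * Complex.exp (-(b * t)) =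
      1 / (2 * b) * (Real.pi / b) ^ (1 / 2 : ℂ) := by
  have hb0 : b ≠ 0 := by rintro rfl; simp at hb
  have hi1 := integrableOn_ofReal_mul_cexp continuousOn_inv_sqrt
    (fun β hβ => integrableOn_inv_sqrt_mul_exp_neg hβ) hb
  have hi2 := integrableOn_ofReal_mul_cexp Real.continuous_sqrt.continuousOn
    (fun β hβ => integrableOn_sqrt_mul_exp_neg hβ) hb
  have hd : ∀ t ∈ Ioi (0 : ℝ), HasDerivAt
      (fun t : ℝ => ((√t : ℝ) : ℂ) * Complex.exp (-(b * t)))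
      (1 / 2 * ((((√t)⁻¹ : ℝ) : ℂ) * Complex.exp (-(b * t))) -
        b * (((√t : ℝ) : ℂ) * Complex.exp (-(b * t)))) t := by
    intro t ht
    have ht' : (0 : ℝ) < t := ht
    have h1 := (Real.hasDerivAt_sqrt ht'.ne').ofReal_comp
    have h2 : HasDerivAt (fun t : ℝ => Complex.exp (-(b * t)))
        (Complex.exp (-(b * t)) * (-(b * 1))) t :=
      (((hasDerivAt_id t).ofReal_comp).const_mul b).neg.cexp
    refine (h1.mul h2).congr_deriv ?_
    push_cast
    ring
  have hlim : Tendsto (fun t : ℝ => ((√t : ℝ) : ℂ) * Complex.exp (-(b * t))) atTop (𝓝 0) := by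
    rw [tendsto_zero_iff_norm_tendsto_zero]
    have := tendsto_rpow_mul_exp_neg_mul_atTop_nhds_zero (1 / 2) b.re hb
    refine this.congr' ?_
    filter_upwards with t
    rw [norm_mul, norm_cexp_neg_mul, Complex.norm_real, Real.norm_of_nonneg (Real.sqrt_nonneg _),
      Real.sqrt_eq_rpow, neg_mul]
  have h := integral_Ioi_of_hasDerivAt_of_tendsto
    (f := fun t : ℝ => ((√t : ℝ) : ℂ) * Complex.exp (-(b * t))) (a := 0)
    (Continuous.continuousWithinAt (by fun_prop)) hd
    ((hi1.const_mul (1 / 2)).sub (hi2.const_mul b)) hlim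
  rw [integral_sub (hi1.const_mul _) (hi2.const_mul _), integral_const_mul, integral_const_mul,
    integral_inv_sqrt_mul_cexp hb] at h
  simp only [Real.sqrt_zero, Complex.ofReal_zero, zero_mul, sub_zero] at h
  have h' : b * ∫ t in Ioi (0 : ℝ), ((√t : ℝ) : ℂ) * Complex.exp (-(b * t)) =
      1 / 2 * (Real.pi / b) ^ (1 / 2 : ℂ) := by
    linear_combination -h
  field_simp
  field_simp at h'
  linear_combination h'

theorem thetaTerm_add_mul (m : ℕ) (a : ℤ → ℂ) (P : ℝ) (n : ℤ) (w v : ℂ) (t : ℝ) :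
    thetaTerm m a P n (w + t * v) = thetaTerm m a P n w *
      Complex.exp (-(Real.pi * n ^ 2 * (-Complex.I * v) / P * t)) := by
  rw [thetaTerm, thetaTerm, mul_assoc _ (Complex.exp _), ← Complex.exp_add]
  congr 2
  ring

section laplace

variable {m : ℕ} {a : ℤ → ℂ} {P A : ℝ} {w v : ℂ}

/-- Termwise integration. Since `n ^ 2 ≥ 1`, the integral of the norm of each term is at most its
norm at `w` times the integral for `n = 1`, which is summable. -/
theorem laplace_thetaSeries {ω : ℝ → ℝ} (hω : ContinuousOn ω (Ioi 0)) (hω0 : ∀ t, 0 ≤ ω t)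
    (hint : ∀ β : ℝ, 0 < β → IntegrableOn (fun t => ω t * Real.exp (-(β * t))) (Ioi 0))
    (hP : 0 < P) (ha : ∀ n, ‖a n‖ ≤ A) (ha0 : a 0 = 0) (hw : 0 < w.im) (hv : 0 < v.im) :
    ∫ t in Ioi (0 : ℝ), (ω t : ℂ) * thetaSeries m a P (w + t * v) =
      ∑' n : ℕ, thetaTerm m a P n w * ∫ t in Ioi (0 : ℝ), (ω t : ℂ) *
        Complex.exp (-(Real.pi * (n : ℂ) ^ 2 * (-Complex.I * v) / P * t)) := by
  have hpi := Real.pi_pos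
  have hre : ∀ n : ℕ, (Real.pi * (n : ℂ) ^ 2 * (-Complex.I * v) / P).re =
      Real.pi * n ^ 2 / P * v.im := by
    intro n
    have : (Real.pi * (n : ℂ) ^ 2 * (-Complex.I * v) / P : ℂ) =
        ((Real.pi * n ^ 2 / P : ℝ) : ℂ) * (-Complex.I * v) := by push_cast; ring
    rw [this, Complex.re_ofReal_mul]
    simp
  have hterm : ∀ (n : ℕ) (t : ℝ), (ω t : ℂ) * thetaTerm m a P n (w + t * v) =
      thetaTerm m a P n w * ((ω t : ℂ) *
        Complex.exp (-(Real.pi * (n : ℂ) ^ 2 * (-Complex.I * v) / P * t))) := by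
    intro n t
    rw [thetaTerm_add_mul]
    push_cast
    ring
  have h0 : ∀ z, thetaTerm m a P 0 z = 0 := by simp [thetaTerm, ha0]
  have hF : ∀ n : ℕ, IntegrableOn (fun t : ℝ => (ω t : ℂ) * thetaTerm m a P n (w + t * v))
      (Ioi 0) := by
    intro n
    rcases Nat.eq_zero_or_pos n with rfl | hn
    · simp [h0]
    simp only [hterm]
    refine (integrableOn_ofReal_mul_cexp hω hint ?_).const_mul _
    rw [hre]
    positivity
  have hβ : 0 < Real.pi / P * v.im := by positivity
  have hsum : Summable fun n : ℕ =>
      ∫ t in Ioi (0 : ℝ), ‖(ω t : ℂ) * thetaTerm m a P n (w + t * v)‖ := by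
    refine .of_nonneg_of_le (fun n => integral_nonneg fun t => norm_nonneg _) (fun n => ?_)
      ((summable_norm_thetaTerm hP ha ha0 hw (m := m)).mul_right
        (∫ t in Ioi (0 : ℝ), ω t * Real.exp (-(Real.pi / P * v.im * t))))
    rcases Nat.eq_zero_or_pos n with rfl | hn
    · simp [h0]
    rw [← integral_const_mul]
    refine setIntegral_mono_on (hF n).norm ((hint _ hβ).const_mul _) measurableSet_Ioi
      fun t ht => ?_
    have ht' : (0 : ℝ) < t := ht
    rw [hterm, norm_mul, norm_mul, norm_cexp_neg_mul, hre, Complex.norm_real,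
      Real.norm_of_nonneg (hω0 t)]
    have hn1 : (1 : ℝ) ≤ (n : ℝ) ^ 2 := by
      have : (1 : ℝ) ≤ n := by exact_mod_cast hn
      nlinarith
    have h1 : Real.pi / P * v.im * t ≤ Real.pi * n ^ 2 / P * v.im * t := by
      have h2 : 0 ≤ Real.pi / P * v.im * t := by positivity
      calc _ ≤ (n : ℝ) ^ 2 * (Real.pi / P * v.im * t) := le_mul_of_one_le_left h2 hn1
        _ = _ := by ring
    have := hω0 t
    gcongr
  have key := (hasSum_integral_of_summable_integral_norm hF hsum).tsum_eq
  simp only [hterm, integral_const_mul] at key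
  rw [key]
  refine setIntegral_congr_fun measurableSet_Ioi fun t _ => ?_
  simp only [← hterm]
  rw [tsum_mul_left]
  rfl

theorem integrableOn_mul_thetaSeries {ω : ℝ → ℝ} (hω : ContinuousOn ω (Ioi 0))
    (hint : ∀ β : ℝ, 0 < β → IntegrableOn (fun t => ω t * Real.exp (-(β * t))) (Ioi 0))
    (hP : 0 < P) (ha : ∀ n, ‖a n‖ ≤ A) (ha0 : a 0 = 0) (hw : 0 < w.im) (hv : 0 < v.im) :
    IntegrableOn (fun t : ℝ => (ω t : ℂ) * thetaSeries m a P (w + t * v)) (Ioi 0) := by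
  obtain ⟨K, hK, hbd⟩ := exists_norm_thetaSeries_le (m := m) hP ha ha0 hw
  have hpi := Real.pi_pos
  have him : ∀ t : ℝ, (w + t * v).im = w.im + t * v.im := fun t => by
    rw [Complex.add_im, Complex.im_ofReal_mul]
  refine ((hint (Real.pi / (2 * P) * v.im) (by positivity)).norm.const_mul K).mono' ?_ ?_
  · refine ContinuousOn.aestronglyMeasurable (fun t ht => ?_) measurableSet_Ioi
    have ht' : (0 : ℝ) < t := ht
    have h1 : ContinuousAt (fun t : ℝ => thetaSeries m a P (w + t * v)) t :=
      (hasDerivAt_thetaSeries hP ha ha0 (z := w + t * v)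
        (by rw [him]; positivity)).continuousAt.comp (f := fun t : ℝ => w + t * v) (by fun_prop)
    exact ((Complex.continuous_ofReal.comp_continuousOn hω) t ht).mul h1.continuousWithinAt
  · filter_upwards [ae_restrict_mem measurableSet_Ioi] with t ht
    have ht' : (0 : ℝ) < t := ht
    have h1 := hbd (w + t * v) (by
      rw [him]
      have : 0 < t * v.im := by positivity
      linarith)
    have h2 : Real.exp (-(Real.pi / (2 * P) * (w + t * v).im)) ≤
        Real.exp (-(Real.pi / (2 * P) * v.im * t)) := by
      rw [him]
      refine Real.exp_le_exp.2 (neg_le_neg ?_)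
      have : 0 ≤ Real.pi / (2 * P) * w.im := by positivity
      linarith
    rw [norm_mul, norm_mul, Complex.norm_real, Real.norm_of_nonneg (Real.exp_pos _).le]
    calc _ ≤ ‖ω t‖ *
        (K * Real.exp (-(Real.pi / (2 * P) * v.im * t))) := by gcongr; exact h1.trans (by gcongr)
      _ = _ := by ring

theorem pi_div_cpow_half (hP : 0 < P) {n : ℕ} (hn : 0 < n) (hv : 0 < v.im) :
    (Real.pi / (Real.pi * (n : ℂ) ^ 2 * (-Complex.I * v) / P) : ℂ) ^ (1 / 2 : ℂ) =
      √P / n * invSqrt v := by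
  have hpi : (Real.pi : ℂ) ≠ 0 := by exact_mod_cast Real.pi_ne_zero
  have hn' : (0 : ℝ) < n := by exact_mod_cast hn
  have hP' : (P : ℂ) ≠ 0 := by exact_mod_cast hP.ne'
  have hv0 : v ≠ 0 := by rintro rfl; simp at hv
  have hs := neg_I_mul_mem_slitPlane hv
  have h : (Real.pi / (Real.pi * (n : ℂ) ^ 2 * (-Complex.I * v) / P) : ℂ) =
      ((P / n ^ 2 : ℝ) : ℂ) * (-Complex.I * v)⁻¹ := by
    have : (n : ℂ) ≠ 0 := by exact_mod_cast hn.ne'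
    push_cast
    field_simp
  rw [h, ofReal_mul_cpow (by positivity), Complex.inv_cpow _ _ (Complex.slitPlane_arg_ne_pi hs),
    ← Complex.cpow_neg, invSqrt]
  congr 1
  rw [show (1 / 2 : ℂ) = ((1 / 2 : ℝ) : ℂ) by push_cast; rfl, ← Complex.ofReal_cpow (by positivity),
    ← Real.sqrt_eq_rpow, Real.sqrt_div hP.le, Real.sqrt_sq hn'.le]
  push_cast
  rfl

theorem re_gauss_pos (hP : 0 < P) {n : ℕ} (hn : 0 < n) (hv : 0 < v.im) :
    0 < (Real.pi * (n : ℂ) ^ 2 * (-Complex.I * v) / P).re := by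
  have hpi := Real.pi_pos
  have : (Real.pi * (n : ℂ) ^ 2 * (-Complex.I * v) / P : ℂ) =
      ((Real.pi * n ^ 2 / P : ℝ) : ℂ) * (-Complex.I * v) := by push_cast; ring
  rw [this, Complex.re_ofReal_mul]
  have : (-Complex.I * v).re = v.im := by simp
  rw [this]
  positivity

/-- The Laplace transform of `t^(-1/2)` at a multiple of `n ^ 2` is proportional to `1 / n`, so it
removes one factor `n`. Only boundedness of the coefficients is assumed, because non-periodic ones
occur in `IsThetaCoeff.integral_dual_one`. -/
theorem laplace_inv_sqrt_thetaSeries (hP : 0 < P) (ha : ∀ n, ‖a n‖ ≤ A) (ha0 : a 0 = 0)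
    (hw : 0 < w.im) (hv : 0 < v.im) :
    ∫ t in Ioi (0 : ℝ), (((√t)⁻¹ : ℝ) : ℂ) * thetaSeries (m + 1) a P (w + t * v) =
      √P * invSqrt v * thetaSeries m a P w := by
  rw [laplace_thetaSeries continuousOn_inv_sqrt (fun t => by positivity)
    (fun β hβ => integrableOn_inv_sqrt_mul_exp_neg hβ) hP ha ha0 hw hv, thetaSeries,
    ← tsum_mul_left]
  refine tsum_congr fun n => ?_
  rcases Nat.eq_zero_or_pos n with rfl | hn
  · simp [thetaTerm, ha0]
  rw [integral_inv_sqrt_mul_cexp (re_gauss_pos hP hn hv), pi_div_cpow_half hP hn hv, thetaTerm,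
    thetaTerm]
  have : (n : ℂ) ≠ 0 := by exact_mod_cast hn.ne'
  push_cast
  field_simp
  ring

theorem laplace_sqrt_thetaSeries (hP : 0 < P) (ha : ∀ n, ‖a n‖ ≤ A) (ha0 : a 0 = 0)
    (hw : 0 < w.im) (hv : 0 < v.im) :
    ∫ t in Ioi (0 : ℝ), ((√t : ℝ) : ℂ) * thetaSeries (m + 3) a P (w + t * v) =
      P / (2 * Real.pi) * √P * invSqrt v * (Complex.I / v) * thetaSeries m a P w := by
  rw [laplace_thetaSeries Real.continuous_sqrt.continuousOn (fun t => by positivity)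
    (fun β hβ => integrableOn_sqrt_mul_exp_neg hβ) hP ha ha0 hw hv, thetaSeries,
    ← tsum_mul_left]
  refine tsum_congr fun n => ?_
  rcases Nat.eq_zero_or_pos n with rfl | hn
  · simp [thetaTerm, ha0]
  rw [integral_sqrt_mul_cexp (re_gauss_pos hP hn hv), pi_div_cpow_half hP hn hv, thetaTerm,
    thetaTerm]
  have : (n : ℂ) ≠ 0 := by exact_mod_cast hn.ne'
  have hpi : (Real.pi : ℂ) ≠ 0 := by exact_mod_cast Real.pi_ne_zero
  have hP' : (P : ℂ) ≠ 0 := by exact_mod_cast hP.ne'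
  have hv0 : v ≠ 0 := by rintro rfl; simp at hv
  have hI : Complex.I / v = 1 / (-Complex.I * v) := by
    field_simp
    simp
  rw [hI]
  push_cast
  field_simp
  ring

end laplace

theorem invSqrt_mul_invSqrt_neg_one_div {w : ℂ} (hw : 0 < w.im) :
    invSqrt w * invSqrt (-1 / w) = 1 := by
  have hw0 : w ≠ 0 := by rintro rfl; simp at hw
  have hs := neg_I_mul_mem_slitPlane hw
  have h : -Complex.I * (-1 / w) = (-Complex.I * w)⁻¹ := by
    field_simp
    simp
  have hne : -Complex.I * w ≠ 0 := Complex.slitPlane_ne_zero hs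
  rw [invSqrt, invSqrt, h, Complex.inv_cpow _ _ (Complex.slitPlane_arg_ne_pi hs), mul_inv_cancel₀]
  rw [Ne, Complex.cpow_eq_zero_iff]
  exact fun h => hne h.1

theorem invSqrt_ofReal_mul {r : ℝ} (hr : 0 < r) (z : ℂ) :
    invSqrt (r * z) = (√r : ℂ)⁻¹ * invSqrt z := by
  rw [invSqrt, invSqrt, ← ofReal_cpow_neg_half hr.le, ← ofReal_mul_cpow hr]
  congr 1
  ring

end QuantumModular
end

noncomputable section
namespace QuantumModular

open Filter Topology MeasureTheory Set

/-! ### The Eichler-type integral of a theta series -/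

theorem image_inv_one_add : (fun r : ℝ => (1 + r)⁻¹) '' Ioi 0 = Ioo 0 1 := by
  ext s
  simp only [mem_image, mem_Ioi, mem_Ioo]
  constructor
  · rintro ⟨r, hr, rfl⟩
    exact ⟨by positivity, inv_lt_one_of_one_lt₀ (by linarith)⟩
  · rintro ⟨h0, h1⟩
    refine ⟨s⁻¹ - 1, by linarith [(one_lt_inv₀ h0).2 h1], ?_⟩
    rw [add_sub_cancel, inv_inv]

/-- The substitution `s = (1 + r)⁻¹`. Under it `-1 / (s w) = -1 / w + r (-1 / w)`, so inversion
carries the segment from `0` to `w` to a ray starting at `-1 / w`. -/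
theorem integral_Ioo_eq_integral_Ioi (f : ℝ → ℂ) :
    ∫ s in Ioo (0 : ℝ) 1, f s = ∫ r in Ioi (0 : ℝ), ((1 + r) ^ 2)⁻¹ • f (1 + r)⁻¹ := by
  rw [← image_inv_one_add, integral_image_eq_integral_abs_deriv_smul measurableSet_Ioi
    (f := fun r : ℝ => (1 + r)⁻¹) (f' := fun r => -((1 + r) ^ 2)⁻¹)]
  · refine setIntegral_congr_fun measurableSet_Ioi fun r _ => ?_
    rw [abs_neg, abs_of_nonneg (by positivity)]
  · intro r hr
    have hr' : (0 : ℝ) < r := hr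
    have := ((hasDerivAt_id r).const_add 1).inv (c := fun r => 1 + r) (by simp; linarith)
    refine HasDerivAt.hasDerivWithinAt ?_
    refine this.congr_deriv ?_
    simp [div_eq_mul_inv]
  · intro r hr r' hr' h
    have := inv_injective h
    linarith

namespace RayData

variable {g : ℂ → ℂ} {v x μ : ℂ}

theorem integrableOn_start (h : RayData g v x μ) :
    IntegrableOn (fun s => rayIntegrand g v x μ s 0) (Ioo 0 1) := by
  obtain ⟨A, b, hA, hb, hbd⟩ := h.exists_bound_of_rapidDecay h.decay
  have hI : IntegrableOn (fun s : ℝ => (1 - s) ^ (-(1 / 2) : ℝ)) (Ioo 0 1) := by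
    have h1 := (intervalIntegral.intervalIntegrable_rpow' (a := 0) (b := 1)
      (show -1 < (-(1 / 2) : ℝ) by norm_num)).comp_sub_left 1
    have h2 := (intervalIntegrable_iff_integrableOn_Ioo_of_le (by norm_num)).1 h1.symm
    simpa using h2
  refine (hI.const_mul (A * (μ * x).re ^ (-(1 / 2) : ℝ))).mono' ?_ ?_
  · refine ContinuousOn.aestronglyMeasurable (fun s hs => ?_) measurableSet_Ioo
    exact ((h.hasDerivAt_left hs.1.le hs.2 le_rfl (.inl hs.1)).continuousAt).continuousWithinAt
  · filter_upwards [ae_restrict_mem measurableSet_Ioo] with s hs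
    have h1 := hbd s 0 hs.1.le le_rfl (.inl hs.1)
    rw [mul_zero, neg_zero, Real.exp_zero, mul_one] at h1
    have hpos : 0 < (1 - s) * (μ * x).re := mul_pos (by linarith [hs.2]) h.re_pos
    have h2 : ‖rayArg x μ s 0‖ ^ (-(1 / 2) : ℝ) ≤ ((1 - s) * (μ * x).re) ^ (-(1 / 2) : ℝ) :=
      Real.rpow_le_rpow_of_nonpos hpos
        ((h.rayArg_re s 0).symm.le.trans (Complex.re_le_norm _)) (by norm_num)
    rw [Real.mul_rpow (by linarith [hs.2]) h.re_pos.le] at h2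
    rw [rayIntegrand, norm_mul, norm_cpow_neg_half]
    calc _ ≤ A * ((1 - s) ^ (-(1 / 2) : ℝ) * (μ * x).re ^ (-(1 / 2) : ℝ)) := by gcongr
      _ = _ := by ring

/-- Fundamental theorem of calculus in `s`: starting the ray at `v * x` instead of `0` leaves out
exactly the segment between these points. -/
theorem integral_sub_integral (h : RayData g v x μ) :
    (∫ t in Ioi (0 : ℝ), rayIntegrand g v x μ 0 t) =
      (∫ t in Ioi (0 : ℝ), rayIntegrand g v x μ 1 t) +
        x * ∫ s in Ioo (0 : ℝ) 1, rayIntegrand g v x μ s 0 := by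
  have h1 := intervalIntegral.integral_eq_sub_of_hasDerivAt_of_le zero_le_one
    h.continuousOn_integral (fun s hs => h.hasDerivAt_integral hs.1 hs.2)
    ((intervalIntegrable_iff_integrableOn_Ioo_of_le zero_le_one).2
      (h.integrableOn_start.const_mul x).neg)
  rw [intervalIntegral.integral_of_le zero_le_one, integral_Ioc_eq_integral_Ioo,
    integral_neg, integral_const_mul] at h1
  linear_combination h1

theorem integral_start (_h : RayData g v x μ) :
    ∫ s in Ioo (0 : ℝ) 1, rayIntegrand g v x μ s 0 = (μ * x) ^ (-(1 / 2) : ℂ) *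
      ∫ s in Ioo (0 : ℝ) 1, g (s * (v * x)) * (√(1 - s) : ℂ)⁻¹ := by
  rw [← integral_const_mul]
  refine setIntegral_congr_fun measurableSet_Ioo fun s hs => ?_
  have h1 : (0 : ℝ) < 1 - s := by linarith [hs.2]
  have h2 : rayArg x μ s 0 = ((1 - s : ℝ) : ℂ) * (μ * x) := by
    rw [rayArg]
    push_cast
    ring
  rw [rayIntegrand, h2, ofReal_mul_cpow h1, ofReal_cpow_neg_half h1.le]
  rw [show v * (s * x + (0 : ℝ)) = s * (v * x) by push_cast; ring]
  ring

theorem integral_end (_h : RayData g v x μ) :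
    ∫ t in Ioi (0 : ℝ), rayIntegrand g v x μ 1 t = (-μ) ^ (-(1 / 2) : ℂ) *
      ∫ t in Ioi (0 : ℝ), (((√t)⁻¹ : ℝ) : ℂ) * g (v * x + t * v) := by
  rw [← integral_const_mul]
  refine setIntegral_congr_fun measurableSet_Ioi fun t ht => ?_
  have ht' : (0 : ℝ) < t := ht
  have h2 : rayArg x μ 1 t = (t : ℂ) * (-μ) := by
    rw [rayArg]
    push_cast
    ring
  rw [rayIntegrand, h2, ofReal_mul_cpow ht', ofReal_cpow_neg_half ht'.le]
  rw [show v * ((1 : ℝ) * x + t) = v * x + t * v by push_cast; ring]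
  push_cast
  ring

end RayData

/-! ### The segment from `0` to `w` as a Laplace transform on the dual side -/

section dual

variable {P : ℕ} {F : ℤ → ℂ} {w : ℂ}

theorem neg_one_div_inv_mul {r : ℝ} (hr : 0 < r) (w : ℂ) :
    -1 / (((1 + r)⁻¹ : ℝ) * w) = -1 / w + r * (-1 / w) := by
  have : (1 + r : ℂ) ≠ 0 := by exact_mod_cast (by linarith : (1 + r : ℝ) ≠ 0)
  push_cast
  rw [neg_div, neg_div, one_div, one_div, mul_inv, inv_inv]
  ring

theorem weight_identity {r : ℝ} (hr : 0 < r) :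
    ((1 + r) ^ 2)⁻¹ * ((√(1 + r)⁻¹)⁻¹ * (√(1 - (1 + r)⁻¹))⁻¹) = (√r)⁻¹ * (1 + r)⁻¹ := by
  have h1 : (0 : ℝ) < 1 + r := by linarith
  have h2 : 1 - (1 + r)⁻¹ = r / (1 + r) := by field_simp; ring
  rw [h2, Real.sqrt_inv, Real.sqrt_div hr.le, inv_inv, inv_div]
  have h3 : √(1 + r) * √(1 + r) = 1 + r := Real.mul_self_sqrt h1.le
  have h4 : √r ≠ 0 := (Real.sqrt_pos.2 hr).ne'
  field_simp
  rw [sq, h3]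

/-- The function `φ` is `g` stripped of its half-integral factor. The square roots and the Jacobian
combine into the Laplace weight `(√r)⁻¹` and one factor `(1 + r)⁻¹`. -/
theorem integral_dual {g φ : ℂ → ℂ} (hg : ∀ z : ℂ, 0 < z.im → g z = invSqrt z * φ z)
    (hw : 0 < w.im) :
    ∫ s in Ioo (0 : ℝ) 1, g (s * w) * (√(1 - s) : ℂ)⁻¹ =
      invSqrt w * ∫ r in Ioi (0 : ℝ), (((√r)⁻¹ : ℝ) : ℂ) *
        (((1 + r)⁻¹ : ℝ) * φ (((1 + r)⁻¹ : ℝ) * w)) := by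
  rw [integral_Ioo_eq_integral_Ioi, ← integral_const_mul]
  refine setIntegral_congr_fun measurableSet_Ioi fun r hr => ?_
  have hr' : (0 : ℝ) < r := hr
  have h1 : (0 : ℝ) < (1 + r)⁻¹ := by positivity
  have h2 : 0 < (((1 + r)⁻¹ : ℝ) * w : ℂ).im := by
    rw [Complex.im_ofReal_mul]
    exact mul_pos h1 hw
  have h3 := congrArg (fun x : ℝ => (x : ℂ)) (weight_identity hr')
  rw [hg _ h2, invSqrt_ofReal_mul h1, Complex.real_smul]
  generalize φ (((1 + r)⁻¹ : ℝ) * w) = y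
  simp only [Complex.ofReal_mul, Complex.ofReal_inv] at h3 ⊢
  linear_combination (invSqrt w * y) * h3

/-- The remaining factor `(1 + r)⁻¹` cancels against the `1 / z` of the inversion formula, leaving a
pure Laplace transform with weight `(√r)⁻¹`. -/
theorem IsThetaCoeff.integral_dual_zero (h : IsThetaCoeff 0 P F) (hw : 0 < w.im) :
    ∫ s in Ioo (0 : ℝ) 1, thetaSeries 1 F P (s * w) * (√(1 - s) : ℂ)⁻¹ =
      w⁻¹ * thetaSeries 0 (dft P F) P (-1 / w) := by
  obtain ⟨B, hB⟩ := exists_bound_of_periodic h.pos (dft_periodic h.pos F)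
  have hP' : (0 : ℝ) < P := by exact_mod_cast h.pos
  have hw0 : w ≠ 0 := by rintro rfl; simp at hw
  have hsq : (√P : ℂ) ≠ 0 := by exact_mod_cast (Real.sqrt_pos.2 hP').ne'
  have hw' := neg_one_div_im_pos hw
  rw [integral_dual (φ := fun z => (√P : ℂ)⁻¹ / z * thetaSeries 1 (dft P F) P (-1 / z))
    (fun z hz => by rw [h.thetaSeries_one_functional_equation hz]; ring) hw]
  have h1 : ∀ r ∈ Ioi (0 : ℝ), (((√r)⁻¹ : ℝ) : ℂ) * ((((1 + r)⁻¹ : ℝ) : ℂ) *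
      ((√P : ℂ)⁻¹ / ((((1 + r)⁻¹ : ℝ) : ℂ) * w) *
        thetaSeries 1 (dft P F) P (-1 / ((((1 + r)⁻¹ : ℝ) : ℂ) * w)))) =
      (√P : ℂ)⁻¹ / w * ((((√r)⁻¹ : ℝ) : ℂ) *
        thetaSeries (0 + 1) (dft P F) P (-1 / w + r * (-1 / w))) := by
    intro r hr
    have hr' : (0 : ℝ) < r := hr
    have : (((1 + r)⁻¹ : ℝ) : ℂ) ≠ 0 := by
      exact_mod_cast (inv_pos.2 (by linarith : (0 : ℝ) < 1 + r)).ne'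
    rw [neg_one_div_inv_mul hr']
    generalize (((1 + r)⁻¹ : ℝ) : ℂ) = y at *
    field_simp
  rw [setIntegral_congr_fun measurableSet_Ioi h1, integral_const_mul,
    laplace_inv_sqrt_thetaSeries hP' hB h.dft_zero hw' hw']
  have := invSqrt_mul_invSqrt_neg_one_div hw
  generalize invSqrt (-1 / w) = u at *
  generalize thetaSeries 0 (dft P F) P (-1 / w) = y
  field_simp
  linear_combination y * this

/-- For even coefficients the dual side contains the series of exponent `0`, from which no further
factor `n` can be removed. Dividing the coefficients by `n` raises the exponent and keeps them
bounded, at the price of periodicity. -/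
theorem thetaSeries_div {m : ℕ} {a : ℤ → ℂ} (ha0 : a 0 = 0) (P : ℝ) (z : ℂ) :
    thetaSeries (m + 1) (fun n => a n / n) P z = thetaSeries m a P z := by
  refine tsum_congr fun n => ?_
  rcases Nat.eq_zero_or_pos n with rfl | hn
  · simp [thetaTerm, ha0]
  have : (n : ℂ) ≠ 0 := by exact_mod_cast hn.ne'
  rw [thetaTerm, thetaTerm]
  push_cast
  field_simp
  ring

theorem norm_div_intCast_le {a : ℤ → ℂ} {A : ℝ} (ha : ∀ n, ‖a n‖ ≤ A) (n : ℤ) :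
    ‖a n / n‖ ≤ A := by
  rcases eq_or_ne n 0 with rfl | hn
  · simpa using (norm_nonneg _).trans (ha 0)
  rw [norm_div, Complex.norm_intCast]
  have : (1 : ℝ) ≤ |(n : ℝ)| := by exact_mod_cast Int.one_le_abs hn
  exact (div_le_self (norm_nonneg _) this).trans (ha n)

/-- The derivative term carries `(1 + r) / √r = 1 / √r + √r`. Its `√r` part, transformed by
`laplace_sqrt_thetaSeries`, cancels the term that came from differentiating `invSqrt`; the `1 / √r`
part gives the result. -/
theorem IsThetaCoeff.integral_dual_one (h : IsThetaCoeff 1 P F) (hw : 0 < w.im) :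
    ∫ s in Ioo (0 : ℝ) 1, thetaSeries 2 F P (s * w) * (√(1 - s) : ℂ)⁻¹ =
      w⁻¹ ^ 2 * thetaSeries 1 (dft P F) P (-1 / w) := by
  obtain ⟨B, hB⟩ := exists_bound_of_periodic h.pos (dft_periodic h.pos F)
  have hP' : (0 : ℝ) < P := by exact_mod_cast h.pos
  have hw0 : w ≠ 0 := by rintro rfl; simp at hw
  have hsq : (√P : ℂ) ≠ 0 := by exact_mod_cast (Real.sqrt_pos.2 hP').ne'
  have hw' := neg_one_div_im_pos hw
  set a : ℤ → ℂ := fun n => dft P F n / n with ha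
  have hb : ∀ n, ‖a n‖ ≤ B := norm_div_intCast_le hB
  have ha0 : a 0 = 0 := by simp [ha]
  have e : ∀ m z, thetaSeries m (dft P F) P z = thetaSeries (m + 1) a P z := fun m z =>
    (thetaSeries_div h.dft_zero P z).symm
  rw [integral_dual (φ := fun z => (√P : ℂ)⁻¹ *
      (P / (2 * Real.pi) * (Complex.I / z) * thetaSeries 1 a P (-1 / z) +
          z⁻¹ ^ 2 * thetaSeries 3 a P (-1 / z)))
    (fun z hz => by rw [h.thetaSeries_two_functional_equation hz, e, e]; ring) hw, e]
  have h1 : ∀ r ∈ Ioi (0 : ℝ), (((√r)⁻¹ : ℝ) : ℂ) * ((((1 + r)⁻¹ : ℝ) : ℂ) * ((√P : ℂ)⁻¹ *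
      (P / (2 * Real.pi) * (Complex.I / ((((1 + r)⁻¹ : ℝ) : ℂ) * w)) *
        thetaSeries 1 a P (-1 / ((((1 + r)⁻¹ : ℝ) : ℂ) * w)) +
      ((((1 + r)⁻¹ : ℝ) : ℂ) * w)⁻¹ ^ 2 *
        thetaSeries 3 a P (-1 / ((((1 + r)⁻¹ : ℝ) : ℂ) * w))))) =
      ((√P : ℂ)⁻¹ * (P / (2 * Real.pi) * (Complex.I / w)) * ((((√r)⁻¹ : ℝ) : ℂ) *
        thetaSeries (0 + 1) a P (-1 / w + r * (-1 / w))) +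
      (√P : ℂ)⁻¹ * w⁻¹ ^ 2 * ((((√r)⁻¹ : ℝ) : ℂ) *
        thetaSeries (2 + 1) a P (-1 / w + r * (-1 / w)))) +
      (√P : ℂ)⁻¹ * w⁻¹ ^ 2 * (((√r : ℝ) : ℂ) *
        thetaSeries (0 + 3) a P (-1 / w + r * (-1 / w))) := by
    intro r hr
    have hr' : (0 : ℝ) < r := hr
    have h2 : (1 + r : ℂ) ≠ 0 := by exact_mod_cast (by linarith : (1 + r : ℝ) ≠ 0)
    have h3 : (√r : ℂ) ≠ 0 := by exact_mod_cast (Real.sqrt_pos.2 hr').ne'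
    have h4 : (r : ℂ) = (√r : ℂ) * √r := by exact_mod_cast (Real.mul_self_sqrt hr'.le).symm
    have h5 : (√r : ℂ) = (√r : ℂ)⁻¹ * r := by
      rw [eq_inv_mul_iff_mul_eq₀ h3, ← h4]
    rw [neg_one_div_inv_mul hr', h5]
    norm_num
    field_simp
    ring
  have i1 := integrableOn_mul_thetaSeries (m := 0 + 1) continuousOn_inv_sqrt
    (fun β hβ => integrableOn_inv_sqrt_mul_exp_neg hβ) hP' hb ha0 hw' hw'
  have i2 := integrableOn_mul_thetaSeries (m := 2 + 1) continuousOn_inv_sqrt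
    (fun β hβ => integrableOn_inv_sqrt_mul_exp_neg hβ) hP' hb ha0 hw' hw'
  have i3 := integrableOn_mul_thetaSeries (m := 0 + 3) Real.continuous_sqrt.continuousOn
    (fun β hβ => integrableOn_sqrt_mul_exp_neg hβ) hP' hb ha0 hw' hw'
  have e1 := integral_add (i1.const_mul ((√P : ℂ)⁻¹ * (P / (2 * Real.pi) * (Complex.I / w))))
    (i2.const_mul ((√P : ℂ)⁻¹ * w⁻¹ ^ 2))
  have e2 := integral_add ((i1.const_mul ((√P : ℂ)⁻¹ * (P / (2 * Real.pi) * (Complex.I / w)))).add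
    (i2.const_mul ((√P : ℂ)⁻¹ * w⁻¹ ^ 2))) (i3.const_mul ((√P : ℂ)⁻¹ * w⁻¹ ^ 2))
  simp only [Pi.add_apply] at e2
  rw [setIntegral_congr_fun measurableSet_Ioi h1, e2, e1, integral_const_mul,
    integral_const_mul, integral_const_mul,
    laplace_inv_sqrt_thetaSeries hP' hb ha0 hw' hw',
    laplace_inv_sqrt_thetaSeries hP' hb ha0 hw' hw',
    laplace_sqrt_thetaSeries hP' hb ha0 hw' hw']
  have h6 := invSqrt_mul_invSqrt_neg_one_div hw
  have hpi : (Real.pi : ℂ) ≠ 0 := by exact_mod_cast Real.pi_ne_zero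
  rw [show Complex.I / (-1 / w) = -(Complex.I * w) by field_simp]
  generalize invSqrt (-1 / w) = u at *
  rw [show 1 + 1 = 2 from rfl]
  generalize thetaSeries 2 a P (-1 / w) = y
  generalize thetaSeries 0 a P (-1 / w) = y'
  field_simp
  linear_combination 2 * Real.pi * y * h6

end dual

/-- The integral `∫_0^∞ g(t v) (μ (x - t))^{-1/2} dt`. -/
def eichlerIntegral (g : ℂ → ℂ) (v x μ : ℂ) : ℂ :=
  ∫ t in Ioi (0 : ℝ), g (v * t) * (μ * (x - t)) ^ (-(1 / 2) : ℂ)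

theorem IsThetaCoeff.rayData {j P : ℕ} {F : ℤ → ℂ} (hj : j < 2) (h : IsThetaCoeff j P F)
    {v x μ : ℂ} (hv : 0 < v.im) (hw : 0 < (v * x).im) (hμ : μ.re = 0) (hμx : 0 < (μ * x).re) :
    RayData (thetaSeries (j + 1) F P) v x μ := by
  obtain ⟨A, hA⟩ := exists_bound_of_periodic h.pos h.periodic
  exact ⟨fun z hz => (hasDerivAt_thetaSeries (by exact_mod_cast h.pos) hA h.zero
    hz).differentiableAt.differentiableWithinAt, h.rapidDecay hj, hv, hw, hμ, hμx⟩

/-- The contour shift with both pieces evaluated: the shifted ray yields the value at `v * x`, the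
segment the dual value at the inverted point. -/
theorem IsThetaCoeff.eichlerIntegral_eq {j P : ℕ} {F : ℤ → ℂ} (hj : j < 2)
    (h : IsThetaCoeff j P F) {v x μ : ℂ} (hv : 0 < v.im) (hw : 0 < (v * x).im) (hμ : μ.re = 0)
    (hμx : 0 < (μ * x).re) :
    eichlerIntegral (thetaSeries (j + 1) F P) v x μ =
      (-μ) ^ (-(1 / 2) : ℂ) * √P * invSqrt v * thetaSeries j F P (v * x) +
        x * (μ * x) ^ (-(1 / 2) : ℂ) * (v * x)⁻¹ ^ (j + 1) *
          thetaSeries j (dft P F) P (-1 / (v * x)) := by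
  have hr := h.rayData hj hv hw hμ hμx
  obtain ⟨A, hA⟩ := exists_bound_of_periodic h.pos h.periodic
  have h1 := hr.integral_sub_integral
  rw [hr.integral_end, hr.integral_start, laplace_inv_sqrt_thetaSeries (by exact_mod_cast h.pos) hA
    h.zero hw hv] at h1
  have h2 : ∫ s in Ioo (0 : ℝ) 1, thetaSeries (j + 1) F P (s * (v * x)) * (√(1 - s) : ℂ)⁻¹ =
      (v * x)⁻¹ ^ (j + 1) * thetaSeries j (dft P F) P (-1 / (v * x)) := by
    interval_cases j
    · rw [h.integral_dual_zero hw]; ring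
    · rw [h.integral_dual_one hw]
  rw [h2] at h1
  have h3 : eichlerIntegral (thetaSeries (j + 1) F P) v x μ =
      ∫ t in Ioi (0 : ℝ), rayIntegrand (thetaSeries (j + 1) F P) v x μ 0 t := by
    refine setIntegral_congr_fun measurableSet_Ioi fun t _ => ?_
    simp [rayIntegrand, rayArg]
  rw [h3, h1]
  ring

end QuantumModular
end

noncomputable section
namespace QuantumModular

open Filter Topology MeasureTheory Set Asymptotics

/-! ### Asymptotic expansion at `0` -/

/-- The binomial coefficient `-1/2 - k` over `m`. -/
def halfBinomial : ℕ → ℕ → ℂ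
  | _, 0 => 1
  | k, m + 1 => (-(1 / 2) - k) * halfBinomial (k + 1) m / (m + 1)

theorem norm_cpow_neg_half_sub_nat (y : ℂ) (k : ℕ) :
    ‖y ^ (-(1 / 2) - k : ℂ)‖ = ‖y‖ ^ (-(1 / 2) - k : ℝ) := by
  have := Complex.norm_cpow_real y (-(1 / 2) - k : ℝ)
  convert this using 2
  push_cast
  rfl

/-- Taylor's formula along a segment, with a constant independent of `y` and `β`. The derivative of
the remainder is the remainder of order one less for the exponent lowered by one, hence the
induction over all `k`. -/
theorem exists_norm_cpow_sub_sum_le (N k : ℕ) : ∃ C : ℝ, 0 ≤ C ∧ ∀ (y β : ℂ) (ρ : ℝ), 0 < ρ →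
    (∀ s ∈ Icc (0 : ℝ) 1, y + s * β ∈ Complex.slitPlane ∧ ρ ≤ ‖y + s * β‖) →
    ∀ s ∈ Icc (0 : ℝ) 1, ‖(y + s * β) ^ (-(1 / 2) - k : ℂ) - ∑ m ∈ Finset.range N,
      halfBinomial k m * y ^ (-(1 / 2) - (k + m : ℕ) : ℂ) * (s * β) ^ m‖ ≤
        C * ‖β‖ ^ N * ρ ^ (-(1 / 2) - (k + N : ℕ) : ℝ) := by
  induction N generalizing k with
  | zero =>
    refine ⟨1, zero_le_one, fun y β ρ hρ h s hs => ?_⟩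
    simp only [Finset.range_zero, Finset.sum_empty, sub_zero, pow_zero, mul_one, one_mul, add_zero]
    rw [norm_cpow_neg_half_sub_nat]
    refine Real.rpow_le_rpow_of_nonpos hρ (h s hs).2 ?_
    have : (0 : ℝ) ≤ k := k.cast_nonneg
    linarith
  | succ N ih =>
    obtain ⟨C, hC, ih⟩ := ih (k + 1)
    have hk : (0 : ℝ) ≤ k := k.cast_nonneg
    refine ⟨(1 / 2 + k) * C, by positivity, fun y β ρ hρ h s hs => ?_⟩
    have hnorm : ‖(-(1 / 2) - k : ℂ)‖ = 1 / 2 + k := by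
      have : (-(1 / 2) - k : ℂ) = -((1 / 2 + k : ℝ) : ℂ) := by push_cast; ring
      rw [this, norm_neg, Complex.norm_real, Real.norm_of_nonneg (by positivity)]
    have hd : ∀ s ∈ Icc (0 : ℝ) 1, HasDerivWithinAt (fun s : ℝ =>
        (y + s * β) ^ (-(1 / 2) - k : ℂ) - ∑ m ∈ Finset.range (N + 1),
          halfBinomial k m * y ^ (-(1 / 2) - (k + m : ℕ) : ℂ) * (s * β) ^ m)
        ((-(1 / 2) - k) * β * ((y + s * β) ^ (-(1 / 2) - (k + 1 : ℕ) : ℂ) -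
          ∑ m ∈ Finset.range N, halfBinomial (k + 1) m *
            y ^ (-(1 / 2) - (k + 1 + m : ℕ) : ℂ) * (s * β) ^ m)) (Icc 0 1) s := by
      intro s hs
      have h0 : HasDerivAt (fun s : ℝ => (s : ℂ) * β) β s := by
        simpa using (hasDerivAt_id s).ofReal_comp.mul_const β
      have h1 := (Complex.hasStrictDerivAt_cpow_const (h s hs).1
        (c := -(1 / 2) - k)).hasDerivAt.comp (h := fun s : ℝ => y + s * β) s (h0.const_add y)
      have h2 : HasDerivAt (fun s : ℝ => ∑ m ∈ Finset.range (N + 1),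
          halfBinomial k m * y ^ (-(1 / 2) - (k + m : ℕ) : ℂ) * (s * β) ^ m)
          (∑ m ∈ Finset.range (N + 1), halfBinomial k m *
            y ^ (-(1 / 2) - (k + m : ℕ) : ℂ) * (m * (s * β) ^ (m - 1) * β)) s :=
        HasDerivAt.fun_sum fun m _ => (h0.pow m).const_mul _
      refine ((h1.sub h2).congr_deriv ?_).hasDerivWithinAt
      rw [Finset.sum_range_succ', mul_sub, Finset.mul_sum]
      congr 1
      · push_cast
        ring_nf
      · simp only [Nat.cast_zero, zero_mul, mul_zero, add_zero]
        refine Finset.sum_congr rfl fun m _ => ?_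
        have hm : (m + 1 : ℂ) ≠ 0 := Nat.cast_add_one_ne_zero m
        rw [halfBinomial, show k + (m + 1) = k + 1 + m by ring]
        push_cast
        field_simp
    have hb : ∀ s ∈ Ico (0 : ℝ) 1, ‖(-(1 / 2) - k) * β *
        ((y + s * β) ^ (-(1 / 2) - (k + 1 : ℕ) : ℂ) -
          ∑ m ∈ Finset.range N, halfBinomial (k + 1) m *
            y ^ (-(1 / 2) - (k + 1 + m : ℕ) : ℂ) * (s * β) ^ m)‖ ≤
        (1 / 2 + k) * ‖β‖ * (C * ‖β‖ ^ N * ρ ^ (-(1 / 2) - (k + 1 + N : ℕ) : ℝ)) := by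
      intro s hs
      rw [norm_mul, norm_mul, hnorm]
      gcongr
      exact ih y β ρ hρ h s ⟨hs.1, hs.2.le⟩
    have key := norm_image_sub_le_of_norm_deriv_le_segment' hd hb s hs
    have hzero : (y + (0 : ℝ) * β) ^ (-(1 / 2) - k : ℂ) - ∑ m ∈ Finset.range (N + 1),
        halfBinomial k m * y ^ (-(1 / 2) - (k + m : ℕ) : ℂ) * ((0 : ℝ) * β) ^ m = 0 := by
      rw [Finset.sum_range_succ']
      simp [halfBinomial]
    rw [hzero, sub_zero, sub_zero] at key
    refine key.trans ?_
    have hpos : 0 ≤ (1 / 2 + k) * ‖β‖ * (C * ‖β‖ ^ N * ρ ^ (-(1 / 2) - (k + 1 + N : ℕ) : ℝ)) := by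
      positivity
    refine (mul_le_of_le_one_right hpos hs.2).trans (le_of_eq ?_)
    rw [show k + (N + 1) = k + 1 + N by ring]
    ring

/-- The moment `∫_0^∞ g(v t) (-μ t)^{-1/2-m} dt`. -/
def rayMoment (g : ℂ → ℂ) (v μ : ℂ) (m : ℕ) : ℂ :=
  ∫ t in Ioi (0 : ℝ), g (v * t) * (-(μ * t)) ^ (-(1 / 2) - m : ℂ)

/-- Vanishing to order `m` at `0` absorbs `t^(-m)`; this makes all the moments converge. -/
theorem RapidDecay.exists_bound_ray {g : ℂ → ℂ} (hg : RapidDecay g) {v : ℂ} (hv : 0 < v.im)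
    (m : ℕ) : ∃ A b : ℝ, 0 ≤ A ∧ 0 < b ∧ ∀ t : ℝ, 0 < t →
      ‖g (v * t)‖ * t ^ (-(1 / 2) - m : ℝ) ≤ A * (t ^ (-(1 / 2) : ℝ) * Real.exp (-(b * t))) := by
  have hv0 : 0 < ‖v‖ := norm_pos_iff.2 fun h0 => by simp [h0] at hv
  obtain ⟨A, b, hA, hb, h⟩ := hg (v.im / ‖v‖) (by positivity) m
  refine ⟨A * ‖v‖ ^ m, b * ‖v‖, by positivity, by positivity, fun t ht => ?_⟩
  have hn : ‖v * t‖ = ‖v‖ * t := by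
    rw [norm_mul, Complex.norm_real, Real.norm_of_nonneg ht.le]
  have hmem : v * t ∈ cone (v.im / ‖v‖) := by
    refine ⟨fun h0 => ?_, ?_⟩
    · rw [h0, norm_zero] at hn
      have : 0 < ‖v‖ * t := by positivity
      linarith
    · rw [hn, mul_comm v, Complex.im_ofReal_mul]
      apply le_of_eq
      field_simp
  have h1 := h _ hmem
  rw [hn] at h1
  rw [Real.rpow_sub ht, Real.rpow_natCast]
  calc _ ≤ A * (‖v‖ * t) ^ m * Real.exp (-(b * (‖v‖ * t))) * (t ^ (-(1 / 2) : ℝ) / t ^ m) := by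
        gcongr
    _ = _ := by
        rw [mul_pow, ← mul_assoc b]
        field_simp

section expansion

variable {g : ℂ → ℂ} {v x μ : ℂ}

theorem integrableOn_rayMoment (hg : RapidDecay g) (hd : DifferentiableOn ℂ g {z | 0 < z.im})
    (hv : 0 < v.im) (hμ : μ.re = 0) (hμ0 : μ ≠ 0) (m : ℕ) :
    IntegrableOn (fun t : ℝ => g (v * t) * (-(μ * t)) ^ (-(1 / 2) - m : ℂ)) (Ioi 0) := by
  obtain ⟨A, b, hA, hb, h⟩ := hg.exists_bound_ray hv m
  refine ((integrableOn_rpow_mul_exp_neg (s := -(1 / 2)) (by norm_num) hb).const_mul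
    (A * ‖μ‖ ^ (-(1 / 2) - m : ℝ))).mono' ?_ ?_
  · refine ContinuousOn.aestronglyMeasurable (fun t ht => ?_) measurableSet_Ioi
    have ht' : (0 : ℝ) < t := ht
    have hz : 0 < (v * t).im := by
      rw [mul_comm, Complex.im_ofReal_mul]
      positivity
    have h1 : ContinuousAt (fun t : ℝ => g (v * t)) t :=
      (hd.differentiableAt ((isOpen_lt continuous_const Complex.continuous_im).mem_nhds
        hz)).continuousAt.comp (f := fun t : ℝ => v * (t : ℂ)) (by fun_prop)
    have hs : -(μ * t) ∈ Complex.slitPlane := by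
      right
      rw [Complex.neg_im, mul_comm, Complex.im_ofReal_mul]
      exact neg_ne_zero.2 (mul_ne_zero ht'.ne' fun h => hμ0 (Complex.ext hμ h))
    have h2 : ContinuousAt (fun t : ℝ => (-(μ * t)) ^ (-(1 / 2) - m : ℂ)) t :=
      ContinuousAt.cpow (by fun_prop) continuousAt_const hs
    exact (h1.mul h2).continuousWithinAt
  · filter_upwards [ae_restrict_mem measurableSet_Ioi] with t ht
    have ht' : (0 : ℝ) < t := ht
    rw [norm_mul, norm_cpow_neg_half_sub_nat, norm_neg, norm_mul, Complex.norm_real,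
      Real.norm_of_nonneg ht'.le, Real.mul_rpow (norm_nonneg _) ht'.le]
    have h0 : 0 ≤ ‖μ‖ ^ (-(1 / 2) - m : ℝ) := by positivity
    calc _ = ‖μ‖ ^ (-(1 / 2) - m : ℝ) * (‖g (v * t)‖ * t ^ (-(1 / 2) - m : ℝ)) := by ring
      _ ≤ ‖μ‖ ^ (-(1 / 2) - m : ℝ) * (A * (t ^ (-(1 / 2) : ℝ) * Real.exp (-(b * t)))) := by
        exact mul_le_mul_of_nonneg_left (h t ht') h0
      _ = _ := by ring

/-- The kernel is expanded in `μ * x` under the integral. The constant `c` keeps `x` away from the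
ray in angle, which makes the remainder uniform. -/
theorem exists_norm_eichlerIntegral_sub_le (hg : RapidDecay g)
    (hd : DifferentiableOn ℂ g {z | 0 < z.im})
    (hv : 0 < v.im) (hμ : μ.re = 0) (hμ0 : μ ≠ 0) {c : ℝ} (hc : 0 < c) (N : ℕ) :
    ∃ C : ℝ, ∀ x : ℂ, RayData g v x μ → c ≤ (μ * x).re / (2 * ‖x‖) →
      ‖eichlerIntegral g v x μ - ∑ m ∈ Finset.range N,
        halfBinomial 0 m * rayMoment g v μ m * (μ * x) ^ m‖ ≤ C * ‖x‖ ^ N := by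
  obtain ⟨C, hC, hT⟩ := exists_norm_cpow_sub_sum_le N 0
  obtain ⟨A, b, hA, hb, hbd⟩ := hg.exists_bound_ray hv N
  set I := ∫ t in Ioi (0 : ℝ), t ^ (-(1 / 2) : ℝ) * Real.exp (-(b * t)) with hI
  refine ⟨C * ‖μ‖ ^ N * c ^ (-(1 / 2) - N : ℝ) * A * I, fun x hr hcx => ?_⟩
  have hint : ∀ m : ℕ, IntegrableOn (fun t : ℝ => halfBinomial 0 m * (μ * x) ^ m *
      (g (v * t) * (-(μ * t)) ^ (-(1 / 2) - m : ℂ))) (Ioi 0) := fun m =>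
    (integrableOn_rayMoment hg hd hv hμ hμ0 m).const_mul _
  have h1 : ∑ m ∈ Finset.range N, halfBinomial 0 m * rayMoment g v μ m * (μ * x) ^ m =
      ∫ t in Ioi (0 : ℝ), ∑ m ∈ Finset.range N, halfBinomial 0 m * (μ * x) ^ m *
        (g (v * t) * (-(μ * t)) ^ (-(1 / 2) - m : ℂ)) := by
    rw [integral_finsetSum _ fun m _ => hint m]
    refine Finset.sum_congr rfl fun m _ => ?_
    rw [integral_const_mul, rayMoment]
    ring
  have h2 : IntegrableOn (fun t : ℝ => g (v * t) * (μ * (x - t)) ^ (-(1 / 2) : ℂ)) (Ioi 0) := by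
    refine (hr.integrableOn_rayIntegrand (s := 0) ⟨le_rfl, zero_le_one⟩).congr_fun
      (fun t _ => ?_) measurableSet_Ioi
    simp [rayIntegrand, rayArg]
  rw [eichlerIntegral, h1, ← integral_sub h2 (integrable_finsetSum _ fun m _ => hint m)]
  have hbound : ∀ t ∈ Ioi (0 : ℝ), ‖g (v * t) * (μ * (x - t)) ^ (-(1 / 2) : ℂ) -
      ∑ m ∈ Finset.range N, halfBinomial 0 m * (μ * x) ^ m *
        (g (v * t) * (-(μ * t)) ^ (-(1 / 2) - m : ℂ))‖ ≤
      C * ‖μ‖ ^ N * c ^ (-(1 / 2) - N : ℝ) * A * ‖x‖ ^ N *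
        (t ^ (-(1 / 2) : ℝ) * Real.exp (-(b * t))) := by
    intro t ht
    have ht' : (0 : ℝ) < t := ht
    have h3 := hT (-(μ * t)) (μ * x) (t * c) (by positivity) (fun s hs => by
      -- The segment of the Taylor expansion consists of kernel values, so `le_norm_rayArg` bounds
      -- its norms below by `t * c`.
      have e : -(μ * t) + s * (μ * x) = rayArg x μ (1 - s) t := by
        rw [rayArg]
        push_cast
        ring
      rw [e]
      refine ⟨hr.rayArg_mem_slitPlane (by linarith [hs.1]) (.inr ht'), ?_⟩
      exact (mul_le_mul_of_nonneg_left hcx ht'.le).trans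
        (hr.le_norm_rayArg (by linarith [hs.1]) ht'.le)) 1 ⟨zero_le_one, le_rfl⟩
    simp only [Nat.cast_zero, sub_zero, Complex.ofReal_one, one_mul, zero_add] at h3
    have e : g (v * t) * (μ * (x - t)) ^ (-(1 / 2) : ℂ) -
        ∑ m ∈ Finset.range N, halfBinomial 0 m * (μ * x) ^ m *
          (g (v * t) * (-(μ * t)) ^ (-(1 / 2) - m : ℂ)) =
        g (v * t) * ((-(μ * t) + μ * x) ^ (-(1 / 2) : ℂ) - ∑ m ∈ Finset.range N,
          halfBinomial 0 m * (-(μ * t)) ^ (-(1 / 2) - m : ℂ) * (μ * x) ^ m) := by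
      rw [mul_sub (g _), Finset.mul_sum]
      congr 1
      · congr 2
        ring
      · exact Finset.sum_congr rfl fun m _ => by ring
    rw [e, norm_mul]
    rw [Real.mul_rpow ht'.le hc.le, norm_mul, mul_pow] at h3
    calc _ ≤ ‖g (v * t)‖ * (C * (‖μ‖ ^ N * ‖x‖ ^ N) *
          (t ^ (-(1 / 2) - N : ℝ) * c ^ (-(1 / 2) - N : ℝ))) := by gcongr
      _ = C * ‖μ‖ ^ N * c ^ (-(1 / 2) - N : ℝ) * ‖x‖ ^ N *
          (‖g (v * t)‖ * t ^ (-(1 / 2) - N : ℝ)) := by ring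
      _ ≤ C * ‖μ‖ ^ N * c ^ (-(1 / 2) - N : ℝ) * ‖x‖ ^ N *
          (A * (t ^ (-(1 / 2) : ℝ) * Real.exp (-(b * t)))) := by
        refine mul_le_mul_of_nonneg_left (hbd t ht') ?_
        positivity
      _ = _ := by ring
  refine (norm_integral_le_of_norm_le
    ((integrableOn_rpow_mul_exp_neg (s := -(1 / 2)) (by norm_num) hb).const_mul _)
    ((ae_restrict_iff' measurableSet_Ioi).2 (ae_of_all _ hbound))).trans (le_of_eq ?_)
  rw [integral_const_mul]
  ring

end expansion

/-- The Eichler-type integral is a constant multiple of the series plus the dual term. The integral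
has an expansion by its moments, and the dual term is smaller than any power. -/
theorem IsThetaCoeff.exists_hasExpansion {j P : ℕ} {F : ℤ → ℂ} (hj : j < 2)
    (h : IsThetaCoeff j P F) {κ : ℝ} (hκ : 0 < κ) :
    ∃ s, HasExpansion (𝓝[cone κ] 0) (thetaSeries j F P) s := by
  obtain ⟨A, hA⟩ := exists_bound_of_periodic h.pos h.periodic
  have hP' : (0 : ℝ) < P := by exact_mod_cast h.pos
  -- A vertical ray would cut the cone in two. This flat ray pointing left lies outside the cone, so
  -- the whole cone is on the same side of it and `μ = I` always works.
  set v : ℂ := -1 + (κ / 2 : ℝ) * Complex.I with hv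
  have hvre : v.re = -1 := by simp [hv]
  have hvim : v.im = κ / 2 := by simp [hv]
  have hv0 : 0 < v.im := by rw [hvim]; positivity
  have hvne : v ≠ 0 := by rintro h0; simp [h0] at hv0
  have hnv : 0 < ‖v‖ := norm_pos_iff.2 hvne
  have hμ : Complex.I.re = 0 := rfl
  set c : ℝ := κ / (4 * ‖v‖) with hc
  have hre : ∀ w ∈ cone κ, κ / 2 * ‖w‖ ≤ ‖v‖ ^ 2 * (Complex.I * (w / v)).re := by
    intro w hw
    have e1 : (Complex.I * (w / v)).re = -(w / v).im := by simp
    have e2 : ‖v‖ ^ 2 * (w / v).im = w.im * v.re - w.re * v.im := by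
      rw [Complex.div_im, ← Complex.normSq_eq_norm_sq]
      have : Complex.normSq v ≠ 0 := by simpa using hvne
      field_simp
    rw [e1, mul_neg, e2, hvre, hvim]
    have h1 := neg_le_of_abs_le (Complex.abs_re_le_norm w)
    nlinarith [hw.2]
  have hrpos : ∀ w ∈ cone κ, 0 < (Complex.I * (w / v)).re := by
    intro w hw
    have h1 := hre w hw
    have h2 : 0 < κ / 2 * ‖w‖ := mul_pos (by positivity) (norm_pos_iff.2 hw.1)
    exact pos_of_mul_pos_right (h2.trans_le h1) (by positivity)
  have hvx : ∀ w : ℂ, v * (w / v) = w := fun w => by field_simp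
  have hwim : ∀ w ∈ cone κ, 0 < w.im := fun w hw => im_pos_of_mem_cone hκ hw
  have hR : ∀ w ∈ cone κ, RayData (thetaSeries (j + 1) F P) v (w / v) Complex.I := fun w hw =>
    h.rayData hj hv0 (by rw [hvx]; exact hwim w hw) hμ (hrpos w hw)
  have hcx : ∀ w ∈ cone κ, c ≤ (Complex.I * (w / v)).re / (2 * ‖w / v‖) := by
    intro w hw
    have hw0 : 0 < ‖w‖ := norm_pos_iff.2 hw.1
    rw [hc, norm_div, div_le_div_iff₀ (by positivity) (by positivity)]
    have h1 := hre w hw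
    generalize (Complex.I * (w / v)).re = y at h1 ⊢
    field_simp
    nlinarith
  set k : ℂ := (-Complex.I) ^ (-(1 / 2) : ℂ) * √P * invSqrt v with hk
  have hk0 : k ≠ 0 := by
    have h1 : (-Complex.I) ^ (-(1 / 2) : ℂ) ≠ 0 := by
      rw [Ne, Complex.cpow_eq_zero_iff]
      simp
    have h2 : invSqrt v ≠ 0 := by
      rw [invSqrt, Ne, Complex.cpow_eq_zero_iff]
      simp [hvne]
    have h3 : (√P : ℂ) ≠ 0 := by exact_mod_cast (Real.sqrt_pos.2 hP').ne'
    exact mul_ne_zero (mul_ne_zero h1 h3) h2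
  have hg := h.rapidDecay hj
  have hd : DifferentiableOn ℂ (thetaSeries (j + 1) F P) {z | 0 < z.im} := fun z hz =>
    (hasDerivAt_thetaSeries hP' hA h.zero hz).differentiableAt.differentiableWithinAt
  set a : ℕ → ℂ := fun m => k⁻¹ * (halfBinomial 0 m *
    rayMoment (thetaSeries (j + 1) F P) v Complex.I m * (Complex.I / v) ^ m) with ha
  refine ⟨PowerSeries.mk a, fun N => ?_⟩
  obtain ⟨C, hC⟩ := exists_norm_eichlerIntegral_sub_le hg hd hv0 hμ Complex.I_ne_zero
    (c := c) (by positivity) N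
  obtain ⟨b, hb, hdual⟩ := expDecay_thetaSeries j h.pos (dft_periodic h.pos F) h.dft_zero
  obtain ⟨B, hB, hdual⟩ := hdual κ hκ
  have hle : (fun w => k⁻¹ * ((w / v) * (Complex.I * (w / v)) ^ (-(1 / 2) : ℂ) * w⁻¹ ^ (j + 1) *
      thetaSeries j (dft P F) P (-1 / w))) =O[𝓝[cone κ] 0] fun w => w ^ N := by
    -- Of these powers, `j + 1` compensate `w⁻¹ ^ (j + 1)`.
    obtain ⟨q, hq⟩ : ∃ q : ℕ, q = N + j + 1 := ⟨_, rfl⟩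
    refine IsBigO.of_bound (‖k⁻¹‖ * (‖v‖⁻¹ * ‖v‖⁻¹ ^ (-(1 / 2) : ℝ) *
      (B * (q.factorial / (b * κ) ^ q)))) ?_
    have hone : ∀ᶠ w in 𝓝[cone κ] (0 : ℂ), ‖w‖ < 1 := by
      refine nhdsWithin_le_nhds ?_
      filter_upwards [Metric.ball_mem_nhds (0 : ℂ) one_pos] with w hw
      simpa using hw
    filter_upwards [hone, self_mem_nhdsWithin] with w hw1 hw
    have hw0 : 0 < ‖w‖ := norm_pos_iff.2 hw.1
    have hi := neg_one_div_im_ge hw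
    have h1 : κ ≤ (-1 / w).im := by
      refine le_trans ?_ hi
      rw [le_div_iff₀ hw0]
      exact mul_le_of_le_one_right hκ.le hw1.le
    have h2 : ‖thetaSeries j (dft P F) P (-1 / w)‖ ≤
        B * (q.factorial / (b * κ) ^ q) * ‖w‖ ^ q := by
      refine (hdual _ h1).trans ?_
      rw [mul_assoc]
      refine mul_le_mul_of_nonneg_left ?_ hB
      have h3 : Real.exp (-(b * (-1 / w).im)) ≤ Real.exp (-(b * κ * ‖w‖⁻¹)) := by
        refine Real.exp_le_exp.2 (neg_le_neg ?_)
        rw [mul_assoc, ← div_eq_mul_inv]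
        exact mul_le_mul_of_nonneg_left hi hb.le
      refine h3.trans ?_
      have h4 := pow_mul_exp_neg_le (mul_pos hb hκ) q (inv_nonneg.2 hw0.le)
      rw [inv_pow, inv_mul_le_iff₀ (by positivity)] at h4
      linarith
    have h5 : ‖w‖ ^ (-(1 / 2) : ℝ) ≤ ‖w‖⁻¹ := by
      rw [inv_eq_one_div]
      exact rpow_neg_half_le hw0 hw1.le
    rw [norm_mul, norm_mul, norm_mul, norm_mul, norm_cpow_neg_half, norm_mul, Complex.norm_I,
      one_mul, norm_pow, norm_inv w, norm_pow, norm_div, div_eq_mul_inv ‖w‖,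
      Real.mul_rpow hw0.le (by positivity)]
    calc _ ≤ ‖k⁻¹‖ * (‖w‖ * ‖v‖⁻¹ * (‖w‖⁻¹ * ‖v‖⁻¹ ^ (-(1 / 2) : ℝ)) * ‖w‖⁻¹ ^ (j + 1) *
          (B * (q.factorial / (b * κ) ^ q) * ‖w‖ ^ q)) := by gcongr
      _ = _ := by
        have e1 : ‖w‖⁻¹ ^ (j + 1) * ‖w‖ ^ (j + 1) = 1 := by
          rw [← mul_pow, inv_mul_cancel₀ hw0.ne', one_pow]
        have e2 : ‖w‖ * ‖w‖⁻¹ = 1 := mul_inv_cancel₀ hw0.ne'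
        have e3 : ‖w‖ ^ q = ‖w‖ ^ N * ‖w‖ ^ (j + 1) := by rw [hq, add_assoc, pow_add]
        rw [e3]
        generalize (q.factorial / (b * κ) ^ q : ℝ) = y
        linear_combination (‖k⁻¹‖ * ‖v‖⁻¹ * ‖v‖⁻¹ ^ (-(1 / 2) : ℝ) * B * y * ‖w‖ ^ N) *
          (‖w‖⁻¹ ^ (j + 1) * ‖w‖ ^ (j + 1) * e2 + e1)
  have hmain : (fun w => k⁻¹ * (eichlerIntegral (thetaSeries (j + 1) F P) v (w / v) Complex.I -
      ∑ m ∈ Finset.range N, halfBinomial 0 m *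
        rayMoment (thetaSeries (j + 1) F P) v Complex.I m * (Complex.I * (w / v)) ^ m))
      =O[𝓝[cone κ] 0] fun w => w ^ N := by
    refine IsBigO.of_bound (‖k⁻¹‖ * (C * ‖v‖⁻¹ ^ N)) ?_
    filter_upwards [self_mem_nhdsWithin] with w hw
    rw [norm_mul, norm_pow]
    have := hC (w / v) (hR w hw) (hcx w hw)
    calc _ ≤ ‖k⁻¹‖ * (C * ‖w / v‖ ^ N) := by gcongr
      _ = _ := by rw [norm_div, div_eq_mul_inv, mul_pow]; ring
  refine (hmain.sub hle).congr' ?_ .rfl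
  filter_upwards [self_mem_nhdsWithin] with w hw
  have hE := h.eichlerIntegral_eq hj (x := w / v) hv0 (by rw [hvx]; exact hwim w hw) hμ (hrpos w hw)
  rw [hvx, ← hk] at hE
  have htr : (PowerSeries.trunc N (PowerSeries.mk a)).eval w = k⁻¹ * ∑ m ∈ Finset.range N,
      halfBinomial 0 m * rayMoment (thetaSeries (j + 1) F P) v Complex.I m *
        (Complex.I * (w / v)) ^ m := by
    rw [Polynomial.eval, PowerSeries.eval₂_trunc_eq_sum_range, Finset.mul_sum]
    refine Finset.sum_congr rfl fun m _ => ?_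
    rw [RingHom.id_apply, PowerSeries.coeff_mk, ha]
    simp only
    rw [show Complex.I * (w / v) = Complex.I / v * w by ring, mul_pow]
    ring
  rw [htr, hE]
  field_simp
  ring

end QuantumModular
end

noncomputable section
namespace QuantumModular

open Filter Topology MeasureTheory Set

/-! ### Partial theta functions at rational points -/

/-- Splitting off the exponential at `r` moves that point to `0`; the passage from `M` to a period
`P` of the twist is a mere rescaling. -/
theorem thetaSeries_eq_twist (j : ℕ) (f : ℤ → ℂ) {M P : ℕ} (hM : 0 < M) (hP : 0 < P) (r : ℚ)
    (τ : ℂ) :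
    thetaSeries j f M τ = thetaSeries j (twist f M r) P (((P : ℝ) / M : ℝ) * (τ - r)) := by
  have hM' : (M : ℂ) ≠ 0 := by exact_mod_cast hM.ne'
  have hP' : (P : ℂ) ≠ 0 := by exact_mod_cast hP.ne'
  refine tsum_congr fun n => ?_
  rw [thetaTerm, thetaTerm, twist, ← mul_assoc, mul_assoc _ (Complex.exp _), ← Complex.exp_add]
  congr 2
  push_cast
  field_simp
  ring

theorem twist_neg {f : ℤ → ℂ} {j : ℕ} (hpar : ∀ n, (-1) ^ (j + 1) * f (-n) = f n) (M : ℕ) (r : ℚ)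
    (n : ℤ) : (-1) ^ (j + 1) * twist f M r (-n) = twist f M r n := by
  rw [twist, twist, ← mul_assoc, hpar]
  push_cast
  rw [neg_sq]

theorem dft_apply_zero (P : ℕ) (F : ℤ → ℂ) : dft P F 0 = ∑ x ∈ Finset.range P, F x := by
  refine Finset.sum_congr rfl fun x _ => ?_
  simp

theorem mem_quantumSet_iff {f : ℤ → ℂ} {M : ℕ} (hM : 0 < M) (hf : Function.Periodic f (M : ℤ))
    {α : ℚ} : α ∈ quantumSet f M ↔ dft (2 * M * α.den) (twist f M α) 0 = 0 := by
  have hP : 0 < 2 * M * α.den := Nat.mul_pos (by omega) α.den_pos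
  have hP' : ((2 * M * α.den : ℕ) : ℂ) ≠ 0 := by exact_mod_cast hP.ne'
  change twistMean f M α = 0 ↔ _
  rw [twistMean, div_eq_zero_iff, or_iff_left hP', dft_apply_zero,
    ← sum_range_add hP (twist_periodic hM hf α) 1, ← Finset.Ico_add_one_right_eq_Icc,
    Finset.sum_Ico_eq_sum_range, Nat.add_sub_cancel]
  simp only [Nat.cast_add, Nat.cast_one, add_comm]

section

variable {f : ℤ → ℂ} {M j : ℕ}

theorem isThetaCoeff_twist (hM : 0 < M) (hf : Function.Periodic f (M : ℤ)) (hf0 : f 0 = 0)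
    (hpar : ∀ n, (-1) ^ (j + 1) * f (-n) = f n) {α : ℚ} (hα : α ∈ quantumSet f M) :
    IsThetaCoeff j (2 * M * α.den) (twist f M α) where
  pos := Nat.mul_pos (by omega) α.den_pos
  periodic := twist_periodic hM hf α
  parity := twist_neg hpar M α
  zero := by simp [twist, hf0]
  dft_zero := (mem_quantumSet_iff hM hf).1 hα

theorem tendsto_ofReal_mul_cone {r : ℝ} (hr : 0 < r) (κ : ℝ) :
    Tendsto (fun T : ℂ => (r : ℂ) * T) (𝓝[cone κ] 0) (𝓝[cone κ] 0) := by
  refine tendsto_nhdsWithin_iff.2 ⟨?_, ?_⟩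
  · have : Continuous fun T : ℂ => (r : ℂ) * T := by fun_prop
    simpa using (this.tendsto 0).mono_left nhdsWithin_le_nhds
  · filter_upwards [self_mem_nhdsWithin] with T hT
    refine ⟨mul_ne_zero (by exact_mod_cast hr.ne') hT.1, ?_⟩
    rw [norm_mul, Complex.norm_real, Real.norm_of_nonneg hr.le, Complex.im_ofReal_mul]
    have := mul_le_mul_of_nonneg_left hT.2 hr.le
    linarith

theorem exists_coneExpansion_thetaSeries (hj : j < 2) (hM : 0 < M)
    (hf : Function.Periodic f (M : ℤ)) (hf0 : f 0 = 0)
    (hpar : ∀ n, (-1) ^ (j + 1) * f (-n) = f n) {α : ℚ} (hα : α ∈ quantumSet f M) :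
    ∃ s, ConeExpansion (thetaSeries j f M) α s := by
  have h := isThetaCoeff_twist hM hf hf0 hpar hα
  have hr : (0 : ℝ) < ((2 * M * α.den : ℕ) : ℝ) / M := by
    have := h.pos
    positivity
  refine exists_coneExpansion fun κ hκ => ?_
  obtain ⟨s, hs⟩ := h.exists_hasExpansion hj hκ
  set r : ℝ := ((2 * M * α.den : ℕ) : ℝ) / M with hr'
  have ht : HasExpansion (𝓝[cone κ] 0) (fun T : ℂ => (r : ℂ) * T)
      ((Polynomial.C (r : ℂ) * Polynomial.X : Polynomial ℂ) : ℂ⟦X⟧) := by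
    have := hasExpansion_polynomial (nhdsWithin_cone_le_nhds κ)
      (Polynomial.C (r : ℂ) * Polynomial.X)
    simp only [Polynomial.eval_mul, Polynomial.eval_C, Polynomial.eval_X] at this
    exact this
  refine ⟨_, (HasExpansion.comp (nhdsWithin_cone_le_nhds κ) hs ht (by simp)
    (tendsto_ofReal_mul_cone hr κ)).congr (Eventually.of_forall fun T => ?_)⟩
  simp only
  rw [thetaSeries_eq_twist j f hM h.pos α, add_sub_cancel_left]

theorem differentiableOn_thetaSeries (hM : 0 < M) (hf : Function.Periodic f (M : ℤ))
    (hf0 : f 0 = 0) (m : ℕ) : DifferentiableOn ℂ (thetaSeries m f M) {z | 0 < z.im} := by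
  obtain ⟨A, hA⟩ := exists_bound_of_periodic hM hf
  exact fun z hz => (hasDerivAt_thetaSeries (by exact_mod_cast hM) hA hf0
    hz).differentiableAt.differentiableWithinAt

end

/-! ### Holomorphy of the Eichler-type integral -/

section

variable {g : ℂ → ℂ} {v μ : ℂ}

theorem eichler_arg_mem_slitPlane (hμ : μ.re = 0) {x : ℂ} (hx : 0 < (μ * x).re) (t : ℝ) :
    μ * (x - t) ∈ Complex.slitPlane ∧ (μ * x).re ≤ ‖μ * (x - t)‖ := by
  have : (μ * (x - t)).re = (μ * x).re := by
    rw [mul_sub, Complex.sub_re, mul_comm μ (t : ℂ), Complex.re_ofReal_mul, hμ, mul_zero, sub_zero]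
  exact ⟨.inl (by rwa [this]), this ▸ Complex.re_le_norm _⟩

/-- For imaginary `μ` the real part of `μ (x - t)` does not depend on `t`, so the kernel is
holomorphic in `x` on the whole half-plane. In terms of `τ` this domain contains real points,
although the theta series live only above them. -/
theorem differentiableOn_eichlerIntegral (hg : RapidDecay g)
    (hd : DifferentiableOn ℂ g {z | 0 < z.im}) (hv : 0 < v.im) (hμ : μ.re = 0) :
    DifferentiableOn ℂ (fun x => eichlerIntegral g v x μ) {x | 0 < (μ * x).re} := by
  have hcg : ContinuousOn (fun t : ℝ => g (v * t)) (Ioi 0) := by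
    intro t ht
    have ht' : (0 : ℝ) < t := ht
    have hz : 0 < (v * t).im := by
      rw [mul_comm, Complex.im_ofReal_mul]
      positivity
    exact ((hd.differentiableAt ((isOpen_lt continuous_const Complex.continuous_im).mem_nhds
        hz)).continuousAt.comp (f := fun t : ℝ => v * (t : ℂ)) (by fun_prop)).continuousWithinAt
  have hgi : IntegrableOn (fun t : ℝ => ‖g (v * t)‖) (Ioi 0) := by
    have hv0 : 0 < ‖v‖ := norm_pos_iff.2 fun h0 => by simp [h0] at hv
    obtain ⟨A, b, hA, hb, h⟩ := hg (v.im / ‖v‖) (by positivity) 0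
    have hexp : IntegrableOn (fun t : ℝ => Real.exp (-(b * ‖v‖ * t))) (Ioi 0) := by
      simpa using integrableOn_rpow_mul_exp_neg (s := 0) (by norm_num)
        (show 0 < b * ‖v‖ by positivity)
    refine (hexp.const_mul A).mono' (hcg.norm.aestronglyMeasurable measurableSet_Ioi) ?_
    filter_upwards [ae_restrict_mem measurableSet_Ioi] with t ht
    have ht' : (0 : ℝ) < t := ht
    have hn : ‖v * t‖ = ‖v‖ * t := by
      rw [norm_mul, Complex.norm_real, Real.norm_of_nonneg ht'.le]
    have hmem : v * t ∈ cone (v.im / ‖v‖) := by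
      refine ⟨fun h0 => ?_, ?_⟩
      · rw [h0, norm_zero] at hn
        have : 0 < ‖v‖ * t := by positivity
        linarith
      · rw [hn, mul_comm v, Complex.im_ofReal_mul]
        apply le_of_eq
        field_simp
    have h1 := h _ hmem
    rw [hn, pow_zero, mul_one, ← mul_assoc] at h1
    rwa [norm_norm]
  intro x hx
  have hx' : 0 < (μ * x).re := hx
  set δ := (μ * x).re / 2 with hδ
  have hδ0 : 0 < δ := by positivity
  have hopen : {y : ℂ | δ < (μ * y).re} ∈ 𝓝 x := by
    refine (isOpen_lt continuous_const (by fun_prop)).mem_nhds ?_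
    change δ < (μ * x).re
    linarith
  have hpos : ∀ y ∈ {y : ℂ | δ < (μ * y).re}, 0 < (μ * y).re := fun y hy => hδ0.trans hy
  have hmeas : ∀ y ∈ {y : ℂ | δ < (μ * y).re}, ∀ e : ℂ, AEStronglyMeasurable
      (fun t : ℝ => g (v * t) * (μ * (y - t)) ^ e) (volume.restrict (Ioi 0)) := by
    intro y hy e
    refine (hcg.mul fun t _ => ?_).aestronglyMeasurable measurableSet_Ioi
    have h1 : ContinuousAt (fun t : ℝ => μ * (y - t)) t := by fun_prop
    exact (h1.cpow continuousAt_const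
      (eichler_arg_mem_slitPlane hμ (hpos y hy) t).1).continuousWithinAt
  have hle : ∀ y ∈ {y : ℂ | δ < (μ * y).re}, ∀ t : ℝ, ∀ r : ℝ, r ≤ 0 →
      ‖μ * (y - t)‖ ^ r ≤ δ ^ r := fun y hy t r hr =>
    Real.rpow_le_rpow_of_nonpos hδ0 ((le_of_lt hy).trans
      (eichler_arg_mem_slitPlane hμ (hpos y hy) t).2) hr
  have key := hasDerivAt_integral_of_dominated_loc_of_deriv_le
    (μ := volume.restrict (Ioi (0 : ℝ)))
    (F := fun y t => g (v * t) * (μ * (y - t)) ^ (-(1 / 2) : ℂ)) (x₀ := x)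
    (F' := fun y t => -(1 / 2) * μ * (g (v * t) * (μ * (y - t)) ^ (-(1 / 2) - 1 : ℂ)))
    (bound := fun t => ‖-(1 / 2) * μ‖ * (‖g (v * t)‖ * δ ^ (-(1 / 2) - 1 : ℝ))) hopen
    (by
      filter_upwards [hopen] with y hy
      exact hmeas y hy _)
    (by
      refine (hgi.mul_const (δ ^ (-(1 / 2) : ℝ))).mono' (hmeas x (mem_of_mem_nhds hopen) _) ?_
      refine Eventually.of_forall fun t => ?_
      rw [norm_mul, norm_cpow_neg_half]
      exact mul_le_mul_of_nonneg_left (hle x (mem_of_mem_nhds hopen) t _ (by norm_num))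
        (norm_nonneg _))
    ((hmeas x (mem_of_mem_nhds hopen) _).const_mul _)
    (by
      refine Eventually.of_forall fun t y hy => ?_
      rw [norm_mul, norm_mul (g _), norm_cpow_neg_half_sub_one]
      refine mul_le_mul_of_nonneg_left (mul_le_mul_of_nonneg_left
        (hle y hy t _ (by norm_num)) (norm_nonneg _)) (norm_nonneg _))
    ((hgi.mul_const _).const_mul _)
    (by
      refine Eventually.of_forall fun t y hy => ?_
      have h1 : HasDerivAt (fun y : ℂ => μ * (y - t)) (μ * 1) y :=
        ((hasDerivAt_id y).sub_const (t : ℂ)).const_mul μ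
      have h2 := (h1.cpow_const (c := -(1 / 2))
        (eichler_arg_mem_slitPlane hμ (hpos y hy) t).1).const_mul (g (v * t))
      refine h2.congr_deriv ?_
      ring)
  exact key.2.differentiableAt.differentiableWithinAt

end

end QuantumModular
end

noncomputable section
namespace QuantumModular

open Filter Topology

/-! ### Gauss sums -/

/-- Fourier inversion on `ZMod P`; it shows that the Gauss sum constant is nonzero, so that the
multiplier is a unit. -/
theorem eq_zero_of_dft_eq_zero {P : ℕ} (hP : 0 < P) {F : ℤ → ℂ}
    (hF : Function.Periodic F (P : ℤ)) (h : ∀ k, dft P F k = 0) (n : ℤ) : F n = 0 := by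
  have : NeZero P := ⟨hP.ne'⟩
  set G : ZMod P → ℂ := fun u => F (u.val : ℤ) with hG
  have hv : G n = F n := by
    simp only [hG]
    rw [ZMod.val_intCast]
    conv_rhs => rw [← Int.emod_add_mul_ediv n P]
    have := hF.int_mul (n / P) (n % P)
    rw [mul_comm (P : ℤ)]
    simpa using this.symm
  have hs : ∀ G : ZMod P → ℂ, ∑ x ∈ Finset.range P, G (x : ℕ) = ∑ u : ZMod P, G u := by
    intro G
    refine Finset.sum_nbij' (fun x => (x : ZMod P)) (fun u => u.val) (by simp) ?_ ?_ (by simp)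
      (by simp)
    · intro u _
      exact Finset.mem_range.2 (ZMod.val_lt u)
    · intro x hx
      exact ZMod.val_natCast_of_lt (Finset.mem_range.1 hx)
  have hG0 : ZMod.dft G = 0 := by
    funext k
    rw [ZMod.dft_apply, Pi.zero_apply, ← h (-(k.val : ℤ)), dft,
      ← hs fun u => ZMod.stdAddChar (-(u * k)) • G u]
    refine Finset.sum_congr rfl fun x hx => ?_
    have e1 : -((x : ZMod P) * k) = ((-(x * k.val : ℤ) : ℤ) : ZMod P) := by simp
    rw [e1, ZMod.stdAddChar_coe, smul_eq_mul, mul_comm]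
    congr 1
    · simp only [hG]
      rw [ZMod.val_natCast_of_lt (Finset.mem_range.1 hx)]
    · congr 1
      push_cast
      ring
  rw [← hv, (LinearEquiv.map_eq_zero_iff ZMod.dft).1 hG0, Pi.zero_apply]

/-- The entries of a matrix in `Γ₁(2 M)` that does not fix `∞`. -/
structure IsGammaOne (M : ℕ) (a b c d : ℤ) : Prop where
  det : a * d - b * c = 1
  a_mod : (2 * M : ℤ) ∣ a - 1
  d_mod : (2 * M : ℤ) ∣ d - 1
  c_mod : (2 * M : ℤ) ∣ c
  c_ne : c ≠ 0

section

variable {M : ℕ} {f : ℤ → ℂ} {a b c d n₀ : ℤ}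

theorem exp_eq_of_div {z w x y q : ℂ} (hq : q ≠ 0) (N : ℤ) (hz : z = Real.pi * Complex.I * (x / q))
    (hw : w = Real.pi * Complex.I * (y / q)) (h : x = y + 2 * N * q) :
    Complex.exp z = Complex.exp w := by
  rw [Complex.exp_eq_exp_iff_exists_int]
  refine ⟨N, ?_⟩
  rw [hz, hw, h]
  field_simp

/-- The exponential `exp (π i x² (b c - d) / (c M))`. -/
def gaussExp (M : ℕ) (b c d x : ℤ) : ℂ :=
  Complex.exp (Real.pi * Complex.I * ((x : ℂ) ^ 2 * (b * c - d) / (c * M)))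

theorem IsGammaOne.gaussExp_periodic (h : IsGammaOne M a b c d) (hM : 0 < M) (x : ℤ) :
    gaussExp M b c d (x + c * M) = gaussExp M b c d x := by
  obtain ⟨c', hc'⟩ := h.c_mod
  have hq : (c * M : ℂ) ≠ 0 :=
    mul_ne_zero (by exact_mod_cast h.c_ne) (by exact_mod_cast hM.ne')
  refine exp_eq_of_div hq ((x + M ^ 2 * c') * (b * c - d)) rfl rfl ?_
  have hc2 : (c : ℂ) = 2 * M * c' := by exact_mod_cast hc'
  push_cast
  linear_combination (c * M ^ 2 * (b * c - d) : ℂ) * hc2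

/-- The congruences for `c` and `d` make a shift by `c` produce a character of `x` modulo `M`. -/
theorem IsGammaOne.gaussExp_add (h : IsGammaOne M a b c d) (hM : 0 < M) (x : ℤ) :
    gaussExp M b c d (x + c) =
      Complex.exp (2 * Real.pi * Complex.I * (-x / M)) * gaussExp M b c d x := by
  obtain ⟨c', hc'⟩ := h.c_mod
  obtain ⟨d', hd'⟩ := h.d_mod
  have hc0 : (c : ℂ) ≠ 0 := by exact_mod_cast h.c_ne
  have hM0 : (M : ℂ) ≠ 0 := by exact_mod_cast hM.ne'
  rw [gaussExp, gaussExp, ← Complex.exp_add]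
  refine exp_eq_of_div (x := (x + c) ^ 2 * (b * c - d))
    (y := x ^ 2 * (b * c - d) - 2 * x * c) (mul_ne_zero hc0 hM0)
    (2 * x * (c' * b - d') + c' * (b * c - d)) ?_ ?_ ?_
  · push_cast
    rfl
  · field_simp
    ring
  have hc2 : (c : ℂ) = 2 * M * c' := by exact_mod_cast hc'
  have hd2 : (d : ℂ) - 1 = 2 * M * d' := by exact_mod_cast hd'
  push_cast
  linear_combination (2 * x * c * b + c * (b * c - d) : ℂ) * hc2 - (2 * x * c : ℂ) * hd2

theorem Periodic.natAbs_mul {F : ℤ → ℂ} (h : Function.Periodic F (c * M)) :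
    Function.Periodic F ((c.natAbs * M : ℕ) : ℤ) := by
  push_cast
  rcases abs_choice c with h1 | h1 <;> rw [h1]
  · exact h
  · rw [neg_mul]
    exact h.neg

theorem exp_neg_ne_one (hM : 0 < M) {x : ℤ} (hx : ¬ (M : ℤ) ∣ x) :
    Complex.exp (2 * Real.pi * Complex.I * (-x / M)) ≠ 1 := by
  have hM0 : (M : ℂ) ≠ 0 := by exact_mod_cast hM.ne'
  intro h
  obtain ⟨n, hn⟩ := Complex.exp_eq_one_iff.1 h
  refine hx ⟨-n, ?_⟩
  have hpi : (2 * Real.pi * Complex.I : ℂ) ≠ 0 := Complex.two_pi_I_ne_zero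
  have h1 : (-x / M : ℂ) = n := mul_left_cancel₀ hpi (by rw [hn]; ring)
  rw [div_eq_iff hM0] at h1
  have h2 : (-x : ℤ) = n * M := by exact_mod_cast h1
  linarith

/-- A shift by `c` preserves `g` and multiplies the exponential by a character that is trivial only
on multiples of `M`; hence only those `x` contribute, and there `g x = g 0`. -/
theorem IsGammaOne.sum_mul_gaussExp (h : IsGammaOne M a b c d) (hM : 0 < M) {g : ℤ → ℂ}
    (hg : Function.Periodic g (M : ℤ)) :
    ∑ x ∈ Finset.range (c.natAbs * M), g x * gaussExp M b c d x = g 0 *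
      ∑ x ∈ Finset.range (c.natAbs * M), if (M : ℤ) ∣ x then gaussExp M b c d x else 0 := by
  have hP : 0 < c.natAbs * M := Nat.mul_pos (Int.natAbs_pos.2 h.c_ne) hM
  have hgz : ∀ x : ℤ, (M : ℤ) ∣ x → g x = g 0 := by
    rintro x ⟨q, rfl⟩
    have := hg.int_mul q 0
    rw [mul_comm, ← this]
    simp
  obtain ⟨q, hq⟩ : (M : ℤ) ∣ c := (Dvd.intro_left 2 rfl).trans h.c_mod
  set e : ℤ → ℂ := fun x => Complex.exp (2 * Real.pi * Complex.I * (-x / M)) with he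
  -- Chosen so that `g' (1 - e)` equals `g` off the multiples of `M`; the sum of this part is then
  -- the difference of a sum over a period and its shift by `c`.
  set g' : ℤ → ℂ := fun x => if (M : ℤ) ∣ x then 0 else g x / (1 - e x) with hg'
  have hge : Function.Periodic e (M : ℤ) := by
    intro x
    have hM0 : (M : ℂ) ≠ 0 := by exact_mod_cast hM.ne'
    refine exp_eq_of_div (x := -2 * (x + M)) (y := -2 * x) hM0 (-1) ?_ ?_ ?_
    · push_cast
      ring
    · ring
    · push_cast
      ring
  have hgp : Function.Periodic g' (M : ℤ) := by
    intro x
    simp only [hg', hg x, hge x, dvd_add_self_right]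
  have hgc : ∀ x, g' (x + c) = g' x := fun x => by
    rw [hq, mul_comm]
    exact hgp.int_mul q x
  have hper : Function.Periodic (fun x => g' x * gaussExp M b c d x)
      ((c.natAbs * M : ℕ) : ℤ) := by
    refine Periodic.natAbs_mul fun x => ?_
    have := hgp.int_mul c x
    simp only [Int.cast_id] at this
    rw [h.gaussExp_periodic hM, this]
  have h1 := sum_range_add hP hper c
  have h2 : ∑ x ∈ Finset.range (c.natAbs * M), (g' x * (1 - e x)) * gaussExp M b c d x = 0 := by
    rw [← sub_eq_zero.2 h1.symm, ← Finset.sum_sub_distrib]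
    refine Finset.sum_congr rfl fun x _ => ?_
    rw [hgc, h.gaussExp_add hM]
    ring
  have h3 : ∀ x : ℤ, g' x * (1 - e x) = g x - g 0 * if (M : ℤ) ∣ x then 1 else 0 := by
    intro x
    by_cases hx : (M : ℤ) ∣ x
    · simp [hg', hx, hgz x hx]
    · have hne : 1 - e x ≠ 0 := sub_ne_zero.2 (exp_neg_ne_one hM hx).symm
      simp only [hg', hx, if_false, mul_zero, sub_zero]
      rw [div_mul_cancel₀ _ hne]
  simp only [h3, sub_mul, Finset.sum_sub_distrib, sub_eq_zero] at h2
  rw [h2, Finset.mul_sum]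
  refine Finset.sum_congr rfl fun x _ => ?_
  split_ifs <;> ring

theorem IsGammaOne.twist_periodic (h : IsGammaOne M a b c d) (hM : 0 < M)
    (hf : Function.Periodic f (M : ℤ)) :
    Function.Periodic (twist f M (-d / c)) ((c.natAbs * M : ℕ) : ℤ) := by
  refine Periodic.natAbs_mul fun x => ?_
  obtain ⟨c', hc'⟩ := h.c_mod
  have hc2 : (c : ℂ) = 2 * M * c' := by exact_mod_cast hc'
  have hq : (c * M : ℂ) ≠ 0 :=
    mul_ne_zero (by exact_mod_cast h.c_ne) (by exact_mod_cast hM.ne')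
  have hfx := hf.int_mul c x
  simp only [Int.cast_id] at hfx
  rw [twist, twist, hfx]
  congr 1
  refine exp_eq_of_div (x := -d * (x + c * M) ^ 2) (y := -d * x ^ 2) hq (-d * (x + M ^ 2 * c'))
    ?_ ?_ ?_
  · push_cast
    field_simp
  · push_cast
    field_simp
  · push_cast
    linear_combination (-d * c * M ^ 2 : ℂ) * hc2

/-- Replace `x` by `x + a k` and complete the square. As `a ≡ 1`, the coefficient becomes `f (x +
k)`; on its support `(x + k)² ≡ n₀²` modulo `2 M`, which turns the mixed term into a constant phase.
By `sum_mul_gaussExp` the rest is `f k` times a sum independent of `k`. -/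
theorem IsGammaOne.exists_dft_twist (h : IsGammaOne M a b c d) (hM : 0 < M)
    (hf : Function.Periodic f (M : ℤ))
    (hsupp : ∀ n : ℤ, f n ≠ 0 → n ^ 2 ≡ n₀ ^ 2 [ZMOD (2 * (M : ℤ))]) :
    ∃ l : ℂ, ∀ k : ℤ, dft (c.natAbs * M) (twist f M (-d / c)) (c.sign * k) =
      l * twist f M (a / c) k := by
  have hP : 0 < c.natAbs * M := Nat.mul_pos (Int.natAbs_pos.2 h.c_ne) hM
  obtain ⟨a', ha'⟩ := h.a_mod
  have hc0 : (c : ℂ) ≠ 0 := by exact_mod_cast h.c_ne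
  have hM0 : (M : ℂ) ≠ 0 := by exact_mod_cast hM.ne'
  have hPc : ((c.natAbs * M : ℕ) : ℂ) = c.sign * c * M := by
    have : (c.natAbs : ℂ) = c.sign * c := by
      rw [← Int.cast_natCast, ← Int.sign_mul_self_eq_natAbs]
      push_cast
      rfl
    rw [Nat.cast_mul, this]
  have hs : (c.sign : ℂ) * c.sign = 1 := by
    have : c.sign * c.sign = 1 := by
      rcases lt_or_gt_of_ne h.c_ne with h1 | h1
      · simp [Int.sign_eq_neg_one_of_neg h1]
      · simp [Int.sign_eq_one_of_pos h1]
    exact_mod_cast this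
  have hs0 : (c.sign : ℂ) ≠ 0 := left_ne_zero_of_mul_eq_one hs
  set S := ∑ x ∈ Finset.range (c.natAbs * M), if (M : ℤ) ∣ x then gaussExp M b c d x else 0 with hS
  refine ⟨Complex.exp (Real.pi * Complex.I * (-(b * n₀ ^ 2) / M)) * S, fun k => ?_⟩
  have hper : Function.Periodic (fun x : ℤ => twist f M (-d / c) x *
      Complex.exp (2 * Real.pi * Complex.I * ((c.sign * k : ℤ) : ℂ) * x /
        ((c.natAbs * M : ℕ) : ℂ))) ((c.natAbs * M : ℕ) : ℤ) := fun x => by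
    simp only [h.twist_periodic hM hf x, exp_two_pi_periodic hP]
  have h1 := sum_range_add hP hper (a * k)
  have hshift : ∀ x : ℤ, f (x + a * k) = f (x + k) := by
    intro x
    rw [show x + a * k = x + k + (2 * a' * k : ℤ) * M by linear_combination k * ha']
    exact hf.int_mul _ _
  have h2 : ∀ x : ℤ, twist f M (-d / c) (x + a * k) *
      Complex.exp (2 * Real.pi * Complex.I * ((c.sign * k : ℤ) : ℂ) * ((x + a * k : ℤ) : ℂ) /
        ((c.natAbs * M : ℕ) : ℂ)) =
      Complex.exp (Real.pi * Complex.I * (-(b * n₀ ^ 2) / M)) *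
        Complex.exp (Real.pi * Complex.I * (k : ℂ) ^ 2 * ((a / c : ℚ) : ℂ) / M) *
        (f (x + k) * gaussExp M b c d x) := by
    intro x
    rw [twist, hshift]
    by_cases hx : f (x + k) = 0
    · simp [hx]
    obtain ⟨q, hq⟩ := (hsupp _ hx).symm.dvd
    have e : ∀ u v w y z : ℂ, Complex.exp u * Complex.exp v = Complex.exp w * Complex.exp y *
        Complex.exp z → f (x + k) * Complex.exp u * Complex.exp v = Complex.exp w * Complex.exp y *
        (f (x + k) * Complex.exp z) := fun u v w y z he => by
      linear_combination f (x + k) * he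
    refine e _ _ _ _ _ ?_
    rw [← Complex.exp_add, ← Complex.exp_add, ← Complex.exp_add]
    refine exp_eq_of_div (x := -d * (x + a * k) ^ 2 + 2 * k * (x + a * k))
      (y := a * k ^ 2 - b * c * n₀ ^ 2 + x ^ 2 * (b * c - d)) (mul_ne_zero hc0 hM0)
      (-b * (q + a' * k ^ 2)) ?_ ?_ ?_
    · rw [hPc]
      push_cast
      field_simp
    · push_cast
      field_simp
      ring
    · have hdet : (a * d - b * c : ℂ) = 1 := by exact_mod_cast h.det
      have ha2 : (a : ℂ) - 1 = 2 * M * a' := by exact_mod_cast ha'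
      have hq2 : ((x : ℂ) + k) ^ 2 - n₀ ^ 2 = 2 * M * q := by exact_mod_cast hq
      push_cast
      linear_combination (-2 * x * k - a * k ^ 2 : ℂ) * hdet - (b * c : ℂ) * hq2 -
        (b * c * k ^ 2 : ℂ) * ha2
  have h3 := h.sum_mul_gaussExp hM (g := fun x => f (x + k)) (fun x => by
    simp only
    rw [show x + (M : ℤ) + k = x + k + M by ring, hf])
  rw [dft]
  refine h1.symm.trans ?_
  simp only [h2]
  rw [← Finset.mul_sum, h3, twist, zero_add]
  ring

end

end QuantumModular
end

noncomputable section
namespace QuantumModular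

open Filter Topology

/-! ### The transformation law -/

theorem thetaSeries_const_mul (m : ℕ) (l : ℂ) (a : ℤ → ℂ) (P : ℝ) (z : ℂ) :
    thetaSeries m (fun n => l * a n) P z = l * thetaSeries m a P z := by
  rw [thetaSeries, thetaSeries, ← tsum_mul_left]
  refine tsum_congr fun n => ?_
  rw [thetaTerm, thetaTerm]
  ring

/-- The inverse of `(-ν i)^{-1/2} √P` for a sign `ν`. -/
def raySign (P : ℕ) (ν : ℤ) : ℂ := ((-(ν * Complex.I)) ^ (-(1 / 2) : ℂ) * √P)⁻¹

theorem neg_I_cpow_neg_half : (Complex.I : ℂ) ^ (-(1 / 2) : ℂ) =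
    (-Complex.I) ^ (-(1 / 2) : ℂ) * -Complex.I := by
  rw [Complex.cpow_def_of_ne_zero Complex.I_ne_zero,
    Complex.cpow_def_of_ne_zero (neg_ne_zero.2 Complex.I_ne_zero), Complex.log_I, Complex.log_neg_I]
  have : -Complex.I = Complex.exp (-(Real.pi / 2) * Complex.I) := by
    rw [neg_mul, Complex.exp_neg, Complex.exp_pi_div_two_mul_I, Complex.inv_I]
  conv_rhs => rw [this]
  rw [← Complex.exp_add]
  congr 1
  ring

theorem raySign_neg_one (P : ℕ) : raySign P (-1) = Complex.I * raySign P 1 := by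
  have h1 : -(((-1 : ℤ) : ℂ) * Complex.I) = Complex.I := by push_cast; ring
  have h2 : -(((1 : ℤ) : ℂ) * Complex.I) = -Complex.I := by push_cast; ring
  rw [raySign, raySign, h1, h2, neg_I_cpow_neg_half, mul_inv, mul_inv, mul_inv, inv_neg,
    Complex.inv_I]
  ring

theorem raySign_one_ne_zero {P : ℕ} (hP : 0 < P) : raySign P 1 ≠ 0 := by
  have h3 : (√P : ℂ) ≠ 0 := by exact_mod_cast (Real.sqrt_pos.2 (by exact_mod_cast hP)).ne'
  refine inv_ne_zero (mul_ne_zero ?_ h3)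
  rw [Ne, Complex.cpow_eq_zero_iff]
  simp

section

variable {M j : ℕ} {f : ℤ → ℂ} {a b c d : ℤ} {l : ℂ}

theorem sign_mul_sign (hc : c ≠ 0) : c.sign * c.sign = 1 := by
  rcases lt_or_gt_of_ne hc with h1 | h1
  · simp [Int.sign_eq_neg_one_of_neg h1]
  · simp [Int.sign_eq_one_of_pos h1]

theorem natAbs_mul_div (hM : 0 < M) : (((c.natAbs * M : ℕ) : ℝ) / M : ℝ) =
    ((c.sign * c : ℤ) : ℝ) := by
  have hM0 : (M : ℝ) ≠ 0 := by exact_mod_cast hM.ne'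
  rw [Nat.cast_mul, mul_div_cancel_right₀ _ hM0, Int.sign_mul_self_eq_natAbs, Int.cast_natCast]

theorem linear_ne_zero_of_im_pos (hc : c ≠ 0) {τ : ℂ} (hτ : 0 < τ.im) : (c * τ + d : ℂ) ≠ 0 := by
  intro h
  have := congrArg Complex.im h
  simp [hc, hτ.ne'] at this

theorem IsGammaOne.isThetaCoeff (h : IsGammaOne M a b c d) (hM : 0 < M)
    (hf : Function.Periodic f (M : ℤ)) (hf0 : f 0 = 0)
    (hpar : ∀ n, (-1) ^ (j + 1) * f (-n) = f n)
    (hl : ∀ k : ℤ, dft (c.natAbs * M) (twist f M (-d / c)) (c.sign * k) =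
      l * twist f M (a / c) k) :
    IsThetaCoeff j (c.natAbs * M) (twist f M (-d / c)) where
  pos := Nat.mul_pos (Int.natAbs_pos.2 h.c_ne) hM
  periodic := h.twist_periodic hM hf
  parity := twist_neg hpar M _
  zero := by simp [twist, hf0]
  dft_zero := by
    have := hl 0
    rw [mul_zero] at this
    rw [this, twist, hf0]
    simp

/-- Since `γ τ - a / c = -1 / (c (c τ + d))`, the dual point is `γ τ` seen from the cusp `a / c`;
the parity of `f` accounts for the power of the sign. -/
theorem IsGammaOne.thetaSeries_dft (h : IsGammaOne M a b c d) (hM : 0 < M)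
    (hpar : ∀ n, (-1) ^ (j + 1) * f (-n) = f n)
    (hl : ∀ k : ℤ, dft (c.natAbs * M) (twist f M (-d / c)) (c.sign * k) =
      l * twist f M (a / c) k) (m : ℕ) {τ : ℂ} (hτ : 0 < τ.im) :
    thetaSeries m (dft (c.natAbs * M) (twist f M (-d / c))) (c.natAbs * M : ℕ)
      (-1 / (c.sign * (c * τ + d))) =
      l * c.sign ^ (j + 1) * thetaSeries m f M ((a * τ + b) / (c * τ + d)) := by
  have hP : 0 < c.natAbs * M := Nat.mul_pos (Int.natAbs_pos.2 h.c_ne) hM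
  have hs := sign_mul_sign h.c_ne
  have hd : dft (c.natAbs * M) (twist f M (-d / c)) =
      fun n => l * c.sign ^ (j + 1) * twist f M (a / c) n := by
    funext n
    have := hl (c.sign * n)
    rw [← mul_assoc, hs, one_mul] at this
    rw [this, mul_assoc]
    congr 1
    rcases lt_or_gt_of_ne h.c_ne with h1 | h1
    · rw [Int.sign_eq_neg_one_of_neg h1]
      push_cast
      rw [neg_one_mul, ← twist_neg hpar M (a / c) n, ← mul_assoc, ← mul_pow]
      simp
    · simp [Int.sign_eq_one_of_pos h1]
  have hden := linear_ne_zero_of_im_pos (d := d) h.c_ne hτ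
  have hc0 : (c : ℂ) ≠ 0 := by exact_mod_cast h.c_ne
  have hs' : (c.sign : ℂ) * c.sign = 1 := by exact_mod_cast hs
  have hs0 : (c.sign : ℂ) ≠ 0 := left_ne_zero_of_mul_eq_one hs'
  have hdet : (a * d - b * c : ℂ) = 1 := by exact_mod_cast h.det
  rw [hd, thetaSeries_const_mul, thetaSeries_eq_twist m f hM hP (a / c), natAbs_mul_div hM]
  congr 2
  push_cast
  field_simp
  linear_combination ((c.sign : ℂ) ^ 2) * hdet + hs'

/-- The Eichler-type integral as a function of `τ`. -/
def eichlerFunction (M j : ℕ) (f : ℤ → ℂ) (c d ν : ℤ) (τ : ℂ) : ℂ :=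
  raySign (c.natAbs * M) ν *
    eichlerIntegral (thetaSeries (j + 1) (twist f M (-d / c)) (c.natAbs * M : ℕ)) Complex.I
      (-Complex.I * (c.sign * (c * τ + d))) (ν * Complex.I)

/-- The ray is vertical, with `x = -I * w` and `μ = ν * I`, so that `μ * x = ν * w`: the sign `ν`
selects the side of `-d / c`. -/
theorem IsGammaOne.eichlerFunction_eq (h : IsGammaOne M a b c d) (hj : j < 2) (hM : 0 < M)
    (hf : Function.Periodic f (M : ℤ)) (hf0 : f 0 = 0)
    (hpar : ∀ n, (-1) ^ (j + 1) * f (-n) = f n)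
    (hl : ∀ k : ℤ, dft (c.natAbs * M) (twist f M (-d / c)) (c.sign * k) =
      l * twist f M (a / c) k) {ν : ℤ} {τ : ℂ} (hτ : 0 < τ.im)
    (hν : 0 < (ν * (c.sign * (c * τ + d)) : ℂ).re) :
    thetaSeries j f M τ - raySign (c.natAbs * M) ν * Complex.I *
      (ν * (c.sign * (c * τ + d)) : ℂ) ^ (-(1 / 2) : ℂ) * (c.sign * (c * τ + d) : ℂ)⁻¹ ^ j *
      l * c.sign ^ (j + 1) * thetaSeries j f M ((a * τ + b) / (c * τ + d)) =
      eichlerFunction M j f c d ν τ := by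
  have hP : 0 < c.natAbs * M := Nat.mul_pos (Int.natAbs_pos.2 h.c_ne) hM
  have hF := h.isThetaCoeff hM hf hf0 hpar hl
  have hdual := h.thetaSeries_dft hM hpar hl j hτ
  have hφ := thetaSeries_eq_twist j f hM hP (-d / c) τ
  have hc0 : (c : ℂ) ≠ 0 := by exact_mod_cast h.c_ne
  have hw : ((((c.natAbs * M : ℕ) : ℝ) / M : ℝ) : ℂ) * (τ - ((-d / c : ℚ) : ℂ)) =
      c.sign * (c * τ + d) := by
    rw [natAbs_mul_div hM]
    push_cast
    field_simp
    ring
  rw [hw] at hφ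
  set w : ℂ := c.sign * (c * τ + d) with hwdef
  have hw0 : w ≠ 0 := by
    intro h0
    simp [h0] at hν
  have hwim : 0 < w.im := by
    have : w = ((c.sign * c : ℤ) : ℝ) * τ + ((c.sign * d : ℤ) : ℝ) := by
      rw [hwdef]
      push_cast
      ring
    rw [this, Complex.add_im, Complex.im_ofReal_mul, Complex.ofReal_im, add_zero]
    refine mul_pos ?_ hτ
    rw [Int.sign_mul_self_eq_natAbs]
    exact_mod_cast Int.natAbs_pos.2 h.c_ne
  have e1 : Complex.I * (-Complex.I * w) = w := by
    rw [← mul_assoc, mul_neg, Complex.I_mul_I, neg_neg, one_mul]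
  have e2 : (ν * Complex.I : ℂ) * (-Complex.I * w) = ν * w := by rw [mul_assoc, e1]
  have key := hF.eichlerIntegral_eq hj (v := Complex.I) (x := -Complex.I * w) (μ := ν * Complex.I)
    (by simp) (by rwa [e1]) (by simp) (by rwa [e2])
  have hI : invSqrt Complex.I = 1 := by simp [invSqrt]
  rw [e1, e2, hI, hdual, ← hφ, mul_one] at key
  have hne : ((-(ν * Complex.I) : ℂ)) ^ (-(1 / 2) : ℂ) * √((c.natAbs * M : ℕ) : ℝ) ≠ 0 := by
    have h3 : (√((c.natAbs * M : ℕ) : ℝ) : ℂ) ≠ 0 := by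
      exact_mod_cast (Real.sqrt_pos.2 (by exact_mod_cast hP)).ne'
    refine mul_ne_zero ?_ h3
    rw [Ne, Complex.cpow_eq_zero_iff]
    rintro ⟨h0, -⟩
    have : (ν : ℂ) = 0 := by simpa using h0
    simp [this] at hν
  rw [eichlerFunction, key, raySign]
  generalize ((-(ν * Complex.I) : ℂ)) ^ (-(1 / 2) : ℂ) * √((c.natAbs * M : ℕ) : ℝ) = y at hne
  have hww : w * w⁻¹ ^ (j + 1) = w⁻¹ ^ j := by
    rw [pow_succ', ← mul_assoc, mul_inv_cancel₀ hw0, one_mul]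
  generalize w⁻¹ ^ (j + 1) = u at hww
  rw [← hww]
  field_simp
  ring

theorem IsThetaCoeff.differentiableOn_eichlerFunction (hj : j < 2)
    (h : IsThetaCoeff j (c.natAbs * M) (twist f M (-d / c))) (ν : ℤ) :
    DifferentiableOn ℂ (eichlerFunction M j f c d ν)
      {τ | 0 < (ν * (c.sign * (c * τ + d)) : ℂ).re} := by
  obtain ⟨A, hA⟩ := exists_bound_of_periodic h.pos h.periodic
  have hd : DifferentiableOn ℂ (thetaSeries (j + 1) (twist f M (-d / c)) (c.natAbs * M : ℕ))
      {z | 0 < z.im} := fun z hz =>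
    (hasDerivAt_thetaSeries (by exact_mod_cast h.pos) hA h.zero
      hz).differentiableAt.differentiableWithinAt
  have h1 := differentiableOn_eichlerIntegral (h.rapidDecay hj) hd (v := Complex.I)
    (μ := ν * Complex.I) (by simp) (by simp)
  refine (h1.comp (g := fun x => eichlerIntegral _ Complex.I x (ν * Complex.I))
    (f := fun τ : ℂ => -Complex.I * (c.sign * (c * τ + d))) (by fun_prop) ?_).const_mul _
  intro τ hτ
  have : (ν * Complex.I : ℂ) * (-Complex.I * (c.sign * (c * τ + d))) =
      ν * (c.sign * (c * τ + d)) := by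
    linear_combination (-(ν * (c.sign * (c * τ + d))) : ℂ) * Complex.I_mul_I
  change 0 < ((ν * Complex.I : ℂ) * (-Complex.I * (c.sign * (c * τ + d)))).re
  rw [this]
  exact hτ

end

/-- The multiplier, as a complex number. -/
def multiplier (P : ℕ) (c : ℤ) (l : ℂ) : ℂ := raySign P 1 * l * if 0 < c then Complex.I else 1

/-- Across `-d / c` the constant `raySign` jumps by a factor `I`. The branch of the square root of
`J` jumps accordingly, so a single multiplier serves both sides. -/
theorem multiplier_mul_inv_sqrtJ (P : ℕ) {γ : SL(2, ℤ)} (hc : γ 1 0 ≠ 0) {α : ℚ} (l : ℂ) {ν : ℤ}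
    (hν : ν = 1 ∨ ν = -1) (h : 0 < ν * ((γ 1 0).sign * J γ α)) :
    multiplier P (γ 1 0) l * (sqrtJ γ α)⁻¹ =
      raySign P ν * Complex.I * (√|(J γ α : ℝ)| : ℂ)⁻¹ * l * (γ 1 0).sign := by
  have hI : Complex.I⁻¹ = -Complex.I := Complex.inv_I
  have hII := Complex.I_mul_I
  rcases hν with rfl | rfl <;> rcases lt_or_gt_of_ne hc with h1 | h1
  · rw [Int.sign_eq_neg_one_of_neg h1] at h ⊢
    have hJ : J γ α < 0 := by push_cast at h; linarith
    have hJ' : (J γ α : ℝ) < 0 := by exact_mod_cast hJ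
    rw [multiplier, sqrtJ, if_neg (not_le.2 hJ), if_neg (not_lt.2 h1.le), if_neg (not_lt.2 h1.le),
      abs_of_neg hJ', mul_inv, hI]
    push_cast
    ring
  · rw [Int.sign_eq_one_of_pos h1] at h ⊢
    have hJ : 0 < J γ α := by push_cast at h; linarith
    have hJ' : 0 < (J γ α : ℝ) := by exact_mod_cast hJ
    rw [multiplier, sqrtJ, if_pos hJ.le, if_pos h1, abs_of_pos hJ']
    push_cast
    ring
  · rw [Int.sign_eq_neg_one_of_neg h1] at h ⊢
    have hJ : 0 < J γ α := by push_cast at h; linarith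
    have hJ' : 0 < (J γ α : ℝ) := by exact_mod_cast hJ
    rw [multiplier, sqrtJ, if_pos hJ.le, if_neg (not_lt.2 h1.le), abs_of_pos hJ', raySign_neg_one]
    push_cast
    linear_combination (raySign P 1 * l * (√(J γ α : ℝ) : ℂ)⁻¹) * hII
  · rw [Int.sign_eq_one_of_pos h1] at h ⊢
    have hJ : J γ α < 0 := by push_cast at h; linarith
    have hJ' : (J γ α : ℝ) < 0 := by exact_mod_cast hJ
    rw [multiplier, sqrtJ, if_neg (not_le.2 hJ), if_pos h1, if_pos h1, abs_of_neg hJ',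
      raySign_neg_one, mul_inv, inv_neg, hI]
    push_cast
    ring

/-- Write `c τ + d = J q`. Multiplying by the signs turns `J` into `|J| > 0`, which can be pulled
out of the power `-1/2` without changing branch. -/
theorem multiplier_mul_automorphy (P j : ℕ) {γ : SL(2, ℤ)} (hc : γ 1 0 ≠ 0) {α : ℚ} (l : ℂ) {ν : ℤ}
    (hν : ν = 1 ∨ ν = -1) (h : 0 < ν * ((γ 1 0).sign * J γ α)) {τ : ℂ}
    (hτ : (γ 1 0 * τ + γ 1 1 : ℂ) ≠ 0) :
    multiplier P (γ 1 0) l * automorphy (2 * j + 1) γ α τ =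
      raySign P ν * Complex.I *
      (ν * ((γ 1 0).sign * (γ 1 0 * τ + γ 1 1)) : ℂ) ^ (-(1 / 2) : ℂ) *
      ((γ 1 0).sign * (γ 1 0 * τ + γ 1 1) : ℂ)⁻¹ ^ j * l * (γ 1 0).sign ^ (j + 1) := by
  have hJ : J γ α ≠ 0 := by
    rintro h0
    simp [h0] at h
  have hJc : (J γ α : ℂ) ≠ 0 := by exact_mod_cast hJ
  have hJdef : (J γ α : ℂ) = (γ 1 0 : ℂ) * α + γ 1 1 := by simp [J]
  set q : ℂ := 1 + (γ 1 0 : ℂ) / (J γ α : ℂ) * (τ - α) with hq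
  have hq1 : (γ 1 0 * τ + γ 1 1 : ℂ) = J γ α * q := by
    rw [hq, mul_add, ← mul_assoc, mul_div_cancel₀ _ hJc, hJdef]
    ring
  have hq0 : q ≠ 0 := by
    rintro h0
    rw [hq1, h0, mul_zero] at hτ
    exact hτ rfl
  have hs : ((γ 1 0).sign : ℂ) * (γ 1 0).sign = 1 := by exact_mod_cast sign_mul_sign hc
  have hs0 : ((γ 1 0).sign : ℂ) ≠ 0 := left_ne_zero_of_mul_eq_one hs
  have habs : (ν * ((γ 1 0).sign * J γ α) : ℚ) = |J γ α| := by
    rw [← abs_of_pos h, abs_mul, abs_mul]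
    have h1 : |(ν : ℚ)| = 1 := by rcases hν with rfl | rfl <;> simp
    have h2 : |((γ 1 0).sign : ℚ)| = 1 := by
      rcases lt_or_gt_of_ne hc with h1 | h1
      · simp [Int.sign_eq_neg_one_of_neg h1]
      · simp [Int.sign_eq_one_of_pos h1]
    rw [h1, h2, one_mul, one_mul]
  have habs' : (ν * ((γ 1 0).sign * J γ α) : ℂ) = ((|(J γ α : ℝ)| : ℝ) : ℂ) := by
    have := congrArg (fun x : ℚ => ((x : ℝ) : ℂ)) habs
    push_cast at this
    simpa using this
  have hpos : 0 < |(J γ α : ℝ)| := abs_pos.2 (by exact_mod_cast hJ)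
  have e1 : (ν * ((γ 1 0).sign * (J γ α * q)) : ℂ) ^ (-(1 / 2) : ℂ) =
      (√|(J γ α : ℝ)| : ℂ)⁻¹ * q ^ (-(1 / 2) : ℂ) := by
    rw [show (ν * ((γ 1 0).sign * (J γ α * q)) : ℂ) = ν * ((γ 1 0).sign * J γ α) * q by ring, habs',
      ofReal_mul_cpow hpos, ofReal_cpow_neg_half hpos.le]
  have e2 : q ^ (-((2 * j + 1 : ℤ) : ℂ) / 2) = q ^ (-(1 / 2) : ℂ) * q⁻¹ ^ j := by
    rw [show (-((2 * j + 1 : ℤ) : ℂ) / 2) = -(1 / 2) + -(j : ℂ) by push_cast; ring,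
      Complex.cpow_add _ _ hq0, Complex.cpow_neg q j, Complex.cpow_natCast, inv_pow]
  have e3 : sqrtJ γ α ^ (-(2 * j + 1 : ℤ)) = (sqrtJ γ α)⁻¹ * (J γ α : ℂ)⁻¹ ^ j := by
    rw [← sqrtJ_sq, zpow_neg, zpow_add₀ (sqrtJ_ne_zero γ hJ), zpow_one, mul_inv, zpow_mul,
      zpow_natCast, mul_comm, inv_pow]
    rfl
  have e4 : ((γ 1 0).sign * (J γ α * q) : ℂ)⁻¹ ^ j * (γ 1 0).sign ^ (j + 1) =
      (γ 1 0).sign * ((J γ α : ℂ)⁻¹ ^ j * q⁻¹ ^ j) := by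
    have : ((γ 1 0).sign : ℂ)⁻¹ ^ j * (γ 1 0).sign ^ j = 1 := by
      rw [← mul_pow, inv_mul_cancel₀ hs0, one_pow]
    rw [mul_inv, mul_inv, mul_pow, mul_pow, pow_succ]
    linear_combination ((γ 1 0).sign * ((J γ α : ℂ)⁻¹ ^ j * q⁻¹ ^ j)) * this
  have key := multiplier_mul_inv_sqrtJ P hc l hν h
  rw [automorphy, e3, e2, hq1, e1]
  linear_combination ((J γ α : ℂ)⁻¹ ^ j * (q ^ (-(1 / 2) : ℂ) * q⁻¹ ^ j)) * key -
    (raySign P ν * Complex.I * (√|(J γ α : ℝ)| : ℂ)⁻¹ * q ^ (-(1 / 2) : ℂ) * l) * e4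

end QuantumModular
end

noncomputable section
namespace QuantumModular

open Filter Topology

/-! ### The modularity defect of the base theta function -/

theorem isGammaOne_of_mem {M : ℕ} {γ : SL(2, ℤ)} (h : γ ∈ CongruenceSubgroup.Gamma1 (2 * M))
    (hc : γ 1 0 ≠ 0) : IsGammaOne M (γ 0 0) (γ 0 1) (γ 1 0) (γ 1 1) := by
  obtain ⟨h1, h2, h3⟩ := (CongruenceSubgroup.Gamma1_mem _ _).1 h
  have hcast : ((2 * M : ℕ) : ℤ) = 2 * (M : ℤ) := by push_cast; rfl
  refine ⟨det_eq_one γ, ?_, ?_, ?_, hc⟩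
  · rw [← hcast, ← ZMod.intCast_zmod_eq_zero_iff_dvd]
    push_cast
    rw [sub_eq_zero]
    exact_mod_cast h1
  · rw [← hcast, ← ZMod.intCast_zmod_eq_zero_iff_dvd]
    push_cast
    rw [sub_eq_zero]
    exact_mod_cast h2
  · rw [← hcast, ← ZMod.intCast_zmod_eq_zero_iff_dvd]
    exact_mod_cast h3

section

variable {M j : ℕ} {f : ℤ → ℂ} {n₀ : ℤ}

/-- The function `g` gives the defect of modularity of `φ` at `γ`, with multiplier `e`. -/
def HasDefect (k : ℤ) (e : ℂˣ) (γ : SL(2, ℤ)) (φ g : ℂ → ℂ) : Prop :=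
  AnalyticOnRegular γ g ∧ ∀ α : ℚ, J γ α ≠ 0 → ∀ᶠ τ in 𝓝 (α : ℂ), 0 < τ.im →
    φ τ - e * automorphy k γ α τ * φ (moebius γ τ) = g τ

theorem exists_hasDefect_of_ne_zero (hj : j < 2) (hM : 0 < M)
    (hf : Function.Periodic f (M : ℤ)) (hf0 : f 0 = 0)
    (hpar : ∀ n, (-1) ^ (j + 1) * f (-n) = f n)
    (hsupp : ∀ n : ℤ, f n ≠ 0 → n ^ 2 ≡ n₀ ^ 2 [ZMOD (2 * (M : ℤ))]) {n : ℤ} (hn : f n ≠ 0)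
    {γ : SL(2, ℤ)} (hγ : γ ∈ CongruenceSubgroup.Gamma1 (2 * M)) (hc : γ 1 0 ≠ 0) :
    ∃ e g, HasDefect (2 * j + 1) e γ (thetaSeries j f M) g := by
  have h := isGammaOne_of_mem hγ hc
  set c := γ 1 0 with hcdef
  set d := γ 1 1 with hddef
  obtain ⟨l, hl⟩ := h.exists_dft_twist hM hf hsupp
  have hP : 0 < c.natAbs * M := Nat.mul_pos (Int.natAbs_pos.2 hc) hM
  have hF := h.isThetaCoeff hM hf hf0 hpar hl
  have hl0 : l ≠ 0 := by
    rintro rfl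
    refine hn ?_
    have h0 : ∀ k, dft (c.natAbs * M) (twist f M (-d / c)) k = 0 := by
      intro k
      have := hl (c.sign * k)
      rwa [← mul_assoc, sign_mul_sign hc, one_mul, zero_mul] at this
    have := eq_zero_of_dft_eq_zero hP hF.periodic h0 n
    rw [twist] at this
    exact (mul_eq_zero.1 this).resolve_right (Complex.exp_ne_zero _)
  have he : multiplier (c.natAbs * M) c l ≠ 0 := by
    refine mul_ne_zero (mul_ne_zero (raySign_one_ne_zero hP) hl0) ?_
    split_ifs
    · exact Complex.I_ne_zero
    · exact one_ne_zero
  set w : ℂ → ℂ := fun τ => c.sign * (c * τ + d) with hw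
  have hwc : Continuous w := by fun_prop
  have hopen : ∀ ν : ℤ, IsOpen {τ : ℂ | 0 < ((ν : ℂ) * w τ).re} := fun ν =>
    isOpen_lt continuous_const (by fun_prop)
  -- The two sides are glued along a line that meets the real axis only at `-d / c`, a point outside
  -- the regular set.
  set g : ℂ → ℂ := fun τ => if 0 < (w τ).re then eichlerFunction M j f c d 1 τ else
    eichlerFunction M j f c d (-1) τ with hg
  have hgν : ∀ ν : ℤ, ν = 1 ∨ ν = -1 → ∀ τ, 0 < ((ν : ℂ) * w τ).re →
      g τ = eichlerFunction M j f c d ν τ := by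
    rintro ν (rfl | rfl) τ hτ
    · rw [Int.cast_one, one_mul] at hτ
      simp only [hg, if_pos hτ]
    · rw [Int.cast_neg, Int.cast_one, neg_one_mul, Complex.neg_re] at hτ
      simp only [hg, if_neg (by linarith : ¬ 0 < (w τ).re)]
  have hsR : (c.sign : ℝ) ≠ 0 := by exact_mod_cast fun h0 => hc (Int.sign_eq_zero_iff_zero.1 h0)
  have hwre : ∀ x : ℝ, w x = ((c.sign * (c * x + d) : ℝ) : ℂ) := fun x => by
    simp only [hw]
    push_cast
    ring
  have hνex : ∀ x : ℝ, (c : ℝ) * x + d ≠ 0 → ∃ ν : ℤ, (ν = 1 ∨ ν = -1) ∧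
      0 < (ν : ℝ) * (c.sign * (c * x + d)) := by
    intro x hx
    rcases lt_or_gt_of_ne (mul_ne_zero hsR hx) with h1 | h1
    · exact ⟨-1, .inr rfl, by push_cast; linarith⟩
    · exact ⟨1, .inl rfl, by push_cast; linarith⟩
  have hmem : ∀ (x : ℝ) (ν : ℤ), 0 < (ν : ℝ) * (c.sign * (c * x + d)) →
      (x : ℂ) ∈ {τ : ℂ | 0 < ((ν : ℂ) * w τ).re} := by
    intro x ν hν
    change 0 < ((ν : ℂ) * w x).re
    rw [hwre, ← Complex.ofReal_intCast, ← Complex.ofReal_mul, Complex.ofReal_re]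
    exact hν
  refine ⟨Units.mk0 _ he, g, ?_, fun α hα => ?_⟩
  · rintro _ ⟨x, hx, rfl⟩
    obtain ⟨ν, hν1, hν⟩ := hνex x hx
    have hm := (hopen ν).mem_nhds (hmem x ν hν)
    refine ((hF.differentiableOn_eichlerFunction hj ν).analyticAt hm).congr ?_
    filter_upwards [hm] with τ hτ
    exact (hgν ν hν1 τ hτ).symm
  · have hx : (c : ℝ) * ((α : ℚ) : ℝ) + d ≠ 0 := mem_regularSet γ hα
    obtain ⟨ν, hν1, hν⟩ := hνex _ hx
    have hm := (hopen ν).mem_nhds (hmem _ ν hν)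
    rw [Complex.ofReal_ratCast] at hm
    have hνq : 0 < (ν : ℚ) * (c.sign * J γ α) := by
      have : (((ν : ℚ) * (c.sign * J γ α) : ℚ) : ℝ) =
          (ν : ℝ) * (c.sign * (c * ((α : ℚ) : ℝ) + d)) := by
        simp [J, hcdef, hddef]
      rw [← this] at hν
      exact_mod_cast hν
    filter_upwards [hm] with τ hτ hτ0
    have hden := linear_ne_zero_of_im_pos (d := d) hc hτ0
    have h1 := h.eichlerFunction_eq hj hM hf hf0 hpar hl hτ0 hτ
    have h2 := multiplier_mul_automorphy (c.natAbs * M) j hc l hν1 hνq hden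
    rw [hgν ν hν1 τ hτ, ← h1, Units.val_mk0, h2]
    rfl

/-- On the support of `f`, `n²` is constant modulo `2 M`, so translation by `b` multiplies every
term by the same phase. -/
theorem exists_thetaSeries_add_intCast (hM : 0 < M)
    (hsupp : ∀ n : ℤ, f n ≠ 0 → n ^ 2 ≡ n₀ ^ 2 [ZMOD (2 * (M : ℤ))]) (m : ℕ) (b : ℤ) :
    ∃ z : ℂ, z ≠ 0 ∧ ∀ τ, thetaSeries m f M (τ + b) = z * thetaSeries m f M τ := by
  have hM0 : (M : ℂ) ≠ 0 := by exact_mod_cast hM.ne'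
  refine ⟨Complex.exp (Real.pi * Complex.I * n₀ ^ 2 * b / M), Complex.exp_ne_zero _, fun τ => ?_⟩
  rw [thetaSeries, thetaSeries, ← tsum_mul_left]
  refine tsum_congr fun n => ?_
  rw [thetaTerm, thetaTerm]
  by_cases hn : f n = 0
  · simp [hn]
  obtain ⟨q, hq⟩ := (hsupp _ hn).symm.dvd
  have hq2 : (n : ℂ) ^ 2 - n₀ ^ 2 = 2 * M * q := by exact_mod_cast hq
  rw [mul_left_comm (Complex.exp _), ← Complex.exp_add]
  congr 1
  refine exp_eq_of_div (x := n ^ 2 * (τ + b)) (y := n₀ ^ 2 * b + n ^ 2 * τ) hM0 (q * b) ?_ ?_ ?_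
  · push_cast
    ring
  · push_cast
    ring
  · push_cast
    linear_combination (b : ℂ) * hq2

theorem exists_hasDefect_of_eq_zero (hM : 0 < M)
    (hsupp : ∀ n : ℤ, f n ≠ 0 → n ^ 2 ≡ n₀ ^ 2 [ZMOD (2 * (M : ℤ))])
    {γ : SL(2, ℤ)} (hc : γ 1 0 = 0) (hd : γ 1 1 = 1) :
    ∃ e g, HasDefect (2 * j + 1) e γ (thetaSeries j f M) g := by
  have hdet := det_eq_one γ
  have ha : γ 0 0 = 1 := by rw [hc, hd] at hdet; linarith
  obtain ⟨z, hz, htr⟩ := exists_thetaSeries_add_intCast hM hsupp j (γ 0 1)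
  refine ⟨Units.mk0 z⁻¹ (inv_ne_zero hz), fun _ => 0,
    fun _ _ => analyticAt_const, fun α hα => Eventually.of_forall fun τ _ => ?_⟩
  have hm : moebius γ τ = τ + γ 0 1 := by
    rw [moebius, ha, hc, hd]
    simp
  have haut : automorphy (2 * j + 1) γ α τ = 1 := by
    have hJ : J γ α = 1 := by simp [J, hc, hd]
    simp [automorphy, sqrtJ, hJ, hc]
  rw [hm, haut, htr, Units.val_mk0, mul_one, ← mul_assoc, inv_mul_cancel₀ hz, one_mul, sub_self]

/-- An element of `Γ₁(2 M)` that fixes `∞` is unipotent, unless `f = 0`. -/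
theorem eq_one_of_mem_gamma1 (hf : Function.Periodic f (M : ℤ)) (hf0 : f 0 = 0) {n : ℤ}
    (hn : f n ≠ 0) {γ : SL(2, ℤ)} (hγ : γ ∈ CongruenceSubgroup.Gamma1 (2 * M)) (hc : γ 1 0 = 0) :
    γ 1 1 = 1 := by
  have hdet := det_eq_one γ
  rw [hc, mul_zero, sub_zero] at hdet
  rcases Int.isUnit_iff.1 (IsUnit.of_mul_eq_one_right _ hdet) with h | h
  · exact h
  · exfalso
    have h1 := ((CongruenceSubgroup.Gamma1_mem _ _).1 hγ).2.1
    have h2 : ((2 * M : ℕ) : ℤ) ∣ γ 1 1 - 1 := by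
      rw [← ZMod.intCast_zmod_eq_zero_iff_dvd]
      push_cast
      rw [sub_eq_zero]
      exact_mod_cast h1
    rw [h] at h2
    have h3 : (M : ℤ) ∣ 1 := by
      obtain ⟨q, hq⟩ := h2
      refine ⟨-q, ?_⟩
      push_cast at hq
      linarith
    obtain ⟨q, hq⟩ := h3
    refine hn ?_
    have := hf.int_mul (n * q) 0
    rw [hf0] at this
    rw [← this]
    congr 1
    simp only [Int.cast_id]
    linear_combination n * hq

theorem exists_hasDefect (hj : j < 2) (hM : 0 < M)
    (hf : Function.Periodic f (M : ℤ)) (hf0 : f 0 = 0)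
    (hpar : ∀ n, (-1) ^ (j + 1) * f (-n) = f n)
    (hsupp : ∀ n : ℤ, f n ≠ 0 → n ^ 2 ≡ n₀ ^ 2 [ZMOD (2 * (M : ℤ))])
    {γ : SL(2, ℤ)} (hγ : γ ∈ CongruenceSubgroup.Gamma1 (2 * M)) :
    ∃ e g, HasDefect (2 * j + 1) e γ (thetaSeries j f M) g := by
  -- For `f = 0` the Gauss sum argument does not give a nonzero constant, but any multiplier works.
  by_cases h0 : ∀ n, f n = 0
  · refine ⟨1, fun _ => 0, fun _ _ => analyticAt_const, fun α _ =>
      Eventually.of_forall fun τ _ => ?_⟩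
    simp [thetaSeries, thetaTerm, h0]
  · push Not at h0
    obtain ⟨n, hn⟩ := h0
    by_cases hc : γ 1 0 = 0
    · exact exists_hasDefect_of_eq_zero hM hsupp hc (eq_one_of_mem_gamma1 hf hf0 hn hγ hc)
    · exact exists_hasDefect_of_ne_zero hj hM hf hf0 hpar hsupp hn hγ hc

end

end QuantumModular
end

noncomputable section
namespace QuantumModular

open Filter Topology

/-! ### Invariance of the quantum set -/

theorem sum_range_mul_period {P : ℕ} {F : ℤ → ℂ} (hF : Function.Periodic F (P : ℤ)) (m : ℕ) :
    ∑ x ∈ Finset.range (P * m), F x = m * ∑ x ∈ Finset.range P, F x := by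
  induction m with
  | zero => simp
  | succ m ih =>
    rw [mul_add, mul_one, Finset.sum_range_add, ih]
    have : ∀ x : ℕ, F ((P * m + x : ℕ) : ℤ) = F x := by
      intro x
      have := hF.int_mul m x
      push_cast
      rw [← this]
      congr 1
      simp only [Int.cast_id]
      ring
    simp only [this]
    push_cast
    ring

theorem sum_range_eq_zero_of_period {P P' : ℕ} {F : ℤ → ℂ}
    (hF : Function.Periodic F (P : ℤ)) (hF' : Function.Periodic F (P' : ℤ))
    (h : ∑ x ∈ Finset.range P, F x = 0) (hP : 0 < P) : ∑ x ∈ Finset.range P', F x = 0 := by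
  have h1 := sum_range_mul_period hF P'
  rw [h, mul_zero, mul_comm, sum_range_mul_period hF'] at h1
  exact (mul_eq_zero.1 h1).resolve_left (by exact_mod_cast hP.ne')

section

variable {M : ℕ} {f : ℤ → ℂ} {n₀ : ℤ}

theorem mem_quantumSet_of_odd (hM : 0 < M) (hf : Function.Periodic f (M : ℤ))
    (hodd : ∀ n, f (-n) = -f n) (α : ℚ) : α ∈ quantumSet f M := by
  have hP : 0 < 2 * M * α.den := Nat.mul_pos (by omega) α.den_pos
  rw [mem_quantumSet_iff hM hf, dft_apply_zero]
  have h := sum_range_neg hP (twist_periodic hM hf α)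
  have h1 : ∀ n : ℤ, twist f M α (-n) = - twist f M α n := by
    intro n
    rw [twist, twist, hodd]
    push_cast
    rw [neg_sq, neg_mul]
  simp only [h1, Finset.sum_neg_distrib] at h
  linear_combination (-1 / 2 : ℂ) * h

/-- As `z → 0` in a cone, the imaginary part of `-1 / z` tends to infinity and only the constant
term survives. -/
theorem tendsto_thetaSeriesInt_neg_one_div {a : ℤ → ℂ} {A P : ℝ} (hP : 0 < P)
    (ha : ∀ n, ‖a n‖ ≤ A) (hev : ∀ n, a (-n) = a n) {κ : ℝ} (hκ : 0 < κ) :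
    Tendsto (fun z => thetaSeriesInt 0 a P (-1 / z)) (𝓝[cone κ] 0) (𝓝 (a 0)) := by
  set a' : ℤ → ℂ := fun n => if n = 0 then 0 else a n with ha'
  have hA : 0 ≤ A := (norm_nonneg _).trans (ha 0)
  have hb : ∀ n, ‖a' n‖ ≤ A := by
    intro n
    simp only [ha']
    split_ifs
    · simpa using hA
    · exact ha n
  have h0 : a' 0 = 0 := by simp [ha']
  have hev' : ∀ n : ℤ, (-1) ^ 0 * a' (-n) = a' n := by
    intro n
    simp [ha', hev]
  have heq : ∀ y : ℂ, 0 < y.im → thetaSeriesInt 0 a P y = a 0 + 2 * thetaSeries 0 a' P y := by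
    intro y hy
    rw [← thetaSeriesInt_eq_two_mul hP hb h0 hev' hy, thetaSeriesInt, thetaSeriesInt,
      ((summable_norm_thetaTerm_int hP ha hy).of_norm).tsum_eq_add_tsum_ite 0]
    congr 1
    · simp [thetaTerm]
    · refine tsum_congr fun n => ?_
      by_cases hn : n = 0 <;> simp [thetaTerm, ha', hn]
  obtain ⟨K, hK, hbd⟩ := exists_norm_thetaSeries_le (m := 0) hP hb h0 one_pos
  have hnorm : Tendsto (fun z : ℂ => κ / ‖z‖) (𝓝[cone κ] 0) atTop := by
    have h1 : Tendsto (fun z : ℂ => ‖z‖⁻¹) (𝓝[≠] 0) atTop :=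
      tendsto_inv_nhdsGT_zero.comp tendsto_norm_nhdsNE_zero
    simp only [div_eq_mul_inv]
    exact (h1.mono_left (nhdsWithin_cone_le κ)).const_mul_atTop hκ
  have hmem : ∀ᶠ z in 𝓝[cone κ] (0 : ℂ), z ∈ cone κ := self_mem_nhdsWithin
  have hpi := Real.pi_pos
  have hexp : Tendsto (fun z : ℂ => K * Real.exp (-(Real.pi / (2 * P) * (κ / ‖z‖))))
      (𝓝[cone κ] 0) (𝓝 0) := by
    have := (Real.tendsto_exp_neg_atTop_nhds_zero.comp
      (hnorm.const_mul_atTop (show 0 < Real.pi / (2 * P) by positivity))).const_mul K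
    simpa using this
  have hθ : Tendsto (fun z => thetaSeries 0 a' P (-1 / z)) (𝓝[cone κ] 0) (𝓝 0) := by
    refine squeeze_zero_norm' ?_ hexp
    filter_upwards [hmem, hnorm.eventually_ge_atTop 1] with z hz h1
    have hi := neg_one_div_im_ge hz
    refine (hbd _ (h1.trans hi)).trans ?_
    gcongr
  have hlim := (hθ.const_mul 2).const_add (a 0)
  rw [mul_zero, add_zero] at hlim
  refine hlim.congr' ?_
  filter_upwards [hmem] with z hz
  exact (heq _ (neg_one_div_im_pos (im_pos_of_mem_cone hκ hz))).symm

theorem tendsto_norm_mul_thetaSeries {P : ℕ} (hP : 0 < P) {F : ℤ → ℂ}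
    (hF : Function.Periodic F (P : ℤ)) (hF0 : F 0 = 0) (hev : ∀ n, F (-n) = F n) {κ : ℝ}
    (hκ : 0 < κ) :
    Tendsto (fun z : ℂ => ‖z‖ ^ (1 / 2 : ℝ) * ‖thetaSeries 0 F P z‖) (𝓝[cone κ] 0)
      (𝓝 (‖(2 * √P : ℂ)⁻¹‖ * ‖dft P F 0‖)) := by
  obtain ⟨A, hA⟩ := exists_bound_of_periodic hP hF
  obtain ⟨B, hB⟩ := exists_bound_of_periodic hP (dft_periodic hP F)
  have hP' : (0 : ℝ) < P := by exact_mod_cast hP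
  have hdev : ∀ n, dft P F (-n) = dft P F n := fun n => by
    rw [dft_neg hP hF]
    simp only [hev]
  refine ((tendsto_thetaSeriesInt_neg_one_div hP' hB hdev hκ).norm.const_mul _).congr' ?_
  filter_upwards [self_mem_nhdsWithin] with z hz
  have hzi := im_pos_of_mem_cone hκ hz
  have hz0 : 0 < ‖z‖ := norm_pos_iff.2 hz.1
  have h1 := thetaSeriesInt_zero_functional_equation hP hF hzi
  rw [thetaSeriesInt_eq_two_mul hP' hA hF0 (fun n => by simpa using hev n) hzi,
    one_div_cpow_eq_invSqrt hP z] at h1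
  have h2 : thetaSeries 0 F P z =
      invSqrt z * ((2 * √P : ℂ)⁻¹ * thetaSeriesInt 0 (dft P F) P (-1 / z)) := by
    rw [mul_inv]
    linear_combination h1 / 2
  rw [h2, norm_mul, norm_invSqrt, ← mul_assoc, ← Real.rpow_add hz0, norm_mul]
  norm_num

/-- By inversion the leading term at `α` is `|T|^(-1/2)` times a multiple of the mean value. This is
an analytic test for membership in the quantum set. -/
theorem exists_tendsto_norm_mul_thetaSeries (hM : 0 < M) (hf : Function.Periodic f (M : ℤ))
    (hf0 : f 0 = 0) (hev : ∀ n, f (-n) = f n) (α : ℚ) : ∃ L : ℝ, (L = 0 ↔ α ∈ quantumSet f M) ∧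
    ∀ κ : ℝ, 0 < κ → Tendsto (fun T : ℂ => ‖T‖ ^ (1 / 2 : ℝ) * ‖thetaSeries 0 f M (α + T)‖)
      (𝓝[cone κ] 0) (𝓝 L) := by
  have hP : 0 < 2 * M * α.den := Nat.mul_pos (by omega) α.den_pos
  set P := 2 * M * α.den with hPdef
  have hM' : (0 : ℝ) < M := by exact_mod_cast hM
  have hP' : (0 : ℝ) < P := by exact_mod_cast hP
  set r : ℝ := (P : ℝ) / M with hr
  have hr0 : 0 < r := by positivity
  refine ⟨(r ^ (1 / 2 : ℝ))⁻¹ * (‖(2 * √P : ℂ)⁻¹‖ * ‖dft P (twist f M α) 0‖), ?_, fun κ hκ => ?_⟩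
  · rw [mem_quantumSet_iff hM hf, mul_eq_zero, mul_eq_zero, norm_eq_zero, norm_eq_zero]
    have h1 : (r ^ (1 / 2 : ℝ))⁻¹ ≠ 0 := by positivity
    have h2 : (2 * √P : ℂ)⁻¹ ≠ 0 := by
      have : (√P : ℂ) ≠ 0 := by exact_mod_cast (Real.sqrt_pos.2 hP').ne'
      exact inv_ne_zero (mul_ne_zero two_ne_zero this)
    simp only [h1, h2, false_or]
    rfl
  · have hev' : ∀ n, twist f M α (-n) = twist f M α n := fun n => by
      rw [twist, twist, hev]
      push_cast
      rw [neg_sq]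
    have h1 := ((tendsto_norm_mul_thetaSeries hP (twist_periodic hM hf α) (by simp [twist, hf0])
      hev' hκ).comp (tendsto_ofReal_mul_cone hr0 κ)).const_mul (r ^ (1 / 2 : ℝ))⁻¹
    refine h1.congr fun T => ?_
    simp only [Function.comp]
    rw [thetaSeries_eq_twist 0 f hM hP α, add_sub_cancel_left, norm_mul, Complex.norm_real,
      Real.norm_of_nonneg hr0.le, Real.mul_rpow hr0.le (norm_nonneg _), ← mul_assoc, ← mul_assoc,
      inv_mul_cancel₀ (Real.rpow_pos_of_pos hr0 _).ne', one_mul]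

/-- The increment is `O(T)`, so the bound carries the limit `0` at `α` over to `act γ α`, where the
analytic test applies again. -/
theorem act_mem_quantumSet_of_bound (hM : 0 < M) (hf : Function.Periodic f (M : ℤ))
    (hf0 : f 0 = 0) (hev : ∀ n, f (-n) = f n) {γ : SL(2, ℤ)} {α : ℚ} (hJ : J γ α ≠ 0)
    (hα : α ∈ quantumSet f M) {C : ℝ} (hC : ∀ᶠ T in 𝓝[cone 1] (0 : ℂ),
      ‖thetaSeries 0 f M (moebius γ (α + T))‖ ≤ C * ‖thetaSeries 0 f M (α + T)‖) :
    act γ α ∈ quantumSet f M := by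
  obtain ⟨L, hL, hlim⟩ := exists_tendsto_norm_mul_thetaSeries hM hf hf0 hev α
  obtain ⟨L', hL', hlim'⟩ := exists_tendsto_norm_mul_thetaSeries hM hf hf0 hev (act γ α)
  have := nhdsWithin_cone_neBot (κ := 1) le_rfl
  have h1 := (hlim' (1 / 2) (by norm_num)).comp (tendsto_moebius_sub_act γ hJ one_pos)
  have h2 := hlim 1 one_pos
  rw [hL.2 hα] at h2
  obtain ⟨B, hB0, hB⟩ := ((hasExpansion_increment (nhdsWithin_cone_le_nhds 1) γ hJ).isBigO_id
    (constantCoeff_increment γ α)).exists_nonneg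
  refine hL'.1 (tendsto_nhds_unique h1 ?_)
  have h3 := h2.const_mul (B ^ (1 / 2 : ℝ) * C)
  rw [mul_zero] at h3
  refine squeeze_zero' (Eventually.of_forall fun T =>
    mul_nonneg (Real.rpow_nonneg (norm_nonneg _) _) (norm_nonneg _)) ?_ h3
  filter_upwards [hC, hB.bound] with T hT hBT
  simp only [Function.comp]
  rw [add_sub_cancel]
  have h4 : ‖moebius γ (α + T) - (act γ α : ℂ)‖ ^ (1 / 2 : ℝ) ≤
      B ^ (1 / 2 : ℝ) * ‖T‖ ^ (1 / 2 : ℝ) := by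
    rw [← Real.mul_rpow hB0 (norm_nonneg _)]
    exact Real.rpow_le_rpow (norm_nonneg _) hBT (by norm_num)
  calc _ ≤ B ^ (1 / 2 : ℝ) * ‖T‖ ^ (1 / 2 : ℝ) * (C * ‖thetaSeries 0 f M (α + T)‖) := by gcongr
    _ = _ := by ring

/-- The inverse matrix has `-d / c` replaced by `a / c`, and the transform of the corresponding
twist at `0` is a multiple of `f 0 = 0`. -/
theorem div_mem_quantumSet (hM : 0 < M) (hf : Function.Periodic f (M : ℤ)) (hf0 : f 0 = 0)
    (hsupp : ∀ n : ℤ, f n ≠ 0 → n ^ 2 ≡ n₀ ^ 2 [ZMOD (2 * (M : ℤ))]) {a b c d : ℤ}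
    (h : IsGammaOne M a b c d) : ((a : ℚ) / c) ∈ quantumSet f M := by
  have h' : IsGammaOne M d (-b) (-c) a := by
    refine ⟨?_, h.d_mod, h.a_mod, (dvd_neg).2 h.c_mod, neg_ne_zero.2 h.c_ne⟩
    linear_combination h.det
  obtain ⟨l, hl⟩ := h'.exists_dft_twist hM hf hsupp
  have h0 := hl 0
  rw [mul_zero, twist, hf0, zero_mul, mul_zero, dft_apply_zero] at h0
  have hper := h'.twist_periodic hM hf
  have hac : (-a / ((-c : ℤ) : ℚ) : ℚ) = a / c := by
    push_cast
    rw [neg_div_neg_eq]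
  rw [hac] at h0 hper
  rw [mem_quantumSet_iff hM hf, dft_apply_zero]
  exact sum_range_eq_zero_of_period hper
    (twist_periodic hM hf _) h0 (Nat.mul_pos (Int.natAbs_pos.2 h'.c_ne) hM)

/-- For even `f` the series of exponent `0` transforms without any defect. Only absolute values are
compared, so neither multipliers nor branches matter. -/
theorem exists_bound_moebius (hM : 0 < M) (hf : Function.Periodic f (M : ℤ))
    (hf0 : f 0 = 0) (hev : ∀ n, f (-n) = f n)
    (hsupp : ∀ n : ℤ, f n ≠ 0 → n ^ 2 ≡ n₀ ^ 2 [ZMOD (2 * (M : ℤ))]) {n : ℤ} (hn : f n ≠ 0)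
    {γ : SL(2, ℤ)} (hγ : γ ∈ CongruenceSubgroup.Gamma1 (2 * M)) (α : ℚ) :
    ∃ C : ℝ, ∀ᶠ T in 𝓝[cone 1] (0 : ℂ),
      ‖thetaSeries 0 f M (moebius γ (α + T))‖ ≤ C * ‖thetaSeries 0 f M (α + T)‖ := by
  have hpar : ∀ n, (-1) ^ (1 + 1) * f (-n) = f n := fun n => by simp [hev]
  by_cases hc : γ 1 0 = 0
  · have hd := eq_one_of_mem_gamma1 hf hf0 hn hγ hc
    have hdet := det_eq_one γ
    have ha : γ 0 0 = 1 := by rw [hc, hd] at hdet; linarith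
    obtain ⟨z, hz, htr⟩ := exists_thetaSeries_add_intCast hM hsupp 0 (γ 0 1)
    refine ⟨‖z‖, Eventually.of_forall fun T => ?_⟩
    have hm : moebius γ (α + T) = α + T + γ 0 1 := by
      rw [moebius, ha, hc, hd]
      simp
    rw [hm, htr, norm_mul]
  · have h := isGammaOne_of_mem hγ hc
    obtain ⟨l, hl⟩ := h.exists_dft_twist hM hf hsupp
    have hP : 0 < (γ 1 0).natAbs * M := Nat.mul_pos (Int.natAbs_pos.2 hc) hM
    have hF := h.isThetaCoeff hM hf hf0 hpar hl
    set P := (γ 1 0).natAbs * M with hPdef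
    have hl0 : l ≠ 0 := by
      rintro rfl
      refine hn ?_
      have h0 : ∀ k, dft P (twist f M (-γ 1 1 / γ 1 0)) k = 0 := by
        intro k
        have := hl ((γ 1 0).sign * k)
        rwa [← mul_assoc, sign_mul_sign hc, one_mul, zero_mul] at this
      have := eq_zero_of_dft_eq_zero hP hF.periodic h0 n
      rw [twist] at this
      exact (mul_eq_zero.1 this).resolve_right (Complex.exp_ne_zero _)
    set w : ℂ → ℂ := fun τ => (γ 1 0).sign * (γ 1 0 * τ + γ 1 1) with hw
    -- The inversion formula contributes `‖w‖^(1/2)` to the bound, and `w` is bounded near `α`.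
    have hbw : ∀ᶠ T in 𝓝 (0 : ℂ), ‖w (α + T)‖ < ‖w α‖ + 1 := by
      have : ContinuousAt (fun T => ‖w (α + T)‖) 0 := by
        simp only [hw]
        fun_prop
      refine this.eventually_lt continuousAt_const ?_
      simp
    refine ⟨‖(√P : ℂ)‖ * ‖l‖⁻¹ * (‖w α‖ + 1) ^ (1 / 2 : ℝ), ?_⟩
    filter_upwards [nhdsWithin_le_nhds hbw, self_mem_nhdsWithin] with T hT hTc
    have hTi := im_pos_of_mem_cone one_pos hTc
    set τ : ℂ := α + T with hτ
    have hτi : 0 < τ.im := by simpa [hτ] using hTi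
    have hdual := h.thetaSeries_dft hM hpar hl 0 hτi
    have hφ := thetaSeries_eq_twist 0 f hM hP (-γ 1 1 / γ 1 0) τ
    have hc0 : (γ 1 0 : ℂ) ≠ 0 := by exact_mod_cast hc
    have hwτ : ((((γ 1 0).natAbs * M : ℕ) : ℝ) / M : ℝ) *
        (τ - ((-γ 1 1 / γ 1 0 : ℚ) : ℂ)) = w τ := by
      rw [natAbs_mul_div hM]
      simp only [hw]
      push_cast
      field_simp
      ring
    have hwi : 0 < (w τ).im := by
      have : w τ = (((γ 1 0).sign * γ 1 0 : ℤ) : ℝ) * τ + (((γ 1 0).sign * γ 1 1 : ℤ) : ℝ) := by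
        simp only [hw]
        push_cast
        ring
      rw [this, Complex.add_im, Complex.im_ofReal_mul, Complex.ofReal_im, add_zero]
      refine mul_pos ?_ hτi
      rw [Int.sign_mul_self_eq_natAbs]
      exact_mod_cast Int.natAbs_pos.2 hc
    rw [← hPdef] at hwτ hdual
    rw [hwτ, hF.thetaSeries_zero_functional_equation hwi] at hφ
    rw [show -1 / w τ = -1 / ((γ 1 0).sign * (γ 1 0 * τ + γ 1 1)) from rfl, hdual] at hφ
    have hs : ((γ 1 0).sign : ℂ) ^ (1 + 1) = 1 := by
      have := sign_mul_sign hc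
      rw [pow_succ, pow_one]
      exact_mod_cast this
    have hsq : ‖(√P : ℂ)‖ ≠ 0 := by
      rw [norm_ne_zero_iff]
      exact_mod_cast (Real.sqrt_pos.2 (by exact_mod_cast hP)).ne'
    have hw0 : 0 < ‖w τ‖ := norm_pos_iff.2 fun h0 => by simp [h0] at hwi
    change ‖thetaSeries 0 f M ((γ 0 0 * τ + γ 0 1) / (γ 1 0 * τ + γ 1 1))‖ ≤ _
    have hnorm : ∀ x y : ℂ, ‖(√P : ℂ)⁻¹ * invSqrt y * (l * x)‖ =
        ‖(√P : ℂ)‖⁻¹ * ‖y‖ ^ (-(1 / 2) : ℝ) * (‖l‖ * ‖x‖) := fun x y => by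
      rw [norm_mul, norm_mul, norm_mul l, norm_inv, norm_invSqrt]
    rw [hφ, hs, mul_one, hnorm]
    have h1 : ‖w τ‖ ^ (1 / 2 : ℝ) * ‖w τ‖ ^ (-(1 / 2) : ℝ) = 1 := by
      rw [← Real.rpow_add hw0]
      norm_num
    have h2 : ‖w τ‖ ^ (1 / 2 : ℝ) ≤ (‖w α‖ + 1) ^ (1 / 2 : ℝ) :=
      Real.rpow_le_rpow (norm_nonneg _) hT.le (by norm_num)
    have hln : ‖l‖ ≠ 0 := norm_ne_zero_iff.2 hl0
    have hy := norm_nonneg (thetaSeries 0 f M ((γ 0 0 * τ + γ 0 1) / (γ 1 0 * τ + γ 1 1)))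
    generalize ‖thetaSeries 0 f M ((γ 0 0 * τ + γ 0 1) / (γ 1 0 * τ + γ 1 1))‖ = y at hy ⊢
    calc y = ‖(√P : ℂ)‖ * ‖l‖⁻¹ * ‖w τ‖ ^ (1 / 2 : ℝ) *
          (‖(√P : ℂ)‖⁻¹ * ‖w τ‖ ^ (-(1 / 2) : ℝ) * (‖l‖ * y)) := by
          field_simp
          linear_combination (-y) * h1
      _ ≤ _ := mul_le_mul_of_nonneg_right (mul_le_mul_of_nonneg_left h2 (by positivity))
          (by positivity)

theorem act_mem_quantumSet (hM : 0 < M) (hf : Function.Periodic f (M : ℤ))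
    (hf0 : f 0 = 0) (hpar : (∀ n, f (-n) = -f n) ∨ ∀ n, f (-n) = f n)
    (hsupp : ∀ n : ℤ, f n ≠ 0 → n ^ 2 ≡ n₀ ^ 2 [ZMOD (2 * (M : ℤ))])
    {γ : SL(2, ℤ)} (hγ : γ ∈ CongruenceSubgroup.Gamma1 (2 * M)) {α : ℚ} (hJ : J γ α ≠ 0)
    (hα : α ∈ quantumSet f M) : act γ α ∈ quantumSet f M := by
  rcases hpar with hodd | hev
  · exact mem_quantumSet_of_odd hM hf hodd _
  by_cases h0 : ∀ n, f n = 0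
  · exact mem_quantumSet_of_odd hM hf (fun n => by simp [h0]) _
  push Not at h0
  obtain ⟨n, hn⟩ := h0
  obtain ⟨C, hC⟩ := exists_bound_moebius hM hf hf0 hev hsupp hn hγ α
  exact act_mem_quantumSet_of_bound hM hf hf0 hev hJ hα hC

theorem leavesInvariant_quantumSet (hM : 0 < M) (hf : Function.Periodic f (M : ℤ))
    (hf0 : f 0 = 0) (hpar : (∀ n, f (-n) = -f n) ∨ ∀ n, f (-n) = f n)
    (hsupp : ∀ n : ℤ, f n ≠ 0 → n ^ 2 ≡ n₀ ^ 2 [ZMOD (2 * (M : ℤ))]) :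
    LeavesInvariant (CongruenceSubgroup.Gamma1 (2 * M)) (quantumSet f M) := by
  rintro γ hγ x (rfl | ⟨α, hα, rfl⟩)
  · rw [OnePoint.smul_infty_eq_ite]
    split_ifs with h
    · exact Or.inl rfl
    · refine Or.inr ⟨_, ?_, rfl⟩
      have hc : γ 1 0 ≠ 0 := by
        rintro h0
        simp [h0] at h
      simpa using div_mem_quantumSet hM hf hf0 hsupp (isGammaOne_of_mem hγ hc)
  · by_cases hJ : J γ α = 0
    · left
      rw [OnePoint.smul_some_eq_ite, if_pos]
      simpa [J] using hJ
    · rw [mapGL_smul_coe γ α hJ]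
      exact Or.inr ⟨_, act_mem_quantumSet hM hf hf0 hpar hsupp hγ hJ hα, rfl⟩

end

end QuantumModular
end

noncomputable section
namespace QuantumModular

open Filter Asymptotics Topology PowerSeries

/-! ### Partial theta series as strong quantum modular forms -/

theorem ConeExpansion.hasAsymptoticExpansionAt {φ : ℂ → ℂ} {α : ℚ} {s : ℂ⟦X⟧}
    (h : ConeExpansion φ α s) : HasAsymptoticExpansionAt (fun τ => φ τ) α s := by
  intro δ hδ N
  -- For `δ > π / 2` there is no such argument. Otherwise the sector lies in the cone of opening
  -- `sin δ`, because `T.im = ‖T‖ sin (arg T)`.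
  rcases lt_or_ge (Real.pi - δ) δ with hlt | hle
  · exact ⟨0, 1, one_pos, fun τ _ hτ => absurd (hτ.1.trans hτ.2) hlt.not_ge⟩
  have hκ : 0 < Real.sin δ := Real.sin_pos_of_pos_of_lt_pi hδ (by linarith)
  obtain ⟨C, hC⟩ := (h _ hκ N).bound
  rw [eventually_nhdsWithin_iff, Metric.eventually_nhds_iff] at hC
  obtain ⟨r, hr, hC⟩ := hC
  refine ⟨C, r, hr, fun τ hτ harg => ?_⟩
  set T : ℂ := (τ : ℂ) - α with hT
  have hmem : T ∈ cone (Real.sin δ) := by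
    refine ⟨fun h0 => ?_, ?_⟩
    · rw [h0, Complex.arg_zero] at harg
      exact hδ.not_ge harg.1
    · rw [← Complex.norm_mul_sin_arg T, mul_comm]
      refine mul_le_mul_of_nonneg_left ?_ (norm_nonneg _)
      rcases le_total (Complex.arg T) (Real.pi / 2) with h1 | h1
      · exact Real.sin_le_sin_of_le_of_le_pi_div_two (by linarith) h1 harg.1
      · rw [← Real.sin_pi_sub (Complex.arg T)]
        exact Real.sin_le_sin_of_le_of_le_pi_div_two (by linarith) (by linarith)
          (by linarith [harg.2])
  have := hC (by simpa using hτ) hmem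
  rw [← Polynomial.eval₂_id, PowerSeries.eval₂_trunc_eq_sum_range, norm_pow] at this
  simpa [hT] using this

theorem partialTheta_eq_thetaSeries (j : ℕ) {f : ℤ → ℂ} (hf0 : f 0 = 0) (M : ℕ) (τ : ℍ) :
    partialTheta j f M τ = thetaSeries j f M τ := by
  have h0 : thetaTerm j f M (0 : ℕ) (τ : ℂ) = 0 := by simp [thetaTerm, hf0]
  rw [thetaSeries, ← tsum_subtype_eq_of_support_subset (s := {n : ℕ | 0 < n})]
  · refine tsum_congr fun n => ?_
    simp [thetaTerm]
    rfl
  · intro n hn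
    refine Nat.pos_of_ne_zero fun h => hn ?_
    rw [h]
    exact h0

variable {M : ℕ} {f : ℤ → ℂ} {n₀ : ℤ} {j : ℕ}

/-- The factor `M / (π i)` normalises the derivative so that it multiplies each term by `n ^ 2`. -/
theorem coneExpansion_derivFamily (hM : 0 < M) (hf : Function.Periodic f (M : ℤ)) (hf0 : f 0 = 0)
    {α : ℚ} {s : ℚ → ℂ⟦X⟧} (h : ConeExpansion (thetaSeries j f M) α (s α)) (m : ℕ) :
    ConeExpansion (thetaSeries (j + 2 * m) f M) α
      (derivFamily (M / (Real.pi * Complex.I)) s (m + 1) α) := by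
  obtain ⟨A, hA⟩ := exists_bound_of_periodic hM hf
  induction m with
  | zero => exact h
  | succ m ih =>
    have hα : (α : ℂ).im = 0 := by simp
    intro κ hκ
    have h1 := ConeExpansion.deriv hα (differentiableOn_thetaSeries hM hf hf0 _) ih κ hκ
    have hl := nhdsWithin_cone_le_nhds κ
    refine (HasExpansion.mul hl (hasExpansion_const hl _) h1).congr ?_
    filter_upwards [self_mem_nhdsWithin] with T hT
    have hTi : 0 < ((α : ℂ) + T).im := by simpa using im_pos_of_mem_cone hκ hT
    rw [(hasDerivAt_thetaSeries (by exact_mod_cast hM) hA hf0 hTi).deriv]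
    have hM' : (M : ℂ) ≠ 0 := by exact_mod_cast hM.ne'
    have hπ : (Real.pi : ℂ) ≠ 0 := by exact_mod_cast Real.pi_ne_zero
    push_cast
    field_simp [Complex.I_ne_zero]
    rfl

theorem isStrongQMF_thetaSeries (hj : j < 2) (hM : 0 < M)
    (hf : Function.Periodic f (M : ℤ)) (hf0 : f 0 = 0)
    (hpar : ∀ n, (-1) ^ (j + 1) * f (-n) = f n)
    (hpar' : (∀ n, f (-n) = -f n) ∨ ∀ n, f (-n) = f n)
    (hsupp : ∀ n : ℤ, f n ≠ 0 → n ^ 2 ≡ n₀ ^ 2 [ZMOD (2 * (M : ℤ))]) (m : ℕ) :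
    IsStrongQMF (fun τ => thetaSeries (j + 2 * m) f M τ) (quantumSet f M)
      (CongruenceSubgroup.Gamma1 (2 * M)) (m + 1) (2 * j + 1 + 4 * m) := by
  -- Outside the quantum set the series is irrelevant and set to `0`.
  have hs : ∀ α : ℚ, ∃ s, α ∈ quantumSet f M → ConeExpansion (thetaSeries j f M) α s := by
    intro α
    by_cases hα : α ∈ quantumSet f M
    · obtain ⟨s, hs⟩ := exists_coneExpansion_thetaSeries hj hM hf hf0 hpar hα
      exact ⟨s, fun _ => hs⟩
    · exact ⟨0, fun h => absurd h hα⟩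
  choose s hs using hs
  choose e g he using fun γ : CongruenceSubgroup.Gamma1 (2 * M) =>
    exists_hasDefect hj hM hf hf0 hpar hsupp γ.2
  refine ⟨leavesInvariant_quantumSet hM hf hf0 hpar' hsupp,
    derivFamily (M / (Real.pi * Complex.I)) s (m + 1), e, fun α hα =>
      (coneExpansion_derivFamily hM hf hf0 (hs α hα) m).hasAsymptoticExpansionAt,
    derivFamily_mem_strongQMF (fun γ => ⟨g γ, (he γ).1, fun α hα hJ => ?_⟩) m⟩
  exact defect_eq_taylorSeries hJ (hs α hα)
    (hs _ (act_mem_quantumSet hM hf hf0 hpar' hsupp γ.2 hJ hα)) ((he γ).1.analyticAt hJ)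
    ((he γ).2 α hJ)

end QuantumModular
end

/-! ### Reduction of the exponent to its parity -/

theorem mainTheorem8 (M : ℕ) (hM : 0 < M) (f : ℤ → ℂ) (hf : Function.Periodic f (M : ℤ))
    (hf0 : f 0 = 0) (n₀ : ℤ)
    (hsupp : ∀ n : ℤ, f n ≠ 0 → n ^ 2 ≡ n₀ ^ 2 [ZMOD (2 * (M : ℤ))])
    (j : ℕ)
    (hpar : (Even j ∧ Function.Odd f) ∨ (Odd j ∧ Function.Even f)) :
    QuantumModular.IsStrongQMF (QuantumModular.partialTheta j f M)
      (QuantumModular.quantumSet f M) (CongruenceSubgroup.Gamma1 (2 * M))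
      (j / 2 + 1) (2 * (j : ℤ) + 1) := by
  rw [show QuantumModular.partialTheta j f M =
    fun τ : UpperHalfPlane => QuantumModular.thetaSeries j f M τ from
      funext (QuantumModular.partialTheta_eq_thetaSeries j hf0 M)]
  -- The exponent is `2 m` or `2 m + 1`, so in both cases `j / 2 = m` counts the derivatives taken
  -- of the base series.
  rcases hpar with ⟨⟨m, rfl⟩, hodd⟩ | ⟨⟨m, rfl⟩, heven⟩
  · have := QuantumModular.isStrongQMF_thetaSeries (j := 0) (by norm_num) hM hf hf0
      (fun n => by rw [hodd]; simp) (.inl hodd) hsupp m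
    convert this using 1
    · simp only [two_mul, zero_add]
    · omega
    · push_cast
      ring
  · have := QuantumModular.isStrongQMF_thetaSeries (j := 1) (by norm_num) hM hf hf0
      (fun n => by rw [heven]; simp) (.inr heven) hsupp m
    convert this using 1
    · simp only [add_comm]
    · omega
    · push_cast
      ring
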